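/- Let $\langle\cdot,\cdot\rangle$ be the inner product of $L_2([0,1])$, let $x\in L_2([0,1])$, let $\mathcal N$ be the open ball of radius $\delta\in(0,1)$ around $x$, and let $\{\varphi_j\}_{j\ge1}$ be an orthonormal basis of $L_2([0,1])$. Let $(X_j,Y_j)$, $j\ge 1$, be i.i.d. with $X_j\in L_2([0,1])$ and $Y_j=g(X_j)+\varepsilon_j$, where $g:L_2([0,1])\to\mathbb R$ is measurable, $E[\varepsilon_j\mid X_j]=0$ and $E[\varepsilon_j^2\mid X_j]\le\sigma^2$. **Estimator.** For integers $J,K$ let $\mathcal K=\{\mathbf k\in\mathbb N_0^J: k_1+\dots+k_J\le K-1\}$, $\xi_{j;\mathbf k}=\prod_{l=1}^J\langle X_j-x,\varphi_l\rangle^{k_l}$, $\mathcal Y=(\sum_{j=1}^n 1_{\mathcal N}(X_j)\xi_{j;\mathbf k}Y_j)_{\mathbf k\in\mathcal K}$, $\mathcal M=(\sum_{j=1}^n1_{\mathcal N}(X_j)\xi_{j;\mathbf k}\xi_{j;\mathbf k'})_{\mathbf k,\mathbf k'\in\mathcal K}$, and let $\mathcal S$ be the diagonal matrix with entries $1/\binom{|\mathbf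 k|}{k_1,\dots,k_J}$. Put $\hat g(x)=\mathbf e_0^\dagger(\mathcal M+\mathcal S)^{-1}\mathcal Y$, where $\mathbf e_0$ is the unit vector of the multi-index $0$. **Assumptions**, with positive constants $C_{Fre},C_{\Gamma,1},C_{\Gamma,2},\gamma,p_0,c_1,c_2,\sigma$: 1. $g$ is infinitely often Fréchet differentiable on $\mathcal N$, and $\|g^{(k)}(y;\cdot)\|\le C_{Fre}$ for all $k\ge0$ and $y\in\mathcal N$ (norm of multilinear maps). 2. $\sum_{j\ge1}\exp(C_{\Gamma,1}j^\gamma)\langle\varphi_j,\Gamma_{\mathcal N}\varphi_j\rangle\le C_{\Gamma,2}$, where $\Gamma_{\mathcal N}=E[(X_1-x)\otimes(X_1-x)\mid X_1\in\mathcal N]$. 3. $P[X_1\in\mathcal N]\ge p_0$. 4. For the dimension $J$ that is used, there is a norm $\|\cdot\|_\lambda$ on $\mathbb R^J$ such that, with $V=(\langle X_1-x,\varphi_l\rangle)_{l\le J}$ and $W=V/\|V\|_\lambda$, whenever $P[X_1\in\mathcal N\mid W]>0$ the random probability measure $A\mapsto E(1_{\mathcal N}(X_1)1_A(\|V\|_\lambda)\mid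 W)/P[X_1\in\mathcal N\mid W]$ has a Lebesgue density $p(\cdot;W)$, and $$P\Big[X_1\in\mathcal N,\ \sup_{t>0}t\,p(t;W)\le c_1J\Big]\ \ge\ P[X_1\in\mathcal N]/c_2 .$$ **Claim.** Consider, for $D_0,D_1>0$, the conditions $$\gamma D_0>1;\qquad (4c_1+1)D_0<1\ \text{ and }\ 2D_1\big(1-(4c_1+1)D_0\big)>1;\qquad (8c_1+3)D_0D_1<1. \tag{$*$}$$ (a) For every $c_1>0$ there is $\gamma_0>0$ such that for every $\gamma>\gamma_0$ some $D_0,D_1>0$ satisfy $(*)$. (b) Let $D_0,D_1>0$ satisfy $(*)$, let $J=J_n\asymp(\log n)^{D_0}$ and $K=K_n=\lfloor D_1\log n/\log\log n\rfloor$. Then, for every $\kappa<1-(8c_1+3)D_0D_1$ (in particular for some $\kappa>0$), $$|\hat g(x)-g(x)|^2=O_P(n^{-\kappa}),$$ uniformly over all models as above with the given constants: for every $\epsilon>0$ there are $M>0$ and $n_0$, depending only on $\epsilon$, $\delta$, $\kappa$, $D_0$, $D_1$, the sequence $(J_n)$ and the constants in the assumptions, such that $P[|\hat g(x)-g(x)|^2>Mn^{-\kappa}]\le\epsilon$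 for all $n\ge n_0$ and all such distributions of $(X_1,Y_1)$, $g$, $x$ and $\{\varphi_j\}$. -/

import Mathlib

open MeasureTheory ProbabilityTheory Filter Topology
open scoped ENNReal

noncomputable section

namespace FunctionalLocPoly

/-- The real Hilbert space `L₂([0,1])`. -/
abbrev L2 : Type := Lp ℝ 2 (volume.restrict (Set.Icc (0 : ℝ) 1))

instance instMeasurableSpaceL2 : MeasurableSpace L2 := borel L2

instance instBorelSpaceL2 : BorelSpace L2 := ⟨rfl⟩

/-! ### The estimator

An orthonormal basis is a `HilbertBasis ℕ ℝ L2`; `φ l` for `l : ℕ` is the basis function which is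
usually written with the index `l + 1`. The neighbourhood of `x` of radius `δ` is
`Metric.ball x δ`. -/

/-- The vector of the first `J` coordinates `⟨u, φ_l⟩` of `u`. -/
def coords (φ : HilbertBasis ℕ ℝ L2) (J : ℕ) (u : L2) : Fin J → ℝ :=
  fun l => inner ℝ u (φ (l : ℕ))

/-- The set of multi-indices `k ∈ ℕ₀^J` with `k_1 + ⋯ + k_J ≤ K - 1` (empty if `K = 0`). -/
def multiIndices (J K : ℕ) : Finset (Fin J → ℕ) :=
  (Fintype.piFinset fun _ => Finset.range K).filter fun k => ∑ l, k l < K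

/-- Sanity check: membership is the condition on the sum only. -/
theorem mem_multiIndices {J K : ℕ} {k : Fin J → ℕ} :
    k ∈ multiIndices J K ↔ ∑ l, k l < K := by
  simp only [multiIndices, Finset.mem_filter, Fintype.mem_piFinset, Finset.mem_range,
    and_iff_right_iff_imp]
  intro h l
  exact lt_of_le_of_lt (Finset.single_le_sum (fun _ _ => Nat.zero_le _) (Finset.mem_univ l)) h

/-- The monomial `∏_l ⟨u - x, φ_l⟩^{k_l}` at the design point `u`. -/
def monomial (φ : HilbertBasis ℕ ℝ L2) (x : L2) {J : ℕ} (k : Fin J → ℕ) (u : L2) : ℝ :=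
  ∏ l, coords φ J (u - x) l ^ k l

/-- The indicator function of the neighbourhood of `x` of radius `δ`. -/
def nbhdInd (x : L2) (δ : ℝ) : L2 → ℝ := (Metric.ball x δ).indicator fun _ => 1

/-- The matrix with entries `∑_{j ≤ n} 1(X_j ∈ N) ξ_{j;k} ξ_{j;k'}`. -/
def gramMatrix (φ : HilbertBasis ℕ ℝ L2) (x : L2) (δ : ℝ) (J K n : ℕ) (X : ℕ → L2) :
    Matrix (multiIndices J K) (multiIndices J K) ℝ :=
  Matrix.of fun k k' => ∑ j ∈ Finset.range n,
    nbhdInd x δ (X j) * monomial φ x k.1 (X j) * monomial φ x k'.1 (X j)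

/-- The vector with entries `∑_{j ≤ n} 1(X_j ∈ N) ξ_{j;k} Y_j`. -/
def responseVector (φ : HilbertBasis ℕ ℝ L2) (x : L2) (δ : ℝ) (J K n : ℕ)
    (X : ℕ → L2) (Y : ℕ → ℝ) : multiIndices J K → ℝ :=
  fun k => ∑ j ∈ Finset.range n, nbhdInd x δ (X j) * monomial φ x k.1 (X j) * Y j

/-- The diagonal ridge matrix, whose entries are the reciprocals of the multinomial coefficients
`|k|! / (k_1! ⋯ k_J!)`. -/
def ridgeMatrix (J K : ℕ) : Matrix (multiIndices J K) (multiIndices J K) ℝ :=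
  Matrix.diagonal fun k => ((Nat.multinomial Finset.univ k.1 : ℕ) : ℝ)⁻¹

/-- The unit vector which belongs to the multi-index `0`. -/
def unitZero (J K : ℕ) : multiIndices J K → ℝ := fun k => if k.1 = 0 then 1 else 0

/-- The functional local polynomial estimator `e₀ᵀ (M + S)⁻¹ 𝒴` of `g(x)`, based on the first `n`
observations. -/
def estimator (φ : HilbertBasis ℕ ℝ L2) (x : L2) (δ : ℝ) (J K n : ℕ)
    (X : ℕ → L2) (Y : ℕ → ℝ) : ℝ :=
  unitZero J K ⬝ᵥ
    Matrix.mulVec (gramMatrix φ x δ J K n X + ridgeMatrix J K)⁻¹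
      (responseVector φ x δ J K n X Y)

/-! ### The assumptions -/

/-- The regression model: the pairs `(X_j, Y_j)` are i.i.d., and the errors `Y_j - g(X_j)` are
conditionally centered given `X_j` with conditional variance at most `σ²`. -/
structure IsRegressionModel {Ω : Type*} [MeasurableSpace Ω] (P : Measure Ω)
    (X : ℕ → Ω → L2) (Y : ℕ → Ω → ℝ) (g : L2 → ℝ) (σ : ℝ) : Prop where
  measurable_X : ∀ j, Measurable (X j)
  measurable_Y : ∀ j, Measurable (Y j)
  measurable_g : Measurable g
  indep : iIndepFun (fun j ω => (X j ω, Y j ω)) P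
  identDistrib : ∀ j, IdentDistrib (fun ω => (X j ω, Y j ω)) (fun ω => (X 0 ω, Y 0 ω)) P P
  memLp_error : ∀ j, MemLp (fun ω => Y j ω - g (X j ω)) 2 P
  centered : ∀ j, P[fun ω => Y j ω - g (X j ω) |
    MeasurableSpace.comap (X j) inferInstance] =ᵐ[P] 0
  variance_le : ∀ j, P[fun ω => (Y j ω - g (X j ω)) ^ 2 |
    MeasurableSpace.comap (X j) inferInstance] ≤ᵐ[P] fun _ => σ ^ 2

/-- `g` is infinitely often Fréchet differentiable on the neighbourhood of `x` of radius `δ`, and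
all its derivatives, of all orders `≥ 0`, are bounded there by `C` in the norm of multilinear
maps. -/
def HasBoundedDerivs (g : L2 → ℝ) (x : L2) (δ C : ℝ) : Prop :=
  ContDiffOn ℝ ((⊤ : ℕ∞) : WithTop ℕ∞) g (Metric.ball x δ) ∧
    ∀ k : ℕ, ∀ y ∈ Metric.ball x δ, ‖iteratedFDeriv ℝ k g y‖ ≤ C

/-- The operator `E((Z - x) ⊗ (Z - x) | Z ∈ N)` on `L₂([0,1])`. -/
def localCov {Ω : Type*} [MeasurableSpace Ω] (P : Measure Ω) (Z : Ω → L2) (x : L2) (δ : ℝ) :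
    L2 →L[ℝ] L2 :=
  ∫ ω, InnerProductSpace.rankOne ℝ (Z ω - x) (Z ω - x) ∂(P[|Z ⁻¹' Metric.ball x δ])

/-- `∑_{j ≥ 1} exp(C₁ j^γ) ⟨φ_j, Γ φ_j⟩ ≤ C₂` for the operator `Γ = localCov P Z x δ`. -/
def CovDecay {Ω : Type*} [MeasurableSpace Ω] (P : Measure Ω) (Z : Ω → L2) (x : L2) (δ : ℝ)
    (φ : HilbertBasis ℕ ℝ L2) (C₁ C₂ γ : ℝ) : Prop :=
  Summable (fun j : ℕ => Real.exp (C₁ * ((j + 1 : ℕ) : ℝ) ^ γ) *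
      inner ℝ (φ j) (localCov P Z x δ (φ j))) ∧
    ∑' j : ℕ, Real.exp (C₁ * ((j + 1 : ℕ) : ℝ) ^ γ) *
      inner ℝ (φ j) (localCov P Z x δ (φ j)) ≤ C₂

/-- The radius of the first `J` coordinates of `Z - x` with respect to the norm `N`. -/
def radius {Ω : Type*} (Z : Ω → L2) (x : L2) (φ : HilbertBasis ℕ ℝ L2) {J : ℕ}
    (N : Seminorm ℝ (Fin J → ℝ)) (ω : Ω) : ℝ :=
  N (coords φ J (Z ω - x))

/-- The direction of the first `J` coordinates of `Z - x`, normalized with respect to `N`. -/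
def direction {Ω : Type*} (Z : Ω → L2) (x : L2) (φ : HilbertBasis ℕ ℝ L2) {J : ℕ}
    (N : Seminorm ℝ (Fin J → ℝ)) (ω : Ω) : Fin J → ℝ :=
  (radius Z x φ N ω)⁻¹ • coords φ J (Z ω - x)

/-- The conditional probability `P[Z ∈ N | direction]`. -/
def condNbhdProb {Ω : Type*} [MeasurableSpace Ω] (P : Measure Ω) (Z : Ω → L2) (x : L2) (δ : ℝ)
    (φ : HilbertBasis ℕ ℝ L2) {J : ℕ} (N : Seminorm ℝ (Fin J → ℝ)) : Ω → ℝ :=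
  P[fun ω => nbhdInd x δ (Z ω) |
    MeasurableSpace.comap (direction Z x φ N) inferInstance]

/-- The random probability measure
`A ↦ E(1(Z ∈ N) 1_A(radius) | direction) / P[Z ∈ N | direction]`, evaluated at a set `A`. -/
def condRadiusProb {Ω : Type*} [MeasurableSpace Ω] (P : Measure Ω) (Z : Ω → L2) (x : L2) (δ : ℝ)
    (φ : HilbertBasis ℕ ℝ L2) {J : ℕ} (N : Seminorm ℝ (Fin J → ℝ)) (A : Set ℝ) : Ω → ℝ :=
  fun ω =>
    (P[fun ω' => nbhdInd x δ (Z ω') * A.indicator (fun _ => (1 : ℝ)) (radius Z x φ N ω') |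
      MeasurableSpace.comap (direction Z x φ N) inferInstance]) ω /
    condNbhdProb P Z x δ φ N ω

/-- For some norm `N` on `ℝ^J`, the conditional law of the radius on `Z ∈ N` given the direction
has, whenever `P[Z ∈ N | direction] > 0`, a Lebesgue density `p(· ; direction)` with
`P[Z ∈ N, sup_{t > 0} t p(t ; direction) ≤ c₁ J] ≥ P[Z ∈ N] / c₂`. -/
def RadialDensityCondition {Ω : Type*} [MeasurableSpace Ω] (P : Measure Ω) (Z : Ω → L2)
    (x : L2) (δ : ℝ) (φ : HilbertBasis ℕ ℝ L2) (c₁ c₂ : ℝ) (J : ℕ) : Prop :=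
  ∃ N : Seminorm ℝ (Fin J → ℝ), (∀ v, N v = 0 → v = 0) ∧
    ∃ p : (Fin J → ℝ) → ℝ → ℝ,
      Measurable (Function.uncurry p) ∧ (∀ w t, 0 ≤ p w t) ∧
      (∀ A : Set ℝ, MeasurableSet A → ∀ᵐ ω ∂P, 0 < condNbhdProb P Z x δ φ N ω →
        condRadiusProb P Z x δ φ N A ω = ∫ t in A, p (direction Z x φ N ω) t) ∧
      P.real {ω | Z ω ∈ Metric.ball x δ} / c₂ ≤
        P.real {ω | Z ω ∈ Metric.ball x δ ∧
          ∀ t : ℝ, 0 < t → t * p (direction Z x φ N ω) t ≤ c₁ * J}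

/-- The conditions on the constants `D₀`, `D₁` in the choice of `J` and `K`. -/
structure TuningConditions (c₁ γ D₀ D₁ : ℝ) : Prop where
  one_lt : 1 < γ * D₀
  lt_one : (4 * c₁ + 1) * D₀ < 1
  one_lt' : 1 < 2 * D₁ * (1 - (4 * c₁ + 1) * D₀)
  lt_one' : (8 * c₁ + 3) * D₀ * D₁ < 1

/-- The degree parameter `K = ⌊D₁ log n / log log n⌋`. -/
def degreeParam (D₁ : ℝ) (n : ℕ) : ℕ :=
  ⌊D₁ * Real.log n / Real.log (Real.log n)⌋₊

end FunctionalLocPoly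

end

/-!
The estimator is a ridge regression on the monomials in the first `J` coordinates of `X - x`, and
the proof is a bias-variance decomposition on an event on which the regression matrix is controlled.
Write `A = M + S`, `v = A⁻¹ e₀` and `D = e₀ᵀ A⁻¹ e₀ = vᵀ A v`, and let `θ` be the coefficients of
the Taylor polynomial of `g` at `x` in the coordinates, so that `e₀ᵀ θ = g(x)`. The error of the
estimator is `-vᵀ S θ` plus weighted sums of the Taylor remainders and of the regression errors, and
all three parts are controlled by `D` (`ridge_error_sq_le`): the penalty by `D θᵀ S θ`, the
remainders by `D` times their sum of squares, and the variance of the noise by `σ² D`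
(`noise_second_moment`, which uses that `v` is a function of the design). So everything depends on
an upper bound for `D`.

**The size of `D`.** With `G` the second moment matrix of the monomials on the neighbourhood, the
empirical matrix satisfies `M + (s/2) S ≥ n G / 2` with high probability as soon as `s` is large
compared with the number of monomials (`gram_lower_bound`). This is a second moment bound after
whitening by `n G + s S`. It needs that `ξᵀ S⁻¹ ξ` is bounded, which is the reason for the
multinomial weights in `S`: by the multinomial theorem `ξᵀ S⁻¹ ξ` is a geometric series in the
squared norm of the coordinates (`sum_monomial_sq_mul_multinomial_le`). Hence `D` is at most
`s / (n m)` if `vᵀ G v ≥ m v₀²` for all `v`.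

**The smallest value of `G`.** On a ray the polynomial with coefficients `v` is a polynomial `q` in
one variable with `q(0) = v₀` (`rayPolynomial`), and with probability at least
`P[X ∈ N] / c₂ ≥ p₀ / c₂` the design point lies in the neighbourhood and the radial density `p` of
its direction satisfies `t p(t) ≤ c₁ J`. If `q(0) = 1`, then `q` is a product of at most `K` factors
`1 - t / z`. The positive part of `-log |1 - t / |z||`, which dominates `-log |1 - t / z|`, has a
mean of at most `log (2 B) + 2` under a density with `t p(t) ≤ B`. By Markov's inequality `|q|`
exceeds `smallValueLevel K B = exp (-(3 / 2) K (log (2 B) + 2))` with probability at least `1 / 3`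
(`lintegral_small_values_le`). Integrating over the directions gives
`m = (p₀ / (3 c₂)) exp (-3 K (log (2 B) + 2))` with `B = max 1 (c₁ J)` (`design_second_moment`).

**Bias.** The Taylor remainder has a part of order `1 / (K - 1)!` and a part which is caused by the
truncation to `J` coordinates (`abs_sub_monomials_dotProduct_le`), whose mean square is at most
`C₂ exp (-C₁ J ^ γ)` by the decay of the covariance operator (`integral_truncation_error_le`). The
penalty satisfies `θᵀ S θ ≤ C² exp (2 √J)` (`sum_taylorCoeff_sq_div_multinomial_le`).

**The rate.** All this is put together in `finite_sample_bound`. With `J` of order `(log n) ^ D₀`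
and `K ∼ D₁ log n / log log n`, the bound for `D` is `n ^ (-1 + 3 D₀ D₁ + o(1))`
(`eventually_cost_le`), which is `o(n ^ (-κ))` even after multiplication with the bound for the
penalty, while the sums of the squared remainders stay bounded in mean. Since `3 D₀ D₁` is smaller
than `(8 c₁ + 3) D₀ D₁`, the condition on `κ` leaves room to spare.
-/

namespace FunctionalLocPoly

/-! ### Ridge regression with a weighted Gram matrix -/

section Ridge

variable {ι α : Type*}

/-- The Gram matrix `∑_j w_j ξ_j ξ_jᵀ` of the vectors `ξ_j` with weights `w_j`. -/
def weightedGram (s : Finset α) (w : α → ℝ) (ξ : α → ι → ℝ) : Matrix ι ι ℝ :=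
  Matrix.of fun k k' => ∑ j ∈ s, w j * ξ j k * ξ j k'

theorem weightedGram_isSymm (s : Finset α) (w : α → ℝ) (ξ : α → ι → ℝ) :
    (weightedGram s w ξ).IsSymm := by
  ext i k
  simp only [weightedGram, Matrix.transpose_apply, Matrix.of_apply]
  exact Finset.sum_congr rfl fun j _ => by ring

/-- The ridge matrix `∑_j w_j ξ_j ξ_jᵀ + diag d`. -/
def ridgeGram [DecidableEq ι] (s : Finset α) (w : α → ℝ) (ξ : α → ι → ℝ) (d : ι → ℝ) :
    Matrix ι ι ℝ :=
  weightedGram s w ξ + Matrix.diagonal d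

theorem ridgeGram_isSymm [DecidableEq ι] (s : Finset α) (w : α → ℝ) (ξ : α → ι → ℝ) (d : ι → ℝ) :
    (ridgeGram s w ξ d).IsSymm :=
  (weightedGram_isSymm s w ξ).add (Matrix.isSymm_diagonal d)

variable [Fintype ι]

theorem weightedGram_mulVec (s : Finset α) (w : α → ℝ) (ξ : α → ι → ℝ) (v : ι → ℝ) :
    Matrix.mulVec (weightedGram s w ξ) v = fun k => ∑ j ∈ s, w j * ξ j k * (ξ j ⬝ᵥ v) := by
  ext k
  simp only [weightedGram, Matrix.mulVec, dotProduct, Matrix.of_apply, Finset.sum_mul,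
    Finset.mul_sum]
  rw [Finset.sum_comm]
  refine Finset.sum_congr rfl fun j _ => Finset.sum_congr rfl fun i _ => by ring

theorem dotProduct_weightedGram_mulVec (s : Finset α) (w : α → ℝ) (ξ : α → ι → ℝ) (u v : ι → ℝ) :
    u ⬝ᵥ Matrix.mulVec (weightedGram s w ξ) v = ∑ j ∈ s, w j * (ξ j ⬝ᵥ u) * (ξ j ⬝ᵥ v) := by
  rw [weightedGram_mulVec]
  simp only [dotProduct, Finset.mul_sum, Finset.sum_mul]
  rw [Finset.sum_comm]
  refine Finset.sum_congr rfl fun j _ => ?_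
  rw [Finset.sum_comm]
  refine Finset.sum_congr rfl fun i _ => Finset.sum_congr rfl fun i _ => by ring

variable [DecidableEq ι]

theorem dotProduct_ridgeGram_mulVec (s : Finset α) (w : α → ℝ) (ξ : α → ι → ℝ) (d u v : ι → ℝ) :
    u ⬝ᵥ Matrix.mulVec (ridgeGram s w ξ d) v =
      ∑ j ∈ s, w j * (ξ j ⬝ᵥ u) * (ξ j ⬝ᵥ v) + ∑ k, d k * u k * v k := by
  rw [ridgeGram, Matrix.add_mulVec, dotProduct_add, dotProduct_weightedGram_mulVec]
  congr 1
  simp only [dotProduct, Matrix.mulVec_diagonal]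
  exact Finset.sum_congr rfl fun k _ => by ring

theorem ridgeGram_posDef {s : Finset α} {w : α → ℝ} (ξ : α → ι → ℝ) {d : ι → ℝ}
    (hw : ∀ j, 0 ≤ w j) (hd : ∀ k, 0 < d k) : (ridgeGram s w ξ d).PosDef := by
  refine Matrix.PosDef.of_dotProduct_mulVec_pos ?_ fun v hv => ?_
  · rw [Matrix.IsHermitian, Matrix.conjTranspose_eq_transpose_of_trivial]
    exact ridgeGram_isSymm s w ξ d
  · rw [star_trivial, dotProduct_ridgeGram_mulVec]
    obtain ⟨k, hk⟩ := Function.ne_iff.1 hv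
    refine add_pos_of_nonneg_of_pos (Finset.sum_nonneg fun j _ => ?_) ?_
    · rw [mul_assoc]
      exact mul_nonneg (hw j) (mul_self_nonneg _)
    · refine Finset.sum_pos' (fun i _ => ?_) ⟨k, Finset.mem_univ k, ?_⟩
      · rw [mul_assoc]
        exact mul_nonneg (hd i).le (mul_self_nonneg _)
      · rw [mul_assoc]
        exact mul_pos (hd k) (mul_self_pos.2 hk)

variable {s : Finset α} {w : α → ℝ} {ξ : α → ι → ℝ} {d : ι → ℝ}

/-- The weights of the ridge estimator of the linear functional `e`. -/
noncomputable def ridgeWeights (s : Finset α) (w : α → ℝ) (ξ : α → ι → ℝ) (d e : ι → ℝ) :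
    ι → ℝ :=
  Matrix.mulVec (ridgeGram s w ξ d)⁻¹ e

theorem ridgeGram_mulVec_ridgeWeights (hw : ∀ j, 0 ≤ w j) (hd : ∀ k, 0 < d k) (e : ι → ℝ) :
    Matrix.mulVec (ridgeGram s w ξ d) (ridgeWeights s w ξ d e) = e := by
  have hu := (Matrix.isUnit_iff_isUnit_det _).1 (ridgeGram_posDef (s := s) ξ hw hd).isUnit
  rw [ridgeWeights, Matrix.mulVec_mulVec, Matrix.mul_nonsing_inv _ hu, Matrix.one_mulVec]

/-- The quadratic form of the ridge matrix at `v = ridgeWeights` is `vᵀ e`; both sums are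
nonnegative, so `vᵀ e` bounds each of them. -/
theorem ridgeWeights_energy (hw : ∀ j, 0 ≤ w j) (hd : ∀ k, 0 < d k) (e : ι → ℝ) :
    ∑ j ∈ s, w j * (ξ j ⬝ᵥ ridgeWeights s w ξ d e) ^ 2
      + ∑ k, d k * ridgeWeights s w ξ d e k ^ 2 = ridgeWeights s w ξ d e ⬝ᵥ e := by
  have h := dotProduct_ridgeGram_mulVec s w ξ d (ridgeWeights s w ξ d e) (ridgeWeights s w ξ d e)
  rw [ridgeGram_mulVec_ridgeWeights hw hd] at h
  rw [h]
  simp only [pow_two, mul_assoc]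

/-- The error decomposition of ridge regression: shrinkage and residuals. -/
theorem ridge_error (hw : ∀ j, 0 ≤ w j) (hd : ∀ k, 0 < d k) (e θ : ι → ℝ) (Y : α → ℝ) :
    e ⬝ᵥ Matrix.mulVec (ridgeGram s w ξ d)⁻¹ (fun k => ∑ j ∈ s, w j * ξ j k * Y j) - e ⬝ᵥ θ =
      ∑ j ∈ s, w j * (ξ j ⬝ᵥ ridgeWeights s w ξ d e) * (Y j - ξ j ⬝ᵥ θ)
        - ∑ k, d k * ridgeWeights s w ξ d e k * θ k := by
  have h1 : e ⬝ᵥ Matrix.mulVec (ridgeGram s w ξ d)⁻¹ (fun k => ∑ j ∈ s, w j * ξ j k * Y j)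
      = ∑ j ∈ s, w j * (ξ j ⬝ᵥ ridgeWeights s w ξ d e) * Y j := by
    have hsymm : ((ridgeGram s w ξ d)⁻¹).transpose = (ridgeGram s w ξ d)⁻¹ := by
      rw [Matrix.transpose_nonsing_inv, (ridgeGram_isSymm s w ξ d).eq]
    rw [← hsymm, Matrix.dotProduct_transpose_mulVec]
    change (fun k => ∑ j ∈ s, w j * ξ j k * Y j) ⬝ᵥ ridgeWeights s w ξ d e = _
    simp only [dotProduct, Finset.sum_mul, Finset.mul_sum]
    rw [Finset.sum_comm]
    exact Finset.sum_congr rfl fun j _ => Finset.sum_congr rfl fun i _ => by ring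
  have h2 : e ⬝ᵥ θ = θ ⬝ᵥ Matrix.mulVec (ridgeGram s w ξ d) (ridgeWeights s w ξ d e) := by
    rw [ridgeGram_mulVec_ridgeWeights hw hd, dotProduct_comm]
  rw [h1, h2, dotProduct_ridgeGram_mulVec]
  simp only [mul_sub, Finset.sum_sub_distrib]
  rw [sub_sub]
  congr 1
  congr 1
  · exact Finset.sum_congr rfl fun j _ => by ring
  · exact Finset.sum_congr rfl fun j _ => by ring

/-- Weighted Cauchy–Schwarz inequality. -/
theorem sq_sum_weight_mul_le {β : Type*} (t : Finset β) {c : β → ℝ} (hc : ∀ j, 0 ≤ c j)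
    (a b : β → ℝ) :
    (∑ j ∈ t, c j * a j * b j) ^ 2 ≤ (∑ j ∈ t, c j * a j ^ 2) * ∑ j ∈ t, c j * b j ^ 2 := by
  refine Finset.sum_sq_le_sum_mul_sum_of_sq_le_mul t (fun j _ => mul_nonneg (hc j) (sq_nonneg _))
    (fun j _ => mul_nonneg (hc j) (sq_nonneg _)) fun j _ => le_of_eq (by ring)

/-- If `e` reads off one coordinate and the ridge quadratic form dominates `c v_e²`, then the
weights have energy at most `c⁻¹`. -/
theorem ridgeWeights_energy_le (hw : ∀ j, 0 ≤ w j) (hd : ∀ k, 0 < d k) (e : ι → ℝ) {c : ℝ}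
    (hc : 0 < c)
    (h : ∀ v : ι → ℝ, c * (v ⬝ᵥ e) ^ 2 ≤
      ∑ j ∈ s, w j * (ξ j ⬝ᵥ v) ^ 2 + ∑ k, d k * v k ^ 2) :
    ridgeWeights s w ξ d e ⬝ᵥ e ≤ c⁻¹ := by
  have h1 := h (ridgeWeights s w ξ d e)
  rw [ridgeWeights_energy hw hd] at h1
  set D := ridgeWeights s w ξ d e ⬝ᵥ e
  rw [← one_div, le_div_iff₀ hc]
  by_contra! hlt
  have hD : 0 < D := by
    by_contra! hD
    nlinarith
  nlinarith

end Ridge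

/-! ### Small values of polynomials under log-bounded densities -/

section SmallValues

/-- The positive part of `-log |u|` has integral at most `2` over the real line. -/
theorem lintegral_neg_log_le : ∫⁻ u : ℝ, ENNReal.ofReal (-Real.log u) ≤ 2 := by
  have h1 : ∫⁻ u : ℝ, ENNReal.ofReal (-Real.log u) =
      ∫⁻ u in Set.Ioc (-1 : ℝ) 1, ENNReal.ofReal (-Real.log u) := by
    rw [← lintegral_indicator measurableSet_Ioc]
    refine lintegral_congr_ae ?_
    have hne : ∀ᵐ u : ℝ, u ≠ -1 := by simp [ae_iff]
    filter_upwards [hne] with u hu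
    by_cases hmem : u ∈ Set.Ioc (-1 : ℝ) 1
    · rw [Set.indicator_of_mem hmem]
    · rw [Set.indicator_of_notMem hmem, ENNReal.ofReal_eq_zero]
      have h1u : 1 ≤ |u| := by
        rw [Set.mem_Ioc, not_and_or] at hmem
        rcases hmem with h | h
        · rw [le_abs]; right; linarith
        · rw [le_abs]; left; linarith
      have := Real.log_nonneg h1u
      rw [Real.log_abs] at this
      linarith
  have hint : IntegrableOn (fun u : ℝ => -Real.log u) (Set.Ioc (-1) 1) :=
    ((intervalIntegrable_iff_integrableOn_Ioc_of_le (by norm_num)).1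
      intervalIntegral.intervalIntegrable_log').neg
  rw [h1, ← ofReal_integral_eq_lintegral_ofReal hint]
  · rw [← intervalIntegral.integral_of_le (by norm_num), intervalIntegral.integral_neg,
      integral_log]
    simp
    norm_num
  · refine (ae_restrict_iff' measurableSet_Ioc).2 (ae_of_all _ fun u hu => ?_)
    have : |u| ≤ 1 := abs_le.2 ⟨hu.1.le, hu.2⟩
    have := Real.log_nonpos (abs_nonneg u) this
    rw [Real.log_abs] at this
    simpa using this

theorem lintegral_neg_log_affine_le {c : ℝ} (hc : 0 < c) (a : ℝ) :
    ∫⁻ t : ℝ, ENNReal.ofReal (-Real.log (c * (t - a))) ≤ ENNReal.ofReal (2 / c) := by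
  have hm : Measurable fun u : ℝ => ENNReal.ofReal (-Real.log u) :=
    Real.measurable_log.neg.ennreal_ofReal
  rw [lintegral_sub_right_eq_self (fun t : ℝ => ENNReal.ofReal (-Real.log (c * t))) a]
  have h := lintegral_map (μ := volume) hm (measurable_const_mul c)
  rw [Real.map_volume_mul_left hc.ne', lintegral_smul_measure] at h
  rw [← h, abs_of_pos (inv_pos.2 hc), smul_eq_mul]
  calc ENNReal.ofReal c⁻¹ * ∫⁻ u : ℝ, ENNReal.ofReal (-Real.log u)
      ≤ ENNReal.ofReal c⁻¹ * ENNReal.ofReal 2 := by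
        gcongr
        simpa using lintegral_neg_log_le
    _ = ENNReal.ofReal (2 / c) := by
        rw [← ENNReal.ofReal_mul (inv_nonneg.2 hc.le)]
        congr 1
        ring

/-- Against a density `ρ` on `(0, ∞)` with `t ρ(t) ≤ B`, the positive part of `-log |1 - t / a|` has
mean at most `log (2B) + 2`, uniformly in `a`: the part which exceeds `log (2B)` lives on a
neighbourhood of `a` of relative size `1 / (2B)`. The absolute value is implicit in `Real.log`. -/
theorem lintegral_neg_log_one_sub_div_le {ρ : ℝ → ℝ≥0∞} (hρm : Measurable ρ) {B : ℝ} (hB : 1 ≤ B)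
    (hρ1 : ∫⁻ t in Set.Ioi 0, ρ t ≤ 1)
    (hρB : ∀ᵐ t ∂(volume.restrict (Set.Ioi (0 : ℝ))), ρ t ≤ ENNReal.ofReal (B / t))
    {a : ℝ} (ha : 0 < a) :
    ∫⁻ t in Set.Ioi 0, ρ t * ENNReal.ofReal (-Real.log (1 - t / a)) ≤
      ENNReal.ofReal (Real.log (2 * B) + 2) := by
  have hl0 : 0 ≤ Real.log (2 * B) := Real.log_nonneg (by linarith)
  set c : ℝ := 2 * B / a with hc
  have hc0 : 0 < c := by positivity
  have hmeas : Measurable fun t : ℝ => ENNReal.ofReal (-Real.log (c * (t - a))) := by fun_prop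
  have hpt : ∀ᵐ t ∂(volume.restrict (Set.Ioi (0 : ℝ))),
      ρ t * ENNReal.ofReal (-Real.log (1 - t / a)) ≤
        ENNReal.ofReal (Real.log (2 * B)) * ρ t +
          ENNReal.ofReal c * ENNReal.ofReal (-Real.log (c * (t - a))) := by
    have hne : ∀ᵐ t ∂(volume.restrict (Set.Ioi (0 : ℝ))), t ≠ a :=
      ae_restrict_of_ae (by simp [ae_iff])
    filter_upwards [hρB, hne, ae_restrict_mem measurableSet_Ioi] with t ht hta ht0
    have ht0 : 0 < t := ht0
    have hsplit : Real.log (c * (t - a)) = Real.log (2 * B) + Real.log (1 - t / a) := by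
      have h1 : 1 - t / a ≠ 0 := by
        intro h
        apply hta
        field_simp at h
        linarith
      rw [← Real.log_mul (by positivity) h1, ← Real.log_neg_eq_log]
      congr 1
      rw [hc]
      field_simp
      ring
    have hle : ENNReal.ofReal (-Real.log (1 - t / a)) ≤
        ENNReal.ofReal (Real.log (2 * B)) + ENNReal.ofReal (-Real.log (c * (t - a))) := by
      rw [hsplit]
      refine le_trans (ENNReal.ofReal_le_ofReal ?_) ENNReal.ofReal_add_le
      linarith
    refine (mul_le_mul_right hle (ρ t)).trans ?_
    rw [mul_add, mul_comm]
    refine add_le_add le_rfl ?_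
    rcases le_or_gt (-Real.log (c * (t - a))) 0 with hneg | hpos
    · simp [ENNReal.ofReal_eq_zero.2 hneg]
    · refine mul_le_mul_left (ht.trans (ENNReal.ofReal_le_ofReal ?_)) _
      -- near `a`, the density is at most `2B / a`
      have habs : |c * (t - a)| < 1 := by
        by_contra! hcon
        have := Real.log_nonneg hcon
        rw [Real.log_abs] at this
        linarith
      have h2 : a ≤ 2 * t := by
        rw [abs_lt, hc] at habs
        have h3 := habs.1
        rw [div_mul_eq_mul_div, lt_div_iff₀ ha] at h3
        by_contra! hcon
        nlinarith
      rw [hc, div_le_div_iff₀ ht0 ha]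
      nlinarith
  calc ∫⁻ t in Set.Ioi 0, ρ t * ENNReal.ofReal (-Real.log (1 - t / a))
      ≤ ∫⁻ t in Set.Ioi 0, (ENNReal.ofReal (Real.log (2 * B)) * ρ t +
          ENNReal.ofReal c * ENNReal.ofReal (-Real.log (c * (t - a)))) := lintegral_mono_ae hpt
    _ = ENNReal.ofReal (Real.log (2 * B)) * (∫⁻ t in Set.Ioi 0, ρ t) +
          ENNReal.ofReal c * ∫⁻ t in Set.Ioi 0, ENNReal.ofReal (-Real.log (c * (t - a))) := by
        rw [lintegral_add_left (hρm.const_mul _), lintegral_const_mul _ hρm,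
          lintegral_const_mul _ hmeas]
    _ ≤ ENNReal.ofReal (Real.log (2 * B)) * 1 + ENNReal.ofReal c * ENNReal.ofReal (2 / c) := by
        gcongr
        exact (setLIntegral_le_lintegral _ _).trans (lintegral_neg_log_affine_le hc0 a)
    _ = ENNReal.ofReal (Real.log (2 * B) + 2) := by
        rw [mul_one, ← ENNReal.ofReal_mul hc0.le, mul_div_cancel₀ _ hc0.ne',
          ENNReal.ofReal_add hl0 (by norm_num)]

/-- A real polynomial with `q(0) = 1` is bounded below by the product of the factors
`|1 - t / |z||` over its complex roots `z`. -/
theorem neg_log_abs_eval_le {q : Polynomial ℝ} (hq : q.eval 0 = 1) {t : ℝ}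
    (ht : ∀ z ∈ (q.map (algebraMap ℝ ℂ)).roots, t ≠ ‖z‖) (ht0 : 0 < t) :
    q.eval t ≠ 0 ∧ -Real.log |q.eval t| ≤
      ((q.map (algebraMap ℝ ℂ)).roots.map fun z => -Real.log (1 - t / ‖z‖)).sum := by
  set Q := q.map (algebraMap ℝ ℂ) with hQ
  have heval : ∀ u : ℝ, Q.eval (u : ℂ) = ((q.eval u : ℝ) : ℂ) := fun u => by
    rw [hQ, Polynomial.eval_map]
    exact Polynomial.eval₂_at_apply (algebraMap ℝ ℂ) u
  have hQ0 : Q.eval 0 = 1 := by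
    have := heval 0
    simpa [hq] using this
  have hs : Q.Splits := IsAlgClosed.splits Q
  have hroot0 : ∀ z ∈ Q.roots, z ≠ 0 := by
    rintro z hz rfl
    have := Polynomial.isRoot_of_mem_roots hz
    rw [Polynomial.IsRoot, hQ0] at this
    exact one_ne_zero this
  have hprod : ∀ u : ℂ, ‖Q.eval u‖ = ‖Q.leadingCoeff‖ * (Q.roots.map fun z => ‖u - z‖).prod := by
    intro u
    rw [hs.eval_eq_prod_roots, norm_mul]
    congr 1
    generalize Q.roots = S
    induction S using Multiset.induction with
    | empty => simp
    | cons z S ih => simp [ih]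
  have key : ∀ S : Multiset ℂ, (∀ z ∈ S, z ≠ 0 ∧ t ≠ ‖z‖) →
      0 < (S.map fun z => ‖(0 : ℂ) - z‖).prod ∧ 0 < (S.map fun z => ‖(t : ℂ) - z‖).prod ∧
      Real.log (S.map fun z => ‖(0 : ℂ) - z‖).prod ≤
        Real.log (S.map fun z => ‖(t : ℂ) - z‖).prod +
          (S.map fun z => -Real.log (1 - t / ‖z‖)).sum := by
    intro S
    induction S using Multiset.induction with
    | empty => simp
    | cons z S ih =>
      intro hS
      obtain ⟨i1, i2, i3⟩ := ih fun w hw => hS w (Multiset.mem_cons_of_mem hw)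
      obtain ⟨hz0, hzt⟩ := hS z (Multiset.mem_cons_self z S)
      have hz : 0 < ‖z‖ := norm_pos_iff.2 hz0
      have hne : 1 - t / ‖z‖ ≠ 0 := by
        intro h
        apply hzt
        field_simp at h
        linarith
      have habs : ‖z‖ * |1 - t / ‖z‖| ≤ ‖(t : ℂ) - z‖ := by
        have h1 : ‖z‖ * |1 - t / ‖z‖| = |‖z‖ - t| := by
          rw [← abs_of_pos hz, ← abs_mul, abs_of_pos hz]
          congr 1
          field_simp
        have h2 := abs_norm_sub_norm_le z (t : ℂ)
        rw [Complex.norm_real, Real.norm_eq_abs, abs_of_pos ht0] at h2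
        rw [h1, norm_sub_rev]
        exact h2
      have hpos : 0 < ‖z‖ * |1 - t / ‖z‖| := mul_pos hz (abs_pos.2 hne)
      have hlog := Real.log_le_log hpos habs
      rw [Real.log_mul hz.ne' (abs_pos.2 hne).ne', Real.log_abs] at hlog
      simp only [Multiset.map_cons, Multiset.prod_cons, Multiset.sum_cons, zero_sub, norm_neg]
        at i1 i3 ⊢
      refine ⟨mul_pos hz i1, mul_pos (hpos.trans_le habs) i2, ?_⟩
      rw [Real.log_mul hz.ne' i1.ne', Real.log_mul (hpos.trans_le habs).ne' i2.ne']
      linarith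
  obtain ⟨k1, k2, k3⟩ := key Q.roots fun z hz => ⟨hroot0 z hz, ht z hz⟩
  have h0 := hprod 0
  have h1 := hprod t
  rw [hQ0, norm_one] at h0
  have hlc : 0 < ‖Q.leadingCoeff‖ := by
    by_contra! hcon
    nlinarith
  have hQt : ‖Q.eval (t : ℂ)‖ = |q.eval t| := by
    rw [heval, Complex.norm_real, Real.norm_eq_abs]
  rw [hQt] at h1
  have hpos : 0 < |q.eval t| := by
    rw [h1]
    exact mul_pos hlc k2
  refine ⟨abs_pos.1 hpos, ?_⟩
  have e0 := congrArg Real.log h0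
  rw [Real.log_one, Real.log_mul hlc.ne' k1.ne'] at e0
  rw [h1, Real.log_mul hlc.ne' k2.ne']
  linarith

theorem lintegral_mul_multiset_sum {β : Type*} {ρ : ℝ → ℝ≥0∞} (hρm : Measurable ρ)
    {f : β → ℝ → ℝ≥0∞} (hf : ∀ z, Measurable (f z)) (ν : Measure ℝ) (S : Multiset β) :
    ∫⁻ t, ρ t * (S.map fun z => f z t).sum ∂ν = (S.map fun z => ∫⁻ t, ρ t * f z t ∂ν).sum := by
  induction S using Multiset.induction with
  | empty => simp
  | cons z S ih =>
    simp only [Multiset.map_cons, Multiset.sum_cons, mul_add]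
    rw [lintegral_add_left (f := fun t => ρ t * f z t) (hρm.mul (hf z)), ih]

theorem ofReal_multiset_sum_le {β : Type*} (f : β → ℝ) (S : Multiset β) :
    ENNReal.ofReal (S.map f).sum ≤ (S.map fun z => ENNReal.ofReal (f z)).sum := by
  induction S using Multiset.induction with
  | empty => simp
  | cons z S ih =>
    simp only [Multiset.map_cons, Multiset.sum_cons]
    exact ENNReal.ofReal_add_le.trans (add_le_add le_rfl ih)

/-- The level below which a polynomial of degree at most `K` with constant coefficient `1` stays
with probability at most `2/3` under a density with `t ρ(t) ≤ B`. -/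
noncomputable def smallValueLevel (K : ℕ) (B : ℝ) : ℝ :=
  Real.exp (-(3 / 2 * K * (Real.log (2 * B) + 2)))

/-- Markov's inequality for the sum of the positive parts of `-log |1 - t / |z||` over the roots `z`
of `q`, which dominates `-log |q|`. -/
theorem lintegral_small_values_le {ρ : ℝ → ℝ≥0∞} (hρm : Measurable ρ) {B : ℝ} (hB : 1 ≤ B)
    (hρ1 : ∫⁻ t in Set.Ioi 0, ρ t ≤ 1)
    (hρB : ∀ᵐ t ∂(volume.restrict (Set.Ioi (0 : ℝ))), ρ t ≤ ENNReal.ofReal (B / t))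
    {q : Polynomial ℝ} (hq : q.eval 0 = 1) {K : ℕ} (hK : 0 < K) (hdeg : q.natDegree ≤ K) :
    ∫⁻ t in Set.Ioi 0, ρ t * {t | |q.eval t| ≤ smallValueLevel K B}.indicator 1 t ≤
      ENNReal.ofReal (2 / 3) := by
  set Λ : ℝ := Real.log (2 * B) + 2 with hΛ
  have hΛ0 : 0 < Λ := by
    have := Real.log_nonneg (show (1 : ℝ) ≤ 2 * B by linarith)
    linarith
  have hK' : (0 : ℝ) < K := by exact_mod_cast hK
  set Q := q.map (algebraMap ℝ ℂ) with hQ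
  set L : ℝ := 3 / 2 * K * Λ with hL
  have hL0 : 0 < L := by positivity
  have hQ0 : Q.eval 0 = 1 := by
    have : Q.eval ((0 : ℝ) : ℂ) = ((q.eval 0 : ℝ) : ℂ) := by
      rw [hQ, Polynomial.eval_map]
      exact Polynomial.eval₂_at_apply (algebraMap ℝ ℂ) 0
    simpa [hq] using this
  have hroot0 : ∀ z ∈ Q.roots, 0 < ‖z‖ := by
    intro z hz
    rw [norm_pos_iff]
    rintro rfl
    have := Polynomial.isRoot_of_mem_roots hz
    rw [Polynomial.IsRoot, hQ0] at this
    exact one_ne_zero this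
  have hcard : (Q.roots.card : ℝ) ≤ K := by
    exact_mod_cast (Polynomial.card_roots' Q).trans (Polynomial.natDegree_map_le.trans hdeg)
  have hae : ∀ᵐ t ∂(volume.restrict (Set.Ioi (0 : ℝ))), ∀ z ∈ Q.roots, t ≠ ‖z‖ := by
    refine ae_restrict_of_ae ?_
    have hfin : ((fun z : ℂ => ‖z‖) '' (Q.roots.toFinset : Set ℂ)).Finite :=
      (Finset.finite_toSet _).image _
    filter_upwards [hfin.measure_zero volume |> compl_mem_ae_iff.2] with t ht z hz h
    exact ht ⟨z, by simpa using hz, h.symm⟩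
  have hpt : ∀ᵐ t ∂(volume.restrict (Set.Ioi (0 : ℝ))),
      ENNReal.ofReal L * (ρ t * {t | |q.eval t| ≤ smallValueLevel K B}.indicator 1 t) ≤
        ρ t * (Q.roots.map fun z => ENNReal.ofReal (-Real.log (1 - t / ‖z‖))).sum := by
    filter_upwards [hae, ae_restrict_mem measurableSet_Ioi] with t ht ht0
    by_cases hmem : |q.eval t| ≤ smallValueLevel K B
    · rw [Set.indicator_of_mem (by exact hmem)]
      obtain ⟨hne, hlog⟩ := neg_log_abs_eval_le hq ht ht0
      have h1 : L ≤ -Real.log |q.eval t| := by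
        have := Real.log_le_log (abs_pos.2 hne) hmem
        rw [smallValueLevel, Real.log_exp] at this
        linarith
      rw [Pi.one_apply, mul_one, mul_comm]
      exact mul_le_mul_right
        ((ENNReal.ofReal_le_ofReal (h1.trans hlog)).trans (ofReal_multiset_sum_le _ _)) _
    · rw [Set.indicator_of_notMem (by exact hmem)]
      simp
  have hf : ∀ z : ℂ, Measurable fun t : ℝ => ENNReal.ofReal (-Real.log (1 - t / ‖z‖)) := by
    intro z
    fun_prop
  have hmeas : Measurable fun t => ρ t * {t | |q.eval t| ≤ smallValueLevel K B}.indicator 1 t := by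
    refine hρm.mul (measurable_one.indicator ?_)
    exact measurableSet_le (q.continuous.abs.measurable) measurable_const
  have hmain : ENNReal.ofReal L *
      (∫⁻ t in Set.Ioi 0, ρ t * {t | |q.eval t| ≤ smallValueLevel K B}.indicator 1 t) ≤
        ENNReal.ofReal (K * Λ) := by
    rw [← lintegral_const_mul _ hmeas]
    refine (lintegral_mono_ae hpt).trans ?_
    rw [lintegral_mul_multiset_sum hρm hf]
    have hb : ∀ x ∈ Q.roots.map (fun z => ∫⁻ t in Set.Ioi 0,
        ρ t * ENNReal.ofReal (-Real.log (1 - t / ‖z‖))), x ≤ ENNReal.ofReal Λ := by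
      intro x hx
      obtain ⟨z, hz, rfl⟩ := Multiset.mem_map.1 hx
      exact lintegral_neg_log_one_sub_div_le hρm hB hρ1 hρB (hroot0 z hz)
    refine (Multiset.sum_le_card_nsmul _ _ hb).trans ?_
    rw [Multiset.card_map, nsmul_eq_mul, ENNReal.ofReal_mul hK'.le, ENNReal.ofReal_natCast]
    gcongr
    exact_mod_cast hcard
  have hval : ENNReal.ofReal (K * Λ) = ENNReal.ofReal L * ENNReal.ofReal (2 / 3) := by
    rw [← ENNReal.ofReal_mul hL0.le]
    congr 1
    rw [hL]
    ring
  rw [hval] at hmain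
  exact (ENNReal.mul_le_mul_iff_right (by simpa using hL0) ENNReal.ofReal_ne_top).1 hmain

end SmallValues

/-! ### Disintegration along a direction with a conditional radial density -/

section Disintegration

variable {Ω E : Type*} [MeasurableSpace Ω] [MeasurableSpace E] {P : Measure Ω}
  [IsProbabilityMeasure P] {W : Ω → E} {R I : Ω → ℝ} {p : E → ℝ → ℝ}

theorem condExp_mul_indicator_bounds (hR : Measurable R) (hI : Measurable I)
    (hI0 : ∀ ω, 0 ≤ I ω) (hI1 : ∀ ω, I ω ≤ 1) {A : Set ℝ} (hA : MeasurableSet A) :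
    Integrable (fun ω => I ω * A.indicator (fun _ => (1 : ℝ)) (R ω)) P ∧
    0 ≤ᵐ[P] P[fun ω => I ω * A.indicator (fun _ => (1 : ℝ)) (R ω) |
      MeasurableSpace.comap W inferInstance] ∧
    P[fun ω => I ω * A.indicator (fun _ => (1 : ℝ)) (R ω) |
      MeasurableSpace.comap W inferInstance] ≤ᵐ[P]
        P[I | MeasurableSpace.comap W inferInstance] := by
  have hnn : ∀ ω, 0 ≤ A.indicator (fun _ => (1 : ℝ)) (R ω) := fun ω =>
    Set.indicator_nonneg (fun _ _ => zero_le_one) _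
  have hle : ∀ ω, A.indicator (fun _ => (1 : ℝ)) (R ω) ≤ 1 := fun ω =>
    Set.indicator_le_self' (fun _ _ => zero_le_one) _
  have hint : Integrable (fun ω => I ω * A.indicator (fun _ => (1 : ℝ)) (R ω)) P := by
    refine Integrable.of_bound (C := 1)
      (hI.mul ((measurable_const.indicator hA).comp hR)).aestronglyMeasurable
      (ae_of_all _ fun ω => ?_)
    rw [Real.norm_eq_abs, abs_of_nonneg (mul_nonneg (hI0 ω) (hnn ω))]
    exact mul_le_one₀ (hI1 ω) (hnn ω) (hle ω)
  have hintI : Integrable I P :=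
    Integrable.of_bound (C := 1) hI.aestronglyMeasurable (ae_of_all _ fun ω => by
      rw [Real.norm_eq_abs, abs_of_nonneg (hI0 ω)]; exact hI1 ω)
  refine ⟨hint, condExp_nonneg (ae_of_all _ fun ω => mul_nonneg (hI0 ω) (hnn ω)),
    condExp_mono hint hintI (ae_of_all _ fun ω => ?_)⟩
  exact mul_le_of_le_one_right (hI0 ω) (hle ω)

/-- The conditional radial density integrates to one, hence is integrable. -/
theorem radial_density_integral_eq_one {P : Measure Ω}
    (hp : ∀ A : Set ℝ, MeasurableSet A → ∀ᵐ ω ∂P,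
      0 < (P[I | MeasurableSpace.comap W inferInstance]) ω →
        (P[fun ω => I ω * A.indicator (fun _ => (1 : ℝ)) (R ω) |
          MeasurableSpace.comap W inferInstance]) ω /
          (P[I | MeasurableSpace.comap W inferInstance]) ω = ∫ t in A, p (W ω) t)
    (hp0 : ∀ w t, 0 ≤ p w t) :
    ∀ᵐ ω ∂P, 0 < (P[I | MeasurableSpace.comap W inferInstance]) ω →
      Integrable (p (W ω)) ∧ ∫⁻ t, ENNReal.ofReal (p (W ω) t) = 1 := by
  filter_upwards [hp Set.univ MeasurableSet.univ] with ω hω hpos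
  have h := hω hpos
  have he : (fun ω => I ω * (Set.univ : Set ℝ).indicator (fun _ => (1 : ℝ)) (R ω)) = I := by
    ext ω
    simp
  rw [he, div_self hpos.ne', setIntegral_univ] at h
  have hint : Integrable (p (W ω)) := by
    by_contra hcon
    rw [integral_undef hcon] at h
    exact one_ne_zero h
  refine ⟨hint, ?_⟩
  rw [← ofReal_integral_eq_lintegral_ofReal hint (ae_of_all _ fun t => hp0 _ t), ← h,
    ENNReal.ofReal_one]

/-- The law of `(W, R)` weighted with `I` disintegrates over `W`, with the conditional weight of `I`
and the conditional radial density. -/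
theorem lintegral_direction_radius (hW : Measurable W) (hR : Measurable R) (hI : Measurable I)
    (hI0 : ∀ ω, 0 ≤ I ω) (hI1 : ∀ ω, I ω ≤ 1) (hpm : Measurable (Function.uncurry p))
    (hp0 : ∀ w t, 0 ≤ p w t)
    (hp : ∀ A : Set ℝ, MeasurableSet A → ∀ᵐ ω ∂P,
      0 < (P[I | MeasurableSpace.comap W inferInstance]) ω →
        (P[fun ω => I ω * A.indicator (fun _ => (1 : ℝ)) (R ω) |
          MeasurableSpace.comap W inferInstance]) ω /
          (P[I | MeasurableSpace.comap W inferInstance]) ω = ∫ t in A, p (W ω) t)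
    {F : E × ℝ → ℝ≥0∞} (hF : Measurable F) :
    ∫⁻ ω, ENNReal.ofReal (I ω) * F (W ω, R ω) ∂P =
      ∫⁻ ω, ENNReal.ofReal ((P[I | MeasurableSpace.comap W inferInstance]) ω) *
        (∫⁻ t, ENNReal.ofReal (p (W ω) t) * F (W ω, t)) ∂P := by
  have hm : MeasurableSpace.comap W inferInstance ≤ (inferInstance : MeasurableSpace Ω) :=
    hW.comap_le
  set π : Ω → ℝ := P[I | MeasurableSpace.comap W inferInstance] with hπ
  have hπm : Measurable π := (stronglyMeasurable_condExp.mono hm).measurable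
  set H : Ω × ℝ → ℝ≥0∞ := fun z => ENNReal.ofReal (π z.1) * ENNReal.ofReal (p (W z.1) z.2) with hH
  have hpW : Measurable fun z : Ω × ℝ => p (W z.1) z.2 :=
    hpm.comp ((hW.comp measurable_fst).prodMk measurable_snd)
  have hHm : Measurable H := (hπm.comp measurable_fst).ennreal_ofReal.mul hpW.ennreal_ofReal
  have hT1 : Measurable fun ω => (W ω, R ω) := hW.prodMk hR
  have hT2 : Measurable fun z : Ω × ℝ => (W z.1, z.2) :=
    (hW.comp measurable_fst).prodMk measurable_snd
  set ν₁ : Measure (E × ℝ) := (P.withDensity fun ω => ENNReal.ofReal (I ω)).map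
    fun ω => (W ω, R ω) with hν₁
  set ν₂ : Measure (E × ℝ) := ((P.prod volume).withDensity H).map
    fun z : Ω × ℝ => (W z.1, z.2) with hν₂
  have hfin : IsFiniteMeasure ν₁ := by
    have : IsFiniteMeasure (P.withDensity fun ω => ENNReal.ofReal (I ω)) := by
      refine isFiniteMeasure_withDensity (ne_top_of_le_ne_top ENNReal.one_ne_top ?_)
      calc ∫⁻ ω, ENNReal.ofReal (I ω) ∂P ≤ ∫⁻ _, 1 ∂P :=
            lintegral_mono fun ω => ENNReal.ofReal_le_one.2 (hI1 ω)
        _ = 1 := by simp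
    rw [hν₁]
    infer_instance
  have hrad := radial_density_integral_eq_one (W := W) (R := R) hp hp0
  have hν : ν₁ = ν₂ := by
    refine Measure.ext_prod fun {S A} hS hA => ?_
    have hSA : MeasurableSet (S ×ˢ A) := hS.prod hA
    obtain ⟨hint, hc0, hcle⟩ := condExp_mul_indicator_bounds (P := P) (W := W) hR hI hI0 hI1 hA
    have hSm : MeasurableSet[MeasurableSpace.comap W inferInstance] (W ⁻¹' S) := ⟨S, hS, rfl⟩
    have hcond : ∀ᵐ ω ∂P, ENNReal.ofReal
        ((P[fun ω => I ω * A.indicator (fun _ => (1 : ℝ)) (R ω) |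
          MeasurableSpace.comap W inferInstance]) ω) =
        ENNReal.ofReal (π ω) * ∫⁻ t in A, ENNReal.ofReal (p (W ω) t) := by
      filter_upwards [hc0, hcle, hp A hA, hrad] with ω h0 h1 h2 h3
      rcases lt_or_ge 0 (π ω) with hpos | hneg
      · have h4 := h2 hpos
        rw [div_eq_iff hpos.ne'] at h4
        rw [h4, mul_comm, ENNReal.ofReal_mul hpos.le,
          ofReal_integral_eq_lintegral_ofReal (h3 hpos).1.integrableOn
            (ae_of_all _ fun t => hp0 _ t)]
      · rw [ENNReal.ofReal_eq_zero.2 hneg, zero_mul, ENNReal.ofReal_eq_zero]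
        exact h1.trans hneg
    rw [hν₁, hν₂, Measure.map_apply hT1 hSA, Measure.map_apply hT2 hSA,
      withDensity_apply _ (hT1 hSA), withDensity_apply _ (hT2 hSA)]
    have hL : ∫⁻ ω in (fun ω => (W ω, R ω)) ⁻¹' S ×ˢ A, ENNReal.ofReal (I ω) ∂P =
        ∫⁻ ω in W ⁻¹' S, ENNReal.ofReal (I ω * A.indicator (fun _ => (1 : ℝ)) (R ω)) ∂P := by
      rw [← lintegral_indicator (hT1 hSA), ← lintegral_indicator (hW hS)]
      refine lintegral_congr fun ω => ?_
      by_cases h1 : W ω ∈ S <;> by_cases h2 : R ω ∈ A <;> simp [Set.indicator, h1, h2]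
    have hRt : ∫⁻ z in (fun z : Ω × ℝ => (W z.1, z.2)) ⁻¹' S ×ˢ A, H z ∂(P.prod volume) =
        ∫⁻ ω in W ⁻¹' S, ENNReal.ofReal (π ω) * (∫⁻ t in A, ENNReal.ofReal (p (W ω) t)) ∂P := by
      have : (fun z : Ω × ℝ => (W z.1, z.2)) ⁻¹' S ×ˢ A = (W ⁻¹' S) ×ˢ A := rfl
      rw [this, ← Measure.prod_restrict, lintegral_prod _ hHm.aemeasurable]
      refine lintegral_congr fun ω => ?_
      exact lintegral_const_mul (ENNReal.ofReal (π ω)) (f := fun t => ENNReal.ofReal (p (W ω) t))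
        (hpm.comp measurable_prodMk_left).ennreal_ofReal
    rw [hL, hRt, ← ofReal_integral_eq_lintegral_ofReal hint.integrableOn
      (ae_of_all _ fun ω => mul_nonneg (hI0 ω) (Set.indicator_nonneg (fun _ _ => zero_le_one) _)),
      ← setIntegral_condExp hm hint hSm,
      ofReal_integral_eq_lintegral_ofReal integrable_condExp.integrableOn (ae_restrict_of_ae hc0)]
    exact lintegral_congr_ae (ae_restrict_of_ae hcond)
  have h1 : ∫⁻ z, F z ∂ν₁ = ∫⁻ ω, ENNReal.ofReal (I ω) * F (W ω, R ω) ∂P := by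
    rw [hν₁, lintegral_map hF hT1, lintegral_withDensity_eq_lintegral_mul _ hI.ennreal_ofReal
      (g := fun z => F (W z, R z)) (hF.comp hT1)]
    rfl
  have h2 : ∫⁻ z, F z ∂ν₂ = ∫⁻ ω, ENNReal.ofReal (π ω) *
        (∫⁻ t, ENNReal.ofReal (p (W ω) t) * F (W ω, t)) ∂P := by
    rw [hν₂, lintegral_map hF hT2, lintegral_withDensity_eq_lintegral_mul _ hHm
      (g := fun z : Ω × ℝ => F (W z.1, z.2)) (hF.comp hT2),
      lintegral_prod (H * fun z : Ω × ℝ => F (W z.1, z.2))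
        (hHm.mul (hF.comp hT2)).aemeasurable]
    refine lintegral_congr fun ω => ?_
    rw [← lintegral_const_mul]
    · refine lintegral_congr fun t => ?_
      simp only [Pi.mul_apply, hH, mul_assoc]
    · exact (hpm.comp measurable_prodMk_left).ennreal_ofReal.mul (hF.comp measurable_prodMk_left)
  rw [← h1, ← h2, hν]

/-- If a function of direction and radius takes small values, for every direction in `G`, only on a
set of conditional radial mass at most `θ`, then it takes small values on at most the fraction
`θ` of the event that the direction lies in `G`. -/
theorem lintegral_direction_radius_le (hW : Measurable W) (hR : Measurable R) (hI : Measurable I)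
    (hI0 : ∀ ω, 0 ≤ I ω) (hI1 : ∀ ω, I ω ≤ 1) (hpm : Measurable (Function.uncurry p))
    (hp0 : ∀ w t, 0 ≤ p w t)
    (hp : ∀ A : Set ℝ, MeasurableSet A → ∀ᵐ ω ∂P,
      0 < (P[I | MeasurableSpace.comap W inferInstance]) ω →
        (P[fun ω => I ω * A.indicator (fun _ => (1 : ℝ)) (R ω) |
          MeasurableSpace.comap W inferInstance]) ω /
          (P[I | MeasurableSpace.comap W inferInstance]) ω = ∫ t in A, p (W ω) t)
    {G : Set E} (hG : MeasurableSet G) {B : Set (E × ℝ)} (hB : MeasurableSet B) {θ : ℝ≥0∞}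
    (h : ∀ w ∈ G, ∫⁻ t, ENNReal.ofReal (p w t) = 1 →
      ∫⁻ t, ENNReal.ofReal (p w t) * B.indicator 1 (w, t) ≤ θ) :
    ∫⁻ ω, ENNReal.ofReal (I ω) * (G.indicator 1 (W ω) * B.indicator 1 (W ω, R ω)) ∂P ≤
      θ * ∫⁻ ω, ENNReal.ofReal (I ω) * G.indicator 1 (W ω) ∂P := by
  have hGm : Measurable fun z : E × ℝ => G.indicator (1 : E → ℝ≥0∞) z.1 :=
    (measurable_one.indicator hG).comp measurable_fst
  have hBm : Measurable (B.indicator (1 : E × ℝ → ℝ≥0∞)) := measurable_one.indicator hB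
  have h1 := lintegral_direction_radius hW hR hI hI0 hI1 hpm hp0 hp (hGm.mul hBm)
  have h2 := lintegral_direction_radius hW hR hI hI0 hI1 hpm hp0 hp hGm
  simp only [Pi.mul_apply] at h1
  rw [h1, h2]
  have hrad := radial_density_integral_eq_one (W := W) (R := R) hp hp0
  have hm : MeasurableSpace.comap W inferInstance ≤ (inferInstance : MeasurableSpace Ω) :=
    hW.comap_le
  have hpm' : ∀ w, Measurable fun t => ENNReal.ofReal (p w t) := fun w =>
    (hpm.comp measurable_prodMk_left).ennreal_ofReal
  by_cases hθ : θ = ∞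
  · rcases eq_or_ne (∫⁻ ω, ENNReal.ofReal ((P[I | MeasurableSpace.comap W inferInstance]) ω) *
        (∫⁻ t, ENNReal.ofReal (p (W ω) t) * G.indicator 1 (W ω)) ∂P) 0 with h0 | h0
    · rw [h0, mul_zero, ← h0]
      refine lintegral_mono fun ω => ?_
      gcongr with t
      exact mul_le_of_le_one_right' (Set.indicator_le_self' (fun _ _ => zero_le_one) _)
    · rw [hθ, ENNReal.top_mul h0]
      exact le_top
  rw [← lintegral_const_mul' _ _ hθ]
  refine lintegral_mono_ae ?_
  filter_upwards [hrad] with ω hω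
  rcases lt_or_ge 0 ((P[I | MeasurableSpace.comap W inferInstance]) ω) with hpos | hneg
  · rw [mul_left_comm]
    gcongr
    by_cases hmem : W ω ∈ G
    · simp only [Set.indicator_of_mem hmem, Pi.one_apply, one_mul, mul_one]
      rw [(hω hpos).2, mul_one]
      exact h _ hmem (hω hpos).2
    · simp [Set.indicator_of_notMem hmem]
  · simp [ENNReal.ofReal_eq_zero.2 hneg]

end Disintegration

/-! ### The design in the neighbourhood -/

section Design

theorem measurable_nbhdInd (x : L2) (δ : ℝ) : Measurable (nbhdInd x δ) :=
  measurable_const.indicator Metric.isOpen_ball.measurableSet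

theorem nbhdInd_nonneg (x : L2) (δ : ℝ) (u : L2) : 0 ≤ nbhdInd x δ u :=
  Set.indicator_nonneg (fun _ _ => zero_le_one) _

theorem nbhdInd_le_one (x : L2) (δ : ℝ) (u : L2) : nbhdInd x δ u ≤ 1 :=
  Set.indicator_le_self' (fun _ _ => zero_le_one) _

theorem continuous_coords (φ : HilbertBasis ℕ ℝ L2) (J : ℕ) : Continuous (coords φ J) := by
  unfold coords
  fun_prop

theorem measurable_coords_sub (φ : HilbertBasis ℕ ℝ L2) (J : ℕ) (x : L2) :
    Measurable fun u => coords φ J (u - x) :=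
  ((continuous_coords φ J).comp (continuous_id.sub continuous_const)).measurable

theorem measurable_monomial (φ : HilbertBasis ℕ ℝ L2) (x : L2) {J : ℕ} (k : Fin J → ℕ) :
    Measurable (monomial φ x k) := by
  unfold monomial
  exact Finset.measurable_prod _ fun l _ =>
    ((measurable_pi_apply l).comp (measurable_coords_sub φ J x)).pow_const _

theorem abs_coords_le (φ : HilbertBasis ℕ ℝ L2) {J : ℕ} (u : L2) (l : Fin J) :
    |coords φ J u l| ≤ ‖u‖ := by
  have h := abs_real_inner_le_norm u (φ (l : ℕ))
  rwa [φ.orthonormal.1, mul_one] at h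

theorem abs_monomial_le_one (φ : HilbertBasis ℕ ℝ L2) {x : L2} {J : ℕ} (k : Fin J → ℕ) {u : L2}
    (hu : ‖u - x‖ ≤ 1) : |monomial φ x k u| ≤ 1 := by
  rw [monomial, Finset.abs_prod]
  refine Finset.prod_le_one (fun _ _ => abs_nonneg _) fun l _ => ?_
  rw [abs_pow]
  exact pow_le_one₀ (abs_nonneg _) ((abs_coords_le φ _ l).trans hu)

/-- The vector of all monomials at the design point `u`. -/
noncomputable def monomials (φ : HilbertBasis ℕ ℝ L2) (x : L2) (J K : ℕ) (u : L2) :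
    multiIndices J K → ℝ :=
  fun k => monomial φ x k.1 u

theorem measurable_monomials_dotProduct (φ : HilbertBasis ℕ ℝ L2) (x : L2) {J K : ℕ}
    (v : multiIndices J K → ℝ) : Measurable fun u => monomials φ x J K u ⬝ᵥ v :=
  Finset.measurable_sum _ fun k _ => (measurable_monomial φ x k.1).mul_const _

theorem abs_monomials_dotProduct_le (φ : HilbertBasis ℕ ℝ L2) {x : L2} {J K : ℕ}
    (v : multiIndices J K → ℝ) {u : L2} (hu : ‖u - x‖ ≤ 1) :
    |monomials φ x J K u ⬝ᵥ v| ≤ ∑ k, |v k| := by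
  refine (Finset.abs_sum_le_sum_abs _ _).trans (Finset.sum_le_sum fun k _ => ?_)
  rw [abs_mul]
  exact mul_le_of_le_one_left (abs_nonneg _) (abs_monomial_le_one φ k.1 hu)

theorem nbhdInd_mul_le {x : L2} {δ : ℝ} {u : L2} {a b : ℝ} (hb : 0 ≤ b)
    (h : ‖u - x‖ < δ → a ≤ b) : nbhdInd x δ u * a ≤ b := by
  by_cases hu : u ∈ Metric.ball x δ
  · rw [nbhdInd, Set.indicator_of_mem hu, one_mul]
    exact h (by simpa [dist_eq_norm] using hu)
  · rw [nbhdInd, Set.indicator_of_notMem hu, zero_mul]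
    exact hb

theorem abs_nbhdInd_mul_le {x : L2} {δ : ℝ} {u : L2} {a b : ℝ} (hb : 0 ≤ b)
    (h : ‖u - x‖ < δ → |a| ≤ b) : |nbhdInd x δ u * a| ≤ b := by
  rw [abs_mul, abs_of_nonneg (nbhdInd_nonneg x δ u)]
  exact nbhdInd_mul_le hb h

/-- The restriction of a polynomial in the coordinates to the line in the direction `w`. -/
noncomputable def rayPolynomial {J K : ℕ} (v : multiIndices J K → ℝ) (w : Fin J → ℝ) :
    Polynomial ℝ :=
  ∑ k, Polynomial.C (v k * ∏ l, w l ^ k.1 l) * Polynomial.X ^ (∑ l, k.1 l)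

theorem eval_rayPolynomial {J K : ℕ} (v : multiIndices J K → ℝ) (w : Fin J → ℝ) (t : ℝ) :
    (rayPolynomial v w).eval t = ∑ k, (∏ l, (t * w l) ^ k.1 l) * v k := by
  rw [rayPolynomial, Polynomial.eval_finsetSum]
  refine Finset.sum_congr rfl fun k _ => ?_
  simp only [Polynomial.eval_mul, Polynomial.eval_C, Polynomial.eval_pow, Polynomial.eval_X,
    mul_pow, Finset.prod_mul_distrib, Finset.prod_pow_eq_pow_sum]
  ring

theorem eval_zero_rayPolynomial {J K : ℕ} (v : multiIndices J K → ℝ) (w : Fin J → ℝ) :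
    (rayPolynomial v w).eval 0 = v ⬝ᵥ unitZero J K := by
  rw [eval_rayPolynomial]
  refine Finset.sum_congr rfl fun k _ => ?_
  rw [mul_comm]
  congr 1
  simp only [zero_mul, unitZero]
  split_ifs with h
  · simp [h]
  · obtain ⟨l, hl⟩ := Function.ne_iff.1 h
    exact Finset.prod_eq_zero (Finset.mem_univ l) (zero_pow hl)

theorem natDegree_rayPolynomial_le {J K : ℕ} (v : multiIndices J K → ℝ) (w : Fin J → ℝ) :
    (rayPolynomial v w).natDegree ≤ K := by
  refine Polynomial.natDegree_sum_le_of_forall_le _ _ fun k _ => ?_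
  exact (Polynomial.natDegree_C_mul_X_pow_le _ _).trans (mem_multiIndices.1 k.2).le

variable {Ω : Type*} [MeasurableSpace Ω] {P : Measure Ω} [IsProbabilityMeasure P] {Z : Ω → L2}
  {x : L2} {δ : ℝ} {φ : HilbertBasis ℕ ℝ L2}

/-- Restricted to the neighbourhood, a polynomial in the first `J` coordinates of the design whose
value at the origin is `1` has a second moment which is not much smaller than the probability of the
neighbourhood: along each direction with a bounded radial density it exceeds `smallValueLevel` with
conditional probability at least `1/3`. -/
theorem design_second_moment_of_eq_one (hZ : Measurable Z) (hδ : δ ≤ 1) {c₁ c₂ : ℝ} {J : ℕ}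
    (hrad : RadialDensityCondition P Z x δ φ c₁ c₂ J)
    {B : ℝ} (hB : 1 ≤ B) (hcB : c₁ * J ≤ B) {K : ℕ} (hK : 0 < K) (v : multiIndices J K → ℝ)
    (hv : v ⬝ᵥ unitZero J K = 1) :
    P.real {ω | Z ω ∈ Metric.ball x δ} / c₂ / 3 * smallValueLevel K B ^ 2 ≤
      ∫ ω, nbhdInd x δ (Z ω) * (monomials φ x J K (Z ω) ⬝ᵥ v) ^ 2 ∂P := by
  obtain ⟨N, hN, p, hpm, hp0, hp, hmass⟩ := hrad
  have hNc : Continuous N := by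
    have h := N.convexOn.continuousOn_interior
    rw [interior_univ] at h
    exact continuousOn_univ.1 h
  set τ : ℝ := smallValueLevel K B with hτ
  have hτ0 : 0 < τ := Real.exp_pos _
  have hτ1 : τ ≤ 1 := by
    refine Real.exp_le_one_iff.2 (neg_nonpos.2 ?_)
    have := Real.log_nonneg (show (1 : ℝ) ≤ 2 * B by linarith)
    positivity
  have hV : Measurable fun ω => coords φ J (Z ω - x) := (measurable_coords_sub φ J x).comp hZ
  have hR : Measurable (radius Z x φ N) := hNc.measurable.comp hV
  have hW : Measurable (direction Z x φ N) := by
    have : direction Z x φ N = fun ω => (radius Z x φ N ω)⁻¹ • coords φ J (Z ω - x) := rfl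
    rw [this]
    exact hR.inv.smul hV
  have hI : Measurable fun ω => nbhdInd x δ (Z ω) := (measurable_nbhdInd x δ).comp hZ
  have hR0 : ∀ ω, 0 ≤ radius Z x φ N ω := fun ω => apply_nonneg N _
  have hpolar : ∀ ω, coords φ J (Z ω - x) = radius Z x φ N ω • direction Z x φ N ω := by
    intro ω
    rcases eq_or_ne (radius Z x φ N ω) 0 with h | h
    · rw [h, zero_smul]
      exact hN _ h
    · rw [direction, smul_smul, mul_inv_cancel₀ h, one_smul]
  have hF : ∀ ω, monomials φ x J K (Z ω) ⬝ᵥ v =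
      (rayPolynomial v (direction Z x φ N ω)).eval (radius Z x φ N ω) := by
    intro ω
    rw [eval_rayPolynomial]
    refine Finset.sum_congr rfl fun k _ => ?_
    rw [monomials, monomial, hpolar]
    simp only [Pi.smul_apply, smul_eq_mul]
  -- the pointwise bound on the density is relaxed to an almost everywhere bound, which gives a
  -- measurable set of directions
  set S : Set ((Fin J → ℝ) × ℝ) := {z | 0 < z.2 ∧ c₁ * J < z.2 * p z.1 z.2} with hS
  have hSm : MeasurableSet S := by
    refine (measurableSet_lt measurable_const measurable_snd).inter
      (measurableSet_lt measurable_const (measurable_snd.mul ?_))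
    exact hpm
  set G : Set (Fin J → ℝ) := {w | volume (Prod.mk w ⁻¹' S) = 0} with hG
  have hGm : MeasurableSet G := (measurable_measure_prodMk_left hSm) (measurableSet_singleton 0)
  set Bad : Set ((Fin J → ℝ) × ℝ) := {z | 0 < z.2 ∧ |(rayPolynomial v z.1).eval z.2| ≤ τ} with hBad
  have hBadm : MeasurableSet Bad := by
    have hm : Measurable fun z : (Fin J → ℝ) × ℝ => |(rayPolynomial v z.1).eval z.2| := by
      simp only [eval_rayPolynomial]
      fun_prop
    exact (measurableSet_lt measurable_const measurable_snd).inter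
      (measurableSet_le hm measurable_const)
  have hsmall : ∀ w ∈ G, ∫⁻ t, ENNReal.ofReal (p w t) = 1 →
      ∫⁻ t, ENNReal.ofReal (p w t) * Bad.indicator 1 (w, t) ≤ ENNReal.ofReal (2 / 3) := by
    intro w hw h1
    have hpw : Measurable fun t => ENNReal.ofReal (p w t) :=
      (hpm.comp measurable_prodMk_left).ennreal_ofReal
    have hρB : ∀ᵐ t ∂(volume.restrict (Set.Ioi (0 : ℝ))),
        ENNReal.ofReal (p w t) ≤ ENNReal.ofReal (B / t) := by
      have hw' : ∀ᵐ t, t ∉ Prod.mk w ⁻¹' S := measure_eq_zero_iff_ae_notMem.1 hw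
      filter_upwards [ae_restrict_of_ae hw', ae_restrict_mem measurableSet_Ioi] with t ht ht0
      have ht0 : 0 < t := ht0
      refine ENNReal.ofReal_le_ofReal ?_
      rw [le_div_iff₀ ht0]
      by_contra! hcon
      exact ht ⟨ht0, by change c₁ * J < t * p w t; linarith⟩
    refine le_trans (le_of_eq ?_) (lintegral_small_values_le hpw hB
      ((setLIntegral_le_lintegral _ _).trans h1.le) hρB
      ((eval_zero_rayPolynomial v w).trans hv) hK (natDegree_rayPolynomial_le v w))
    rw [← lintegral_indicator measurableSet_Ioi]
    refine lintegral_congr fun t => ?_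
    by_cases h1 : 0 < t <;> by_cases h2 : |(rayPolynomial v w).eval t| ≤ τ <;>
      simp [Set.indicator, hBad, h1, h2, ← hτ]
  have hfrac := lintegral_direction_radius_le hW hR hI (fun ω => nbhdInd_nonneg x δ _)
    (fun ω => nbhdInd_le_one x δ _) hpm hp0 hp hGm hBadm hsmall
  set A₁ : Set Ω := {ω | Z ω ∈ Metric.ball x δ ∧ direction Z x φ N ω ∈ G} with hA₁
  set A₂ : Set Ω := A₁ ∩ {ω | (direction Z x φ N ω, radius Z x φ N ω) ∈ Bad} with hA₂
  have hA₁m : MeasurableSet A₁ :=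
    (hZ Metric.isOpen_ball.measurableSet).inter (hW hGm)
  have hA₂m : MeasurableSet A₂ := hA₁m.inter ((hW.prodMk hR) hBadm)
  have hfrac' : P.real A₂ ≤ 2 / 3 * P.real A₁ := by
    have e1 : ∫⁻ ω, ENNReal.ofReal (nbhdInd x δ (Z ω)) * (G.indicator 1 (direction Z x φ N ω) *
        Bad.indicator 1 (direction Z x φ N ω, radius Z x φ N ω)) ∂P = P A₂ := by
      rw [← lintegral_indicator_one hA₂m]
      refine lintegral_congr fun ω => ?_
      by_cases h1 : Z ω ∈ Metric.ball x δ <;> by_cases h2 : direction Z x φ N ω ∈ G <;>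
        by_cases h3 : (direction Z x φ N ω, radius Z x φ N ω) ∈ Bad <;>
        simp only [Set.indicator, nbhdInd, hA₂, hA₁, Set.mem_inter_iff, Set.mem_ofPred_eq, h1, h2,
          h3] <;> simp
    have e2 : ∫⁻ ω, ENNReal.ofReal (nbhdInd x δ (Z ω)) * G.indicator 1 (direction Z x φ N ω) ∂P
        = P A₁ := by
      rw [← lintegral_indicator_one hA₁m]
      refine lintegral_congr fun ω => ?_
      by_cases h1 : Z ω ∈ Metric.ball x δ <;> by_cases h2 : direction Z x φ N ω ∈ G <;>
        simp only [Set.indicator, nbhdInd, hA₁, Set.mem_ofPred_eq, h1, h2] <;> simp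
    rw [e1, e2] at hfrac
    have := ENNReal.toReal_mono
      (ENNReal.mul_ne_top ENNReal.ofReal_ne_top (measure_ne_top P A₁)) hfrac
    rwa [ENNReal.toReal_mul, ENNReal.toReal_ofReal (by norm_num)] at this
  have hmass' : P.real {ω | Z ω ∈ Metric.ball x δ} / c₂ ≤ P.real A₁ := by
    refine hmass.trans (measureReal_mono fun ω hω => ⟨hω.1, ?_⟩)
    have : Prod.mk (direction Z x φ N ω) ⁻¹' S = ∅ := by
      refine Set.eq_empty_of_forall_notMem fun t ht => ?_
      exact absurd (hω.2 t ht.1) (not_le.2 ht.2)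
    rw [hG, Set.mem_ofPred_eq, this, measure_empty]
  have hdiff : P.real {ω | Z ω ∈ Metric.ball x δ} / c₂ / 3 ≤ P.real (A₁ \ A₂) := by
    rw [measureReal_sdiff Set.inter_subset_left hA₂m]
    linarith
  have hint : Integrable (fun ω => nbhdInd x δ (Z ω) * (monomials φ x J K (Z ω) ⬝ᵥ v) ^ 2) P := by
    refine Integrable.of_bound (C := (∑ k, |v k|) ^ 2) (hI.mul
      (((measurable_monomials_dotProduct φ x v).comp hZ).pow_const 2)).aestronglyMeasurable
      (ae_of_all _ fun ω => ?_)
    refine abs_nbhdInd_mul_le (sq_nonneg _) fun h => ?_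
    rw [abs_pow]
    exact pow_le_pow_left₀ (abs_nonneg _)
      (abs_monomials_dotProduct_le φ v (h.le.trans hδ)) 2
  calc P.real {ω | Z ω ∈ Metric.ball x δ} / c₂ / 3 * τ ^ 2
      ≤ P.real (A₁ \ A₂) * τ ^ 2 := by gcongr
    _ = ∫ ω, (A₁ \ A₂).indicator (fun _ => τ ^ 2) ω ∂P := by
        rw [integral_indicator (hA₁m.diff hA₂m), setIntegral_const, smul_eq_mul]
    _ ≤ ∫ ω, nbhdInd x δ (Z ω) * (monomials φ x J K (Z ω) ⬝ᵥ v) ^ 2 ∂P := by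
        refine integral_mono ((integrable_const _).indicator (hA₁m.diff hA₂m)) hint fun ω => ?_
        by_cases hω : ω ∈ A₁ \ A₂
        swap
        · rw [Set.indicator_of_notMem hω]
          exact mul_nonneg (nbhdInd_nonneg x δ _) (sq_nonneg _)
        rw [Set.indicator_of_mem hω]
        rw [nbhdInd, Set.indicator_of_mem hω.1.1, one_mul, hF, ← sq_abs ((Polynomial.eval _ _))]
        refine pow_le_pow_left₀ hτ0.le ?_ 2
        rcases (hR0 ω).eq_or_lt with h | h
        · rw [← h, eval_zero_rayPolynomial, hv, abs_one]
          exact hτ1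
        · by_contra! hcon
          exact hω.2 ⟨hω.1, h, hcon.le⟩

theorem design_second_moment (hZ : Measurable Z) (hδ : δ ≤ 1) {c₁ c₂ : ℝ} {J : ℕ}
    (hrad : RadialDensityCondition P Z x δ φ c₁ c₂ J)
    {B : ℝ} (hB : 1 ≤ B) (hcB : c₁ * J ≤ B) {K : ℕ} (hK : 0 < K) (v : multiIndices J K → ℝ) :
    P.real {ω | Z ω ∈ Metric.ball x δ} / c₂ / 3 * smallValueLevel K B ^ 2 *
        (v ⬝ᵥ unitZero J K) ^ 2 ≤
      ∫ ω, nbhdInd x δ (Z ω) * (monomials φ x J K (Z ω) ⬝ᵥ v) ^ 2 ∂P := by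
  set a := v ⬝ᵥ unitZero J K with ha
  rcases eq_or_ne a 0 with h0 | h0
  · rw [h0, zero_pow two_ne_zero, mul_zero]
    exact integral_nonneg fun ω => mul_nonneg (nbhdInd_nonneg x δ _) (sq_nonneg _)
  · have h := design_second_moment_of_eq_one hZ hδ hrad hB hcB hK (a⁻¹ • v)
      (by rw [smul_dotProduct, ← ha, smul_eq_mul, inv_mul_cancel₀ h0])
    have e : ∀ ω, nbhdInd x δ (Z ω) * (monomials φ x J K (Z ω) ⬝ᵥ (a⁻¹ • v)) ^ 2 =
        (a ^ 2)⁻¹ * (nbhdInd x δ (Z ω) * (monomials φ x J K (Z ω) ⬝ᵥ v) ^ 2) := fun ω => by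
      rw [dotProduct_smul, smul_eq_mul, mul_pow, inv_pow]
      ring
    simp only [e] at h
    rw [integral_const_mul, ← div_eq_inv_mul, le_div_iff₀ (by positivity)] at h
    exact h

end Design

/-! ### Concentration of the empirical Gram matrix -/

section Concentration

open scoped MatrixOrder Matrix.Norms.L2Operator in
theorem exists_factor_of_posDef {ι : Type*} [Fintype ι] [DecidableEq ι] {T : Matrix ι ι ℝ}
    (hT : T.PosDef) : ∃ B : Matrix ι ι ℝ, IsUnit B ∧ T = B.transpose * B := by
  obtain ⟨B, hB, rfl⟩ :=
    CStarAlgebra.isStrictlyPositive_iff_eq_star_mul_self.mp hT.isStrictlyPositive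
  exact ⟨B, hB, by rw [Matrix.star_eq_conjTranspose, Matrix.conjTranspose_eq_transpose_of_trivial]⟩

variable {ι : Type*} [Fintype ι]

/-- Leverage bound: if the columns of `U` are orthonormal with respect to a quadratic form which
dominates `s ∑ d_k v_k²`, then the vector `a` has small components in this basis. -/
theorem whitened_sq_le [DecidableEq ι] {s : ℝ} (hs : 0 < s) {d : ι → ℝ}
    (hd : ∀ k, 0 < d k) {U B : Matrix ι ι ℝ} (hBU : B * U = 1)
    (hquad : ∀ v : ι → ℝ, s * ∑ k, d k * v k ^ 2 ≤ Matrix.mulVec B v ⬝ᵥ Matrix.mulVec B v)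
    {C : ℝ} (a : ι → ℝ) (ha : ∑ k, a k ^ 2 / d k ≤ C) :
    ∑ i, (a ⬝ᵥ fun k => U k i) ^ 2 ≤ C / s := by
  set f : ι → ℝ := fun i => a ⬝ᵥ fun k => U k i with hf
  set z : ι → ℝ := Matrix.mulVec U f with hz
  set q : ℝ := ∑ i, f i ^ 2 with hq
  have hq0 : 0 ≤ q := Finset.sum_nonneg fun i _ => sq_nonneg _
  have hC0 : 0 ≤ C := (Finset.sum_nonneg fun k _ => div_nonneg (sq_nonneg _) (hd k).le).trans ha
  have haz : a ⬝ᵥ z = q := by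
    simp only [hz, hq, dotProduct, Matrix.mulVec, Finset.mul_sum]
    rw [Finset.sum_comm]
    refine Finset.sum_congr rfl fun i _ => ?_
    simp only [hf, dotProduct, pow_two, Finset.sum_mul]
    exact Finset.sum_congr rfl fun k _ => by ring
  have hBz : Matrix.mulVec B z = f := by
    rw [hz, Matrix.mulVec_mulVec, hBU, Matrix.one_mulVec]
  have h1 : s * ∑ k, d k * z k ^ 2 ≤ q := by
    have h := hquad z
    rw [hBz] at h
    have h2 : f ⬝ᵥ f = q := by simp only [hq, dotProduct, pow_two]
    rwa [h2] at h
  have h2 : q ^ 2 ≤ (∑ k, a k ^ 2 / d k) * ∑ k, d k * z k ^ 2 := by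
    rw [← haz]
    refine Finset.sum_sq_le_sum_mul_sum_of_sq_le_mul _
      (fun k _ => div_nonneg (sq_nonneg _) (hd k).le)
      (fun k _ => mul_nonneg (hd k).le (sq_nonneg _)) fun k _ => le_of_eq ?_
    have := (hd k).ne'
    field_simp
  rw [le_div_iff₀ hs]
  have hS0 : 0 ≤ ∑ k, d k * z k ^ 2 := Finset.sum_nonneg fun k _ =>
    mul_nonneg (hd k).le (sq_nonneg _)
  have h3 : q ^ 2 ≤ C * ∑ k, d k * z k ^ 2 := h2.trans (mul_le_mul_of_nonneg_right ha hS0)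
  have h4 : q * (q * s) ≤ q * C := by nlinarith
  rcases hq0.eq_or_lt with h | h
  · rw [← h, zero_mul]
    exact hC0
  · exact le_of_mul_le_mul_left h4 h

variable {Ω S : Type*} [MeasurableSpace Ω] [MeasurableSpace S] {P : Measure Ω}
  [IsProbabilityMeasure P] {X : ℕ → Ω → S}

theorem integrable_comp_of_bounded {Z : Ω → S} (hZ : Measurable Z) {h : S → ℝ} (hh : Measurable h)
    {L : ℝ} (hL : ∀ u, |h u| ≤ L) : Integrable (fun ω => h (Z ω)) P :=
  Integrable.of_bound (hh.comp hZ).aestronglyMeasurable (C := L) (ae_of_all _ fun _ => hL _)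

theorem integral_sq_centered_sum_le (hX : ∀ j, Measurable (X j))
    (hind : ∀ i j, i ≠ j → X i ⟂ᵢ[P] X j) (hid : ∀ j, IdentDistrib (X j) (X 0) P P)
    {h : S → ℝ} (hh : Measurable h) {L : ℝ} (hL : ∀ u, |h u| ≤ L) (n : ℕ) :
    ∫ ω, (∑ j ∈ Finset.range n, h (X j ω) - n * ∫ ω, h (X 0 ω) ∂P) ^ 2 ∂P ≤
      n * ∫ ω, h (X 0 ω) ^ 2 ∂P := by
  have hm : ∀ j, Measurable fun ω => h (X j ω) := fun j => hh.comp (hX j)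
  have hid' : ∀ j, IdentDistrib (fun ω => h (X j ω)) (fun ω => h (X 0 ω)) P P := fun j =>
    (hid j).comp hh
  have hmean : ∫ ω, (∑ j ∈ Finset.range n, fun ω => h (X j ω)) ω ∂P =
      n * ∫ ω, h (X 0 ω) ∂P := by
    simp only [Finset.sum_apply]
    rw [integral_finsetSum _ fun j _ => integrable_comp_of_bounded (hX j) hh hL]
    simp [fun j => (hid' j).integral_eq]
  have hvar := IndepFun.variance_sum (μ := P) (X := fun j ω => h (X j ω)) (s := Finset.range n)
    (fun j _ => MemLp.of_bound (hm j).aestronglyMeasurable L (ae_of_all _ fun ω => hL _))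
    fun i _ j _ hij => (hind i j hij).comp hh hh
  have hsum : Measurable (∑ j ∈ Finset.range n, fun ω => h (X j ω)) := by
    rw [Finset.sum_fn]
    exact Finset.measurable_sum _ fun j _ => hm j
  rw [variance_eq_integral hsum.aemeasurable, hmean] at hvar
  simp only [Finset.sum_apply] at hvar
  rw [hvar, Finset.sum_congr rfl fun j _ => (hid' j).variance_eq, Finset.sum_const,
    Finset.card_range, nsmul_eq_mul]
  gcongr
  exact variance_le_expectation_sq (hm 0).aestronglyMeasurable

theorem measurable_dotProduct_const {ζ : S → ι → ℝ} (hζ : ∀ k, Measurable fun u => ζ u k)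
    (v : ι → ℝ) : Measurable fun u => ζ u ⬝ᵥ v :=
  Finset.measurable_sum _ fun k _ => (hζ k).mul_const _

theorem abs_dotProduct_le_sum {a : ι → ℝ} (ha : ∀ k, |a k| ≤ 1) (v : ι → ℝ) :
    |a ⬝ᵥ v| ≤ ∑ k, |v k| := by
  refine (Finset.abs_sum_le_sum_abs _ _).trans (Finset.sum_le_sum fun k _ => ?_)
  rw [abs_mul]
  exact mul_le_of_le_one_left (abs_nonneg _) (ha k)

/-- A matrix `U` and its inverse `B` such that the columns of `U` are orthonormal with respect to
the quadratic form `n E (ζ ⬝ v)² + s ∑ d_k v_k²`. -/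
theorem exists_whitening [DecidableEq ι] {ζ : S → ι → ℝ} (hζm : ∀ k, Measurable fun u => ζ u k)
    (hζ1 : ∀ u k, |ζ u k| ≤ 1) {Z : Ω → S} (hZ : Measurable Z) (n : ℕ) {s : ℝ} (hs : 0 < s)
    {d : ι → ℝ} (hd : ∀ k, 0 < d k) :
    ∃ U B : Matrix ι ι ℝ, U * B = 1 ∧ B * U = 1 ∧ ∀ v : ι → ℝ,
      n * ∫ ω, (ζ (Z ω) ⬝ᵥ v) ^ 2 ∂P + s * ∑ k, d k * v k ^ 2 =
        Matrix.mulVec B v ⬝ᵥ Matrix.mulVec B v := by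
  set T : Matrix ι ι ℝ := Matrix.of fun k k' =>
    n * ∫ ω, ζ (Z ω) k * ζ (Z ω) k' ∂P + s * Matrix.diagonal d k k' with hT
  have hint : ∀ (c : ℝ) k k', Integrable (fun ω => c * (ζ (Z ω) k * ζ (Z ω) k')) P :=
    fun c k k' => Integrable.const_mul (integrable_comp_of_bounded hZ ((hζm k).mul (hζm k'))
      (L := 1)
      fun u => by
        rw [Pi.mul_apply, abs_mul]
        exact mul_le_one₀ (hζ1 u k) (abs_nonneg _) (hζ1 u k')) c
  have hquad : ∀ v : ι → ℝ, v ⬝ᵥ Matrix.mulVec T v =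
      n * ∫ ω, (ζ (Z ω) ⬝ᵥ v) ^ 2 ∂P + s * ∑ k, d k * v k ^ 2 := by
    intro v
    have e1 : ∫ ω, (ζ (Z ω) ⬝ᵥ v) ^ 2 ∂P =
        ∑ k, ∑ k', v k * v k' * ∫ ω, ζ (Z ω) k * ζ (Z ω) k' ∂P := by
      have : ∀ ω, (ζ (Z ω) ⬝ᵥ v) ^ 2 = ∑ k, ∑ k', v k * v k' * (ζ (Z ω) k * ζ (Z ω) k') := by
        intro ω
        rw [pow_two, dotProduct, Finset.sum_mul_sum]
        exact Finset.sum_congr rfl fun k _ => Finset.sum_congr rfl fun k' _ => by ring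
      simp only [this]
      rw [integral_finsetSum _ fun k _ => integrable_finsetSum _ fun k' _ => hint _ k k']
      refine Finset.sum_congr rfl fun k _ => ?_
      rw [integral_finsetSum _ fun k' _ => hint _ k k']
      exact Finset.sum_congr rfl fun k' _ => integral_const_mul _ _
    rw [e1, dotProduct]
    simp only [Matrix.mulVec, dotProduct, hT, Matrix.of_apply, Finset.mul_sum, add_mul, mul_add,
      Finset.sum_add_distrib]
    congr 1
    · exact Finset.sum_congr rfl fun k _ => Finset.sum_congr rfl fun k' _ => by ring
    · refine Finset.sum_congr rfl fun k _ => ?_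
      rw [Finset.sum_eq_single k]
      · rw [Matrix.diagonal_apply_eq]
        ring
      · intro k' _ hne
        rw [Matrix.diagonal_apply_ne' _ hne]
        ring
      · simp
  have hpos : T.PosDef := by
    refine Matrix.PosDef.of_dotProduct_mulVec_pos ?_ fun v hv => ?_
    · rw [Matrix.IsHermitian, Matrix.conjTranspose_eq_transpose_of_trivial]
      ext k k'
      simp only [hT, Matrix.transpose_apply, Matrix.of_apply]
      congr 2
      · exact integral_congr_ae (ae_of_all _ fun ω => mul_comm _ _)
      · rw [← Matrix.transpose_apply (Matrix.diagonal d), Matrix.diagonal_transpose]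
    · rw [star_trivial, hquad]
      obtain ⟨k, hk⟩ := Function.ne_iff.1 hv
      refine add_pos_of_nonneg_of_pos
        (mul_nonneg n.cast_nonneg (integral_nonneg fun ω => sq_nonneg _)) (mul_pos hs ?_)
      exact Finset.sum_pos' (fun i _ => mul_nonneg (hd i).le (sq_nonneg _))
        ⟨k, Finset.mem_univ k, mul_pos (hd k) (sq_pos_of_ne_zero hk)⟩
  obtain ⟨B, hB, hTB⟩ := exists_factor_of_posDef hpos
  have hdet := (Matrix.isUnit_iff_isUnit_det B).1 hB
  refine ⟨B⁻¹, B, Matrix.nonsing_inv_mul B hdet, Matrix.mul_nonsing_inv B hdet, fun v => ?_⟩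
  rw [← hquad, hTB, ← Matrix.mulVec_mulVec, Matrix.dotProduct_transpose_mulVec]

/-- With probability at least `1 - 4 C |ι| / s`, the empirical second moments of all linear
combinations `ζ ⬝ v` are, up to the ridge term, at least one half of the true ones. The matrix is
whitened with the true second moments plus the ridge term; a second moment bound for its
Hilbert–Schmidt norm suffices, since the leverages are at most `C / s` and their sum has mean at
most `|ι|`. -/
theorem gram_lower_bound [DecidableEq ι] (hX : ∀ j, Measurable (X j))
    (hind : ∀ i j, i ≠ j → X i ⟂ᵢ[P] X j) (hid : ∀ j, IdentDistrib (X j) (X 0) P P)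
    {ζ : S → ι → ℝ} (hζm : ∀ k, Measurable fun u => ζ u k)
    (hζ1 : ∀ u k, |ζ u k| ≤ 1) (n : ℕ) {s : ℝ} (hs : 0 < s)
    {d : ι → ℝ} (hd : ∀ k, 0 < d k) {C : ℝ} (hC : ∀ u, ∑ k, ζ u k ^ 2 / d k ≤ C) (hC0 : 0 ≤ C) :
    ∃ E : Set Ω, MeasurableSet E ∧ P.real Eᶜ ≤ 4 * C * Fintype.card ι / s ∧ ∀ ω ∈ E, ∀ v : ι → ℝ,
      n / 2 * ∫ ω, (ζ (X 0 ω) ⬝ᵥ v) ^ 2 ∂P ≤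
        ∑ j ∈ Finset.range n, (ζ (X j ω) ⬝ᵥ v) ^ 2 + s / 2 * ∑ k, d k * v k ^ 2 := by
  obtain ⟨U, B, hUB, hBU, hquad⟩ := exists_whitening (P := P) hζm hζ1 (hX 0) n hs hd
  set f : ι → S → ℝ := fun i u => ζ u ⬝ᵥ fun k => U k i with hf
  have hfm : ∀ i, Measurable (f i) := fun i => measurable_dotProduct_const hζm _
  obtain ⟨L, hL⟩ : ∃ L : ℝ, ∀ i u, |f i u| ≤ L :=
    ⟨∑ i, ∑ k, |U k i|, fun i u => (abs_dotProduct_le_sum (hζ1 u) _).trans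
      (Finset.single_le_sum (f := fun i => ∑ k, |U k i|)
        (fun i _ => Finset.sum_nonneg fun k _ => abs_nonneg _) (Finset.mem_univ i))⟩
  have hlev : ∀ u, ∑ i, f i u ^ 2 ≤ C / s := fun u => whitened_sq_le hs hd hBU
    (fun v => by
      rw [← hquad v, le_add_iff_nonneg_left]
      exact mul_nonneg n.cast_nonneg (integral_nonneg fun ω => sq_nonneg _)) _ (hC u)
  have hff : ∀ i i' u, |f i u * f i' u| ≤ L * L := fun i i' u => by
    rw [abs_mul]
    exact mul_le_mul (hL i u) (hL i' u) (abs_nonneg _) ((abs_nonneg _).trans (hL i u))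
  have hnorm : ∀ i, n * ∫ ω, f i (X 0 ω) ^ 2 ∂P ≤ 1 := by
    intro i
    have h := hquad fun k => U k i
    have e : (Matrix.mulVec B fun k => U k i) = (1 : Matrix ι ι ℝ).col i := by
      ext k
      rw [← hBU]
      rfl
    have e1 : (1 : Matrix ι ι ℝ).col i ⬝ᵥ (1 : Matrix ι ι ℝ).col i = 1 := by
      simp [dotProduct, Matrix.col, Matrix.one_apply]
    rw [e, e1] at h
    have : 0 ≤ s * ∑ k, d k * U k i ^ 2 :=
      mul_nonneg hs.le (Finset.sum_nonneg fun k _ => mul_nonneg (hd k).le (sq_nonneg _))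
    simp only [hf]
    linarith
  set D : ι → ι → Ω → ℝ := fun i i' ω =>
    ∑ j ∈ Finset.range n, f i (X j ω) * f i' (X j ω) - n * ∫ ω, f i (X 0 ω) * f i' (X 0 ω) ∂P
    with hD
  have hDm : ∀ i i', Measurable (D i i') := fun i i' =>
    (Finset.measurable_sum _ fun j _ => ((hfm i).comp (hX j)).mul
      ((hfm i').comp (hX j))).sub_const _
  have hDb : ∀ i i' ω, |D i i' ω ^ 2| ≤
      (n * (L * L) + |n * ∫ ω, f i (X 0 ω) * f i' (X 0 ω) ∂P|) ^ 2 := by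
    intro i i' ω
    rw [abs_pow]
    refine pow_le_pow_left₀ (abs_nonneg _) ((abs_sub _ _).trans (add_le_add ?_ le_rfl)) 2
    refine (Finset.abs_sum_le_sum_abs _ _).trans
      ((Finset.sum_le_sum fun j _ => hff i i' (X j ω)).trans ?_)
    simp
  have hDint : ∀ i i', Integrable (fun ω => D i i' ω ^ 2) P := fun i i' =>
    Integrable.of_bound ((hDm i i').pow_const 2).aestronglyMeasurable _ (ae_of_all _ (hDb i i'))
  set H : Ω → ℝ := fun ω => ∑ i, ∑ i', D i i' ω ^ 2 with hH
  have hHm : Measurable H := Finset.measurable_sum _ fun i _ => Finset.measurable_sum _ fun i' _ =>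
    (hDm i i').pow_const 2
  have hH0 : ∀ ω, 0 ≤ H ω := fun ω => Finset.sum_nonneg fun i _ => Finset.sum_nonneg fun i' _ =>
    sq_nonneg _
  have hHint : Integrable H P := integrable_finsetSum _ fun i _ => integrable_finsetSum _
    fun i' _ => hDint i i'
  have hf2int : ∀ i, Integrable (fun ω => f i (X 0 ω) ^ 2) P := fun i =>
    integrable_comp_of_bounded (hX 0) ((hfm i).pow_const 2) (L := L * L) fun u => by
      rw [pow_two]
      exact hff i i u
  have hprodint : ∀ i i', Integrable (fun ω => (f i (X 0 ω) * f i' (X 0 ω)) ^ 2) P := fun i i' =>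
    integrable_comp_of_bounded (hX 0) (((hfm i).mul (hfm i')).pow_const 2) (L := (L * L) ^ 2)
      fun u => by
        rw [abs_pow]
        exact pow_le_pow_left₀ (abs_nonneg _) (hff i i' u) 2
  have hmean : ∫ ω, H ω ∂P ≤ C / s * Fintype.card ι := by
    have e1 : ∫ ω, H ω ∂P = ∑ i, ∑ i', ∫ ω, D i i' ω ^ 2 ∂P := by
      rw [hH, integral_finsetSum _ fun i _ => integrable_finsetSum _ fun i' _ => hDint i i']
      exact Finset.sum_congr rfl fun i _ => integral_finsetSum _ fun i' _ => hDint i i'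
    have e2 : ∀ i i', ∫ ω, D i i' ω ^ 2 ∂P ≤ n * ∫ ω, (f i (X 0 ω) * f i' (X 0 ω)) ^ 2 ∂P :=
      fun i i' => integral_sq_centered_sum_le hX hind hid ((hfm i).mul (hfm i')) (hff i i') n
    calc ∫ ω, H ω ∂P ≤ ∑ i, ∑ i', n * ∫ ω, (f i (X 0 ω) * f i' (X 0 ω)) ^ 2 ∂P := by
          rw [e1]
          exact Finset.sum_le_sum fun i _ => Finset.sum_le_sum fun i' _ => e2 i i'
      _ = ∑ i, n * ∫ ω, ∑ i', (f i (X 0 ω) * f i' (X 0 ω)) ^ 2 ∂P := by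
          refine Finset.sum_congr rfl fun i _ => ?_
          rw [integral_finsetSum _ fun i' _ => hprodint i i', Finset.mul_sum]
      _ ≤ ∑ i, n * ∫ ω, C / s * f i (X 0 ω) ^ 2 ∂P := by
          refine Finset.sum_le_sum fun i _ => mul_le_mul_of_nonneg_left ?_ n.cast_nonneg
          refine integral_mono (integrable_finsetSum _ fun i' _ => hprodint i i')
            ((hf2int i).const_mul _) fun ω => ?_
          simp only [mul_pow, ← Finset.mul_sum]
          rw [mul_comm]
          exact mul_le_mul_of_nonneg_right (hlev _) (sq_nonneg _)
      _ = C / s * ∑ i, n * ∫ ω, f i (X 0 ω) ^ 2 ∂P := by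
          rw [Finset.mul_sum]
          refine Finset.sum_congr rfl fun i _ => ?_
          rw [integral_const_mul]
          ring
      _ ≤ C / s * ∑ _i : ι, 1 := by
          gcongr with i
          exact hnorm i
      _ = C / s * Fintype.card ι := by simp
  refine ⟨{ω | H ω < 1 / 4}, measurableSet_lt hHm measurable_const, ?_, ?_⟩
  · have hmk := mul_meas_ge_le_integral_of_nonneg (μ := P) (ae_of_all _ hH0) hHint (1 / 4)
    have hset : {ω | H ω < 1 / 4}ᶜ = {ω | 1 / 4 ≤ H ω} := by
      ext ω
      simp
    rw [hset]
    have e : 4 * C * Fintype.card ι / s = 4 * (C / s * Fintype.card ι) := by ring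
    rw [e]
    linarith
  · intro ω hω v
    have hω : H ω < 1 / 4 := hω
    set a : ι → ℝ := Matrix.mulVec B v with ha
    have hv : v = Matrix.mulVec U a := by
      rw [ha, Matrix.mulVec_mulVec, hUB, Matrix.one_mulVec]
    have hexp : ∀ u, ζ u ⬝ᵥ v = ∑ i, a i * f i u := by
      intro u
      rw [hv]
      simp only [hf, dotProduct, Matrix.mulVec, Finset.mul_sum]
      rw [Finset.sum_comm]
      exact Finset.sum_congr rfl fun i _ => Finset.sum_congr rfl fun k _ => by ring
    have hsq : ∀ u, (ζ u ⬝ᵥ v) ^ 2 = ∑ i, ∑ i', a i * a i' * (f i u * f i' u) := by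
      intro u
      rw [hexp, pow_two, Finset.sum_mul_sum]
      exact Finset.sum_congr rfl fun i _ => Finset.sum_congr rfl fun i' _ => by ring
    have hintff : ∀ i i', Integrable (fun ω => f i (X 0 ω) * f i' (X 0 ω)) P := fun i i' =>
      integrable_comp_of_bounded (hX 0) ((hfm i).mul (hfm i')) (hff i i')
    have hdev : ∑ j ∈ Finset.range n, (ζ (X j ω) ⬝ᵥ v) ^ 2 - n * ∫ ω, (ζ (X 0 ω) ⬝ᵥ v) ^ 2 ∂P =
        ∑ i, ∑ i', a i * a i' * D i i' ω := by
      have e1 : ∫ ω, (ζ (X 0 ω) ⬝ᵥ v) ^ 2 ∂P =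
          ∑ i, ∑ i', a i * a i' * ∫ ω, f i (X 0 ω) * f i' (X 0 ω) ∂P := by
        simp only [hsq]
        rw [integral_finsetSum _ fun i _ => integrable_finsetSum _ fun i' _ =>
          (hintff i i').const_mul _]
        refine Finset.sum_congr rfl fun i _ => ?_
        rw [integral_finsetSum _ fun i' _ => (hintff i i').const_mul _]
        exact Finset.sum_congr rfl fun i' _ => integral_const_mul _ _
      simp only [hD, mul_sub, Finset.sum_sub_distrib]
      congr 1
      · simp only [hsq, Finset.mul_sum]
        rw [Finset.sum_comm]
        exact Finset.sum_congr rfl fun i _ => Finset.sum_comm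
      · rw [e1]
        simp only [Finset.mul_sum]
        exact Finset.sum_congr rfl fun i _ => Finset.sum_congr rfl fun i' _ => by ring
    set q : ℝ := ∑ i, a i ^ 2 with hq
    have hq0 : 0 ≤ q := Finset.sum_nonneg fun i _ => sq_nonneg _
    have hcs : (∑ i, ∑ i', a i * a i' * D i i' ω) ^ 2 ≤ q ^ 2 * H ω := by
      have h := Finset.sum_mul_sq_le_sq_mul_sq (Finset.univ : Finset (ι × ι))
        (fun z => a z.1 * a z.2) fun z => D z.1 z.2 ω
      have e1 : ∑ z : ι × ι, (a z.1 * a z.2) ^ 2 = q ^ 2 := by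
        rw [Fintype.sum_prod_type, pow_two q, hq, Finset.sum_mul_sum]
        simp only [mul_pow]
      have e2 : ∑ z : ι × ι, D z.1 z.2 ω ^ 2 = H ω := Fintype.sum_prod_type _
      have e3 : ∑ z : ι × ι, a z.1 * a z.2 * D z.1 z.2 ω = ∑ i, ∑ i', a i * a i' * D i i' ω :=
        Fintype.sum_prod_type _
      rwa [e1, e2, e3] at h
    have habs : |∑ i, ∑ i', a i * a i' * D i i' ω| ≤ q / 2 := by
      refine abs_le_of_sq_le_sq ?_ (by linarith)
      nlinarith [sq_nonneg q]
    have hqq : n * ∫ ω, (ζ (X 0 ω) ⬝ᵥ v) ^ 2 ∂P + s * ∑ k, d k * v k ^ 2 = q := by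
      rw [hquad v, ← ha, hq]
      simp only [dotProduct, pow_two]
    rw [← hdev] at habs
    have := (abs_le.1 habs).1
    linarith

end Concentration

/-! ### Weighted sums of conditionally centered errors -/

section Noise

variable {Ω S β : Type*} [MeasurableSpace Ω] [MeasurableSpace S] [MeasurableSpace β]
  {P : Measure Ω} [IsProbabilityMeasure P]

/-- Fubini's theorem for a pair `(U, η)` which is independent of `R`. -/
theorem integral_mul_of_indep {U : Ω → S} {η : Ω → ℝ} {R : Ω → β} (hU : Measurable U)
    (hη : Measurable η) (hR : Measurable R) (hind : (fun ω => (U ω, η ω)) ⟂ᵢ[P] R)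
    (hηi : Integrable η P) {H : S × β → ℝ} (hH : Measurable H) {b : β → ℝ} (hb : Measurable b)
    (hbi : Integrable (fun ω => b (R ω)) P) (hHb : ∀ u r, |H (u, r)| ≤ b r) :
    ∫ ω, H (U ω, R ω) * η ω ∂P = ∫ ω, (∫ ω', H (U ω', R ω) * η ω' ∂P) ∂P ∧
      Integrable (fun ω => ∫ ω', H (U ω', R ω) * η ω' ∂P) P := by
  set k : (S × ℝ) × β → ℝ := fun z => H (z.1.1, z.2) * z.1.2 with hk
  have hkm : Measurable k := by
    refine (hH.comp ?_).mul (measurable_snd.comp measurable_fst)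
    exact (measurable_fst.comp measurable_fst).prodMk measurable_snd
  have hUη : Measurable fun ω => (U ω, η ω) := hU.prodMk hη
  have hmap := (indepFun_iff_map_prod_eq_prod_map_map hUη.aemeasurable hR.aemeasurable).1 hind
  have hp1 : IsProbabilityMeasure (P.map fun ω => (U ω, η ω)) :=
    Measure.isProbabilityMeasure_map hUη.aemeasurable
  have hp2 : IsProbabilityMeasure (P.map R) := Measure.isProbabilityMeasure_map hR.aemeasurable
  have hint : Integrable k ((P.map fun ω => (U ω, η ω)).prod (P.map R)) := by
    have h1 : Integrable (fun z : S × ℝ => z.2) (P.map fun ω => (U ω, η ω)) :=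
      (integrable_map_measure measurable_snd.aestronglyMeasurable hUη.aemeasurable).2 hηi
    have h2 : Integrable b (P.map R) :=
      (integrable_map_measure hb.aestronglyMeasurable hR.aemeasurable).2 hbi
    refine (h1.mul_prod h2).mono hkm.aestronglyMeasurable (ae_of_all _ fun z => ?_)
    rw [hk, Real.norm_eq_abs, Real.norm_eq_abs, abs_mul, abs_mul, mul_comm]
    exact mul_le_mul_of_nonneg_left ((hHb _ _).trans (le_abs_self _)) (abs_nonneg _)
  have hsec : ∀ r, Measurable fun z : S × ℝ => k (z, r) := fun r => hkm.comp measurable_prodMk_right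
  have hinner : ∀ r, ∫ z, k (z, r) ∂(P.map fun ω => (U ω, η ω)) = ∫ ω', H (U ω', r) * η ω' ∂P :=
    fun r => integral_map hUη.aemeasurable (hsec r).aestronglyMeasurable
  have hright := hint.integral_prod_right
  constructor
  · calc ∫ ω, H (U ω, R ω) * η ω ∂P
        = ∫ z, k z ∂(P.map fun ω => ((U ω, η ω), R ω)) :=
          (integral_map (hUη.prodMk hR).aemeasurable hkm.aestronglyMeasurable).symm
      _ = ∫ r, ∫ z, k (z, r) ∂(P.map fun ω => (U ω, η ω)) ∂(P.map R) := by
          rw [hmap, integral_prod_symm _ hint]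
      _ = ∫ ω, ∫ z, k (z, R ω) ∂(P.map fun ω => (U ω, η ω)) ∂P :=
          integral_map hR.aemeasurable hright.aestronglyMeasurable
      _ = ∫ ω, (∫ ω', H (U ω', R ω) * η ω' ∂P) ∂P := by simp only [hinner]
  · have := (integrable_map_measure hright.aestronglyMeasurable hR.aemeasurable).1 hright
    simpa only [Function.comp_def, hinner] using this

theorem integral_comp_mul_eq_condExp {U : Ω → S} {η : Ω → ℝ} (hU : Measurable U)
    (hηi : Integrable η P) {h : S → ℝ} (hh : Measurable h) {c : ℝ} (hc : ∀ u, |h u| ≤ c) :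
    ∫ ω, h (U ω) * η ω ∂P =
      ∫ ω, h (U ω) * (P[η | MeasurableSpace.comap U inferInstance]) ω ∂P := by
  have hm : MeasurableSpace.comap U inferInstance ≤ (inferInstance : MeasurableSpace Ω) :=
    hU.comap_le
  have hsm : StronglyMeasurable[MeasurableSpace.comap U inferInstance] fun ω => h (U ω) :=
    (hh.comp (comap_measurable U)).stronglyMeasurable
  have h1 := condExp_stronglyMeasurable_mul_of_bound hm hsm hηi c (ae_of_all _ fun ω => hc (U ω))
  have h2 := integral_condExp hm (f := (fun ω => h (U ω)) * η) (μ := P)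
  rw [integral_congr_ae h1] at h2
  exact h2.symm

theorem integral_mul_eq_zero_of_indep {U : Ω → S} {η : Ω → ℝ} {R : Ω → β} (hU : Measurable U)
    (hη : Measurable η) (hR : Measurable R) (hind : (fun ω => (U ω, η ω)) ⟂ᵢ[P] R)
    (hηi : Integrable η P) (hcent : P[η | MeasurableSpace.comap U inferInstance] =ᵐ[P] 0)
    {H : S × β → ℝ} (hH : Measurable H) {b : β → ℝ} (hb : Measurable b)
    (hbi : Integrable (fun ω => b (R ω)) P) (hHb : ∀ u r, |H (u, r)| ≤ b r) :
    ∫ ω, H (U ω, R ω) * η ω ∂P = 0 := by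
  rw [(integral_mul_of_indep hU hη hR hind hηi hH hb hbi hHb).1]
  have : ∀ r, ∫ ω', H (U ω', r) * η ω' ∂P = 0 := fun r => by
    rw [integral_comp_mul_eq_condExp hU hηi (h := fun u => H (u, r))
      (hH.comp measurable_prodMk_right) fun u => hHb u r]
    rw [integral_eq_zero_of_ae]
    filter_upwards [hcent] with ω hω
    simp [hω]
  simp [this]

theorem integral_mul_le_of_indep {U : Ω → S} {η : Ω → ℝ} {R : Ω → β} (hU : Measurable U)
    (hη : Measurable η) (hR : Measurable R) (hind : (fun ω => (U ω, η ω)) ⟂ᵢ[P] R)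
    (hηi : Integrable η P) {c : ℝ}
    (hcond : P[η | MeasurableSpace.comap U inferInstance] ≤ᵐ[P] fun _ => c)
    {H : S × β → ℝ} (hH : Measurable H) (hH0 : ∀ z, 0 ≤ H z) {L : ℝ} (hHL : ∀ z, H z ≤ L) :
    ∫ ω, H (U ω, R ω) * η ω ∂P ≤ c * ∫ ω, H (U ω, R ω) ∂P := by
  have hHb : ∀ u (r : β), |H (u, r)| ≤ L := fun u r => by
    rw [abs_of_nonneg (hH0 _)]
    exact hHL _
  have hind1 : (fun ω => (U ω, (1 : ℝ))) ⟂ᵢ[P] R :=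
    hind.comp (φ := fun z => (z.1, (1 : ℝ))) (measurable_fst.prodMk measurable_const) measurable_id
  obtain ⟨e1, i1⟩ := integral_mul_of_indep hU hη hR hind hηi hH (b := fun _ => L) measurable_const
    (integrable_const _) hHb
  obtain ⟨e2, i2⟩ := integral_mul_of_indep hU measurable_const hR hind1 (integrable_const _) hH
    (b := fun _ => L) measurable_const (integrable_const _) hHb
  simp only [mul_one] at e2 i2
  rw [e1, e2, ← integral_const_mul]
  refine integral_mono i1 (i2.const_mul c) fun ω => ?_
  have hHr : Measurable fun u => H (u, R ω) := hH.comp measurable_prodMk_right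
  have hHi : Integrable (fun ω' => H (U ω', R ω)) P :=
    Integrable.of_bound (hHr.comp hU).aestronglyMeasurable (C := L) (ae_of_all _ fun ω' => hHb _ _)
  change ∫ ω', H (U ω', R ω) * η ω' ∂P ≤ c * ∫ ω', H (U ω', R ω) ∂P
  rw [integral_comp_mul_eq_condExp hU hηi (h := fun u => H (u, R ω)) hHr fun u => hHb u _,
    ← integral_const_mul]
  refine integral_mono_ae ?_ (hHi.const_mul c) ?_
  · exact integrable_condExp.bdd_mul (hHr.comp hU).aestronglyMeasurable
      (ae_of_all _ fun ω' => hHb _ _)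
  · filter_upwards [hcond] with ω' hω'
    change _ ≤ c * H (U ω', R ω)
    rw [mul_comm c]
    exact mul_le_mul_of_nonneg_left hω' (hH0 _)

/-- Replaces the `i`-th entry of a sample and fills up with a default value. -/
def insertSample [Inhabited S] (T : Finset ℕ) (i : ℕ) (u : S) (r : T → S × ℝ) : ℕ → S :=
  fun k => if k = i then u else if h : k ∈ T then (r ⟨k, h⟩).1 else default

theorem measurable_insertSample [Inhabited S] (T : Finset ℕ) (i : ℕ) :
    Measurable fun z : S × (T → S × ℝ) => insertSample T i z.1 z.2 := by
  refine measurable_pi_lambda _ fun k => ?_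
  unfold insertSample
  split_ifs
  · exact measurable_fst
  · exact measurable_fst.comp ((measurable_pi_apply _).comp measurable_snd)
  · exact measurable_const

/-- The second moment of a sum of conditionally centered errors with coefficients which depend on
the design: the mixed terms vanish, since the error of one observation is centered given its design
point and all other observations. -/
theorem noise_second_moment [Inhabited S] {X : ℕ → Ω → S} {Y : ℕ → Ω → ℝ} {g : S → ℝ} {σ : ℝ}
    (hX : ∀ j, Measurable (X j)) (hY : ∀ j, Measurable (Y j)) (hg : Measurable g)
    (hind : iIndepFun (fun j ω => (X j ω, Y j ω)) P)
    (hL2 : ∀ j, MemLp (fun ω => Y j ω - g (X j ω)) 2 P)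
    (hcent : ∀ j, P[fun ω => Y j ω - g (X j ω) | MeasurableSpace.comap (X j) inferInstance] =ᵐ[P] 0)
    (hvar : ∀ j, P[fun ω => (Y j ω - g (X j ω)) ^ 2 |
      MeasurableSpace.comap (X j) inferInstance] ≤ᵐ[P] fun _ => σ ^ 2)
    {n : ℕ} {A : ℕ → (ℕ → S) → ℝ} (hA : ∀ j, Measurable (A j)) (hA1 : ∀ j u, |A j u| ≤ 1)
    (hAn : ∀ j u u', (∀ k < n, u k = u' k) → A j u = A j u') :
    Integrable (fun ω => (∑ j ∈ Finset.range n,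
      A j (fun k => X k ω) * (Y j ω - g (X j ω))) ^ 2) P ∧
    ∫ ω, (∑ j ∈ Finset.range n, A j (fun k => X k ω) * (Y j ω - g (X j ω))) ^ 2 ∂P ≤
      σ ^ 2 * ∫ ω, ∑ j ∈ Finset.range n, A j (fun k => X k ω) ^ 2 ∂P := by
  set e : ℕ → Ω → ℝ := fun j ω => Y j ω - g (X j ω) with he
  set a : ℕ → Ω → ℝ := fun j ω => A j fun k => X k ω with ha
  have hem : ∀ j, Measurable (e j) := fun j => (hY j).sub (hg.comp (hX j))
  have ham : ∀ j, Measurable (a j) := fun j => (hA j).comp (measurable_pi_lambda _ hX)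
  have hei : ∀ j, Integrable (e j) P := fun j => (hL2 j).integrable one_le_two
  have hee : ∀ i j, Integrable (fun ω => e i ω * e j ω) P := fun i j =>
    (hL2 i).integrable_mul (hL2 j)
  have haa : ∀ i j ω, |a i ω * a j ω| ≤ 1 := fun i j ω => by
    rw [abs_mul]
    exact mul_le_one₀ (hA1 i _) (abs_nonneg _) (hA1 j _)
  have hint : ∀ i j, Integrable (fun ω => a i ω * a j ω * (e i ω * e j ω)) P := fun i j =>
    (hee i j).bdd_mul ((ham i).mul (ham j)).aestronglyMeasurable (ae_of_all _ (haa i j))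
  have hexp : ∀ ω, (∑ j ∈ Finset.range n, a j ω * e j ω) ^ 2 =
      ∑ i ∈ Finset.range n, ∑ j ∈ Finset.range n, a i ω * a j ω * (e i ω * e j ω) := by
    intro ω
    rw [pow_two, Finset.sum_mul_sum]
    exact Finset.sum_congr rfl fun i _ => Finset.sum_congr rfl fun j _ => by ring
  have hpair : ∀ i : ℕ, (fun ω => (X i ω, e i ω)) ⟂ᵢ[P]
      fun ω (k : (Finset.range n).erase i) => (X k ω, Y k ω) := by
    intro i
    have h := hind.indepFun_finset {i} ((Finset.range n).erase i)
      (Finset.disjoint_singleton_left.2 (Finset.notMem_erase i _)) fun j => (hX j).prodMk (hY j)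
    have hm : Measurable fun z : ({i} : Finset ℕ) → S × ℝ =>
        ((z ⟨i, Finset.mem_singleton_self i⟩).1,
          (z ⟨i, Finset.mem_singleton_self i⟩).2 - g (z ⟨i, Finset.mem_singleton_self i⟩).1) := by
      fun_prop
    exact h.comp hm measurable_id
  have hRm : ∀ i, Measurable fun ω (k : (Finset.range n).erase i) => (X k ω, Y k ω) := fun i =>
    measurable_pi_lambda _ fun k => (hX k).prodMk (hY k)
  have hains : ∀ i j ω, A j (insertSample ((Finset.range n).erase i) i (X i ω)
      fun k => (X k ω, Y k ω)) = a j ω := by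
    intro i j ω
    refine hAn j _ _ fun k hk => ?_
    by_cases hki : k = i
    · simp [insertSample, hki]
    · have : k ∈ (Finset.range n).erase i := Finset.mem_erase.2 ⟨hki, Finset.mem_range.2 hk⟩
      simp [insertSample, hki, hk]
  have hoff : ∀ i ∈ Finset.range n, ∀ j ∈ Finset.range n, j ≠ i →
      ∫ ω, a i ω * a j ω * (e i ω * e j ω) ∂P = 0 := by
    intro i _ j hj hji
    have hjT : j ∈ (Finset.range n).erase i := Finset.mem_erase.2 ⟨hji, hj⟩
    set H : S × ((Finset.range n).erase i → S × ℝ) → ℝ := fun z =>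
      A i (insertSample _ i z.1 z.2) * A j (insertSample _ i z.1 z.2) *
        ((z.2 ⟨j, hjT⟩).2 - g (z.2 ⟨j, hjT⟩).1) with hH
    have hins := measurable_insertSample (S := S) ((Finset.range n).erase i) i
    have hbm : Measurable fun r : (Finset.range n).erase i → S × ℝ =>
        (r ⟨j, hjT⟩).2 - g (r ⟨j, hjT⟩).1 := by fun_prop
    have hHm : Measurable H :=
      (((hA i).comp hins).mul ((hA j).comp hins)).mul (hbm.comp measurable_snd)
    have h0 := integral_mul_eq_zero_of_indep (hX i) (hem i) (hRm i)
      (hpair i) (hei i) (hcent i) hHm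
      (b := fun r => |(r ⟨j, hjT⟩).2 - g (r ⟨j, hjT⟩).1|) hbm.abs (hei j).abs fun u r => by
        rw [hH, abs_mul, abs_mul]
        exact mul_le_of_le_one_left (abs_nonneg _)
          (mul_le_one₀ (hA1 i _) (abs_nonneg _) (hA1 j _))
    rw [← h0]
    refine integral_congr_ae (ae_of_all _ fun ω => ?_)
    simp only [hH, hains, he]
    ring
  have hdiag : ∀ i, ∫ ω, a i ω * a i ω * (e i ω * e i ω) ∂P ≤
      σ ^ 2 * ∫ ω, a i ω ^ 2 ∂P := by
    intro i
    have hins := measurable_insertSample (S := S) ((Finset.range n).erase i) i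
    have hind2 : (fun ω => (X i ω, e i ω ^ 2)) ⟂ᵢ[P]
        fun ω (k : (Finset.range n).erase i) => (X k ω, Y k ω) :=
      (hpair i).comp (φ := fun z => (z.1, z.2 ^ 2))
        (measurable_fst.prodMk (measurable_snd.pow_const 2)) measurable_id
    have h0 := integral_mul_le_of_indep (hX i) ((hem i).pow_const 2) (hRm i) hind2
      (hL2 i).integrable_sq (hvar i)
      (H := fun z => A i (insertSample ((Finset.range n).erase i) i z.1 z.2) ^ 2)
      (((hA i).comp hins).pow_const 2) (fun z => sq_nonneg _) (L := 1)
      fun z => (sq_le_one_iff_abs_le_one _).2 (hA1 i _)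
    simp only [hains] at h0
    refine le_trans (le_of_eq (integral_congr_ae (ae_of_all _ fun ω => ?_))) h0
    change a i ω * a i ω * (e i ω * e i ω) = a i ω ^ 2 * e i ω ^ 2
    ring
  have haint : ∀ i, Integrable (fun ω => a i ω ^ 2) P := fun i =>
    Integrable.of_bound ((ham i).pow_const 2).aestronglyMeasurable (C := 1) (ae_of_all _ fun ω => by
      rw [Real.norm_eq_abs, pow_two]
      exact haa i i ω)
  change Integrable (fun ω => (∑ j ∈ Finset.range n, a j ω * e j ω) ^ 2) P ∧
    ∫ ω, (∑ j ∈ Finset.range n, a j ω * e j ω) ^ 2 ∂P ≤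
      σ ^ 2 * ∫ ω, ∑ j ∈ Finset.range n, a j ω ^ 2 ∂P
  simp only [hexp]
  refine ⟨integrable_finsetSum _ fun i _ => integrable_finsetSum _ fun j _ => hint i j, ?_⟩
  rw [integral_finsetSum _ fun i _ => integrable_finsetSum _ fun j _ => hint i j,
    integral_finsetSum _ fun i _ => haint i, Finset.mul_sum]
  refine Finset.sum_le_sum fun i hi => ?_
  rw [integral_finsetSum _ fun j _ => hint i j,
    Finset.sum_eq_single i (fun j hj hji => hoff i hi j hj hji) fun h => absurd hi h]
  exact hdiag i

end Noise

/-! ### Truncation of the coordinates -/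

section Truncation

/-- Second countability makes measurable `L2`-valued functions strongly measurable. -/
instance instSecondCountableTopologyL2 : SecondCountableTopology L2 := by
  have : Fact ((2 : ℝ≥0∞) ≠ ∞) := ⟨ENNReal.ofNat_ne_top⟩
  exact inferInstance

/-- The orthogonal projection onto the span of the first `J` basis functions. -/
noncomputable def truncate (φ : HilbertBasis ℕ ℝ L2) (J : ℕ) (u : L2) : L2 :=
  ∑ l : Fin J, coords φ J u l • φ (l : ℕ)

theorem inner_truncate (φ : HilbertBasis ℕ ℝ L2) (J : ℕ) (u : L2) (j : ℕ) :
    inner ℝ (φ j) (truncate φ J u) = if j < J then inner ℝ (φ j) u else 0 := by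
  rw [truncate, inner_sum]
  simp only [inner_smul_right, orthonormal_iff_ite.1 φ.orthonormal, coords]
  split_ifs with h
  · rw [Finset.sum_eq_single (⟨j, h⟩ : Fin J)]
    · simp [real_inner_comm]
    · intro l _ hl
      rw [if_neg, mul_zero]
      intro hjl
      exact hl (Fin.ext hjl.symm)
    · simp
  · refine Finset.sum_eq_zero fun l _ => ?_
    rw [if_neg, mul_zero]
    intro hjl
    exact h (hjl ▸ l.2)

theorem hasSum_inner_sq (φ : HilbertBasis ℕ ℝ L2) (u : L2) :
    HasSum (fun j => inner ℝ (φ j) u ^ 2) (‖u‖ ^ 2) := by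
  have h := φ.hasSum_inner_mul_inner u u
  rw [real_inner_self_eq_norm_sq] at h
  convert! h using 2 with j
  rw [real_inner_comm u (φ j), pow_two]

theorem sum_coords_sq_le (φ : HilbertBasis ℕ ℝ L2) (J : ℕ) (u : L2) :
    ∑ l, coords φ J u l ^ 2 ≤ ‖u‖ ^ 2 := by
  have h := (hasSum_inner_sq φ u).summable.sum_le_tsum (Finset.range J) fun j _ => sq_nonneg _
  rw [(hasSum_inner_sq φ u).tsum_eq, Finset.sum_range] at h
  refine le_trans (le_of_eq (Finset.sum_congr rfl fun l _ => ?_)) h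
  rw [coords, real_inner_comm]

theorem norm_truncate_le (φ : HilbertBasis ℕ ℝ L2) (J : ℕ) (u : L2) : ‖truncate φ J u‖ ≤ ‖u‖ := by
  refine le_of_sq_le_sq ?_ (norm_nonneg u)
  refine hasSum_le (fun j => ?_) (hasSum_inner_sq φ _) (hasSum_inner_sq φ u)
  rw [inner_truncate]
  split_ifs
  · exact le_rfl
  · rw [zero_pow two_ne_zero]
    exact sq_nonneg _

/-- The truncation error, weighted with the exponential of `C₁ J^γ`, is dominated by the sum which
appears in the covariance condition. -/
theorem exp_mul_norm_sub_truncate_sq_le (φ : HilbertBasis ℕ ℝ L2) (J : ℕ) (u : L2) {C₁ γ : ℝ}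
    (hC₁ : 0 < C₁) (hγ : 0 < γ) :
    ENNReal.ofReal (Real.exp (C₁ * (J : ℝ) ^ γ) * ‖u - truncate φ J u‖ ^ 2) ≤
      ∑' j : ℕ, ENNReal.ofReal (Real.exp (C₁ * ((j + 1 : ℕ) : ℝ) ^ γ) * inner ℝ (φ j) u ^ 2) := by
  have h := (hasSum_inner_sq φ (u - truncate φ J u)).mul_left (Real.exp (C₁ * (J : ℝ) ^ γ))
  rw [← h.tsum_eq, ENNReal.ofReal_tsum_of_nonneg (fun j => by positivity) h.summable]
  refine ENNReal.tsum_le_tsum fun j => ENNReal.ofReal_le_ofReal ?_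
  rw [inner_sub_right, inner_truncate]
  split_ifs with hj
  · rw [sub_self, zero_pow two_ne_zero, mul_zero]
    positivity
  · rw [sub_zero]
    have : (J : ℝ) ≤ ((j + 1 : ℕ) : ℝ) := by
      exact_mod_cast (not_lt.1 hj).trans (Nat.le_succ j)
    gcongr

variable {Ω : Type*} [MeasurableSpace Ω] {P : Measure Ω} [IsProbabilityMeasure P] {Z : Ω → L2}
  {x : L2} {δ : ℝ} {φ : HilbertBasis ℕ ℝ L2}

theorem ae_cond_mem_ball {P : Measure Ω} (hZ : Measurable Z) :
    ∀ᵐ ω ∂(P[|Z ⁻¹' Metric.ball x δ]), ‖Z ω - x‖ < δ := by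
  filter_upwards [ae_cond_mem (hZ Metric.isOpen_ball.measurableSet)] with ω hω
  simpa [dist_eq_norm] using hω

theorem inner_localCov {P : Measure Ω} (hZ : Measurable Z) (v : L2) :
    inner ℝ v (localCov P Z x δ v) = ∫ ω, inner ℝ v (Z ω - x) ^ 2 ∂(P[|Z ⁻¹' Metric.ball x δ]) ∧
      Integrable (fun ω => inner ℝ v (Z ω - x) ^ 2) (P[|Z ⁻¹' Metric.ball x δ]) := by
  set Q := P[|Z ⁻¹' Metric.ball x δ] with hQ
  have hcont : Continuous fun u : L2 => InnerProductSpace.rankOne ℝ (u - x) (u - x) := by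
    have h : Continuous fun u : L2 => u - x := continuous_id.sub continuous_const
    exact ((InnerProductSpace.rankOne ℝ).continuous.comp h).clm_apply h
  have hint : Integrable (fun ω => InnerProductSpace.rankOne ℝ (Z ω - x) (Z ω - x)) Q := by
    refine Integrable.of_bound (C := δ * δ)
      (hcont.comp_stronglyMeasurable hZ.stronglyMeasurable).aestronglyMeasurable ?_
    filter_upwards [ae_cond_mem_ball (P := P) (x := x) (δ := δ) hZ] with ω hω
    rw [InnerProductSpace.norm_rankOne]
    exact mul_le_mul hω.le hω.le (norm_nonneg _) ((norm_nonneg _).trans hω.le)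
  have hint2 : Integrable (fun ω => (InnerProductSpace.rankOne ℝ (Z ω - x) (Z ω - x)) v) Q :=
    hint.apply_continuousLinearMap v
  have e : ∀ ω, inner ℝ v ((InnerProductSpace.rankOne ℝ (Z ω - x) (Z ω - x)) v) =
      inner ℝ v (Z ω - x) ^ 2 := fun ω => by
    rw [InnerProductSpace.rankOne_apply, inner_smul_right, real_inner_comm, pow_two]
  constructor
  · rw [localCov, ContinuousLinearMap.integral_apply hint, ← integral_inner hint2]
    simp only [e]
  · have := hint2.const_inner (𝕜 := ℝ) v
    simpa only [e] using this

/-- The mean squared truncation error in the neighbourhood. -/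
theorem integral_truncation_error_le (hZ : Measurable Z) {C₁ C₂ γ : ℝ} (hC₁ : 0 < C₁) (hC₂ : 0 ≤ C₂)
    (hγ : 0 < γ) (hcov : CovDecay P Z x δ φ C₁ C₂ γ) (J : ℕ) :
    ∫ ω, nbhdInd x δ (Z ω) * ‖Z ω - x - truncate φ J (Z ω - x)‖ ^ 2 ∂P ≤
      C₂ * Real.exp (-(C₁ * (J : ℝ) ^ γ)) := by
  set Q := P[|Z ⁻¹' Metric.ball x δ] with hQ
  set E := Real.exp (C₁ * (J : ℝ) ^ γ) with hE
  have hE0 : 0 < E := Real.exp_pos _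
  have hball : MeasurableSet (Z ⁻¹' Metric.ball x δ) := hZ Metric.isOpen_ball.measurableSet
  have hwm : Measurable fun ω => ‖Z ω - x - truncate φ J (Z ω - x)‖ ^ 2 := by
    have : Continuous fun u : L2 => ‖u - x - truncate φ J (u - x)‖ ^ 2 := by
      unfold truncate
      simp only [coords]
      fun_prop
    exact this.measurable.comp hZ
  have hmain : ∫⁻ ω, ENNReal.ofReal (E * ‖Z ω - x - truncate φ J (Z ω - x)‖ ^ 2) ∂Q ≤
      ENNReal.ofReal C₂ := by
    calc ∫⁻ ω, ENNReal.ofReal (E * ‖Z ω - x - truncate φ J (Z ω - x)‖ ^ 2) ∂Q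
        ≤ ∫⁻ ω, ∑' j : ℕ, ENNReal.ofReal (Real.exp (C₁ * ((j + 1 : ℕ) : ℝ) ^ γ) *
            inner ℝ (φ j) (Z ω - x) ^ 2) ∂Q :=
          lintegral_mono fun ω => exp_mul_norm_sub_truncate_sq_le φ J _ hC₁ hγ
      _ = ∑' j : ℕ, ∫⁻ ω, ENNReal.ofReal (Real.exp (C₁ * ((j + 1 : ℕ) : ℝ) ^ γ) *
            inner ℝ (φ j) (Z ω - x) ^ 2) ∂Q := by
          refine lintegral_tsum fun j => Measurable.aemeasurable ?_
          have : Continuous fun u : L2 =>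
              Real.exp (C₁ * ((j + 1 : ℕ) : ℝ) ^ γ) * inner ℝ (φ j) (u - x) ^ 2 := by fun_prop
          exact (this.measurable.comp hZ).ennreal_ofReal
      _ = ∑' j : ℕ, ENNReal.ofReal (Real.exp (C₁ * ((j + 1 : ℕ) : ℝ) ^ γ) *
            inner ℝ (φ j) (localCov P Z x δ (φ j))) := by
          refine tsum_congr fun j => ?_
          obtain ⟨h1, h2⟩ := inner_localCov (P := P) (x := x) (δ := δ) hZ (φ j)
          rw [h1, ← integral_const_mul, ofReal_integral_eq_lintegral_ofReal (h2.const_mul _)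
            (ae_of_all _ fun ω => mul_nonneg (Real.exp_pos _).le (sq_nonneg _))]
      _ = ENNReal.ofReal (∑' j : ℕ, Real.exp (C₁ * ((j + 1 : ℕ) : ℝ) ^ γ) *
            inner ℝ (φ j) (localCov P Z x δ (φ j))) := by
          refine (ENNReal.ofReal_tsum_of_nonneg (fun j => mul_nonneg (Real.exp_pos _).le ?_)
            hcov.1).symm
          rw [(inner_localCov hZ _).1]
          exact integral_nonneg fun ω => sq_nonneg _
      _ ≤ ENNReal.ofReal C₂ := ENNReal.ofReal_le_ofReal hcov.2
  have hind : ∀ ω, nbhdInd x δ (Z ω) * ‖Z ω - x - truncate φ J (Z ω - x)‖ ^ 2 =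
      (Z ⁻¹' Metric.ball x δ).indicator
        (fun ω => ‖Z ω - x - truncate φ J (Z ω - x)‖ ^ 2) ω := fun ω => by
    by_cases h : Z ω ∈ Metric.ball x δ <;> simp [nbhdInd, Set.indicator, h]
  have hPQ : P.restrict (Z ⁻¹' Metric.ball x δ) ≤ Q := by
    rw [hQ, ProbabilityTheory.cond]
    refine Measure.le_intro fun s _ _ => ?_
    rw [Measure.smul_apply, smul_eq_mul]
    exact le_mul_of_one_le_left' (ENNReal.one_le_inv.2 prob_le_one)
  simp only [hind]
  rw [integral_indicator hball, integral_eq_lintegral_of_nonneg_ae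
    (ae_of_all _ fun ω => sq_nonneg _) hwm.aestronglyMeasurable, Real.exp_neg, ← hE,
    ← div_eq_mul_inv]
  refine ENNReal.toReal_le_of_le_ofReal (div_nonneg hC₂ hE0.le) ?_
  refine (lintegral_mono' hPQ le_rfl).trans ?_
  have h2 : ENNReal.ofReal E * ∫⁻ ω, ENNReal.ofReal (‖Z ω - x - truncate φ J (Z ω - x)‖ ^ 2) ∂Q ≤
      ENNReal.ofReal E * ENNReal.ofReal (C₂ / E) := by
    rw [← lintegral_const_mul _ hwm.ennreal_ofReal, ← ENNReal.ofReal_mul hE0.le,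
      mul_div_cancel₀ _ hE0.ne']
    simpa only [ENNReal.ofReal_mul hE0.le] using hmain
  exact (ENNReal.mul_le_mul_iff_right (by simpa using hE0) ENNReal.ofReal_ne_top).1 h2

end Truncation

/-! ### Taylor expansion along a segment -/

section Taylor

variable {E : Type*} [NormedAddCommGroup E] [NormedSpace ℝ E] {g : E → ℝ} {x z : E} {δ : ℝ}

theorem hasDerivAt_iteratedFDeriv_segment (hg : ContDiffOn ℝ ((⊤ : ℕ∞) : WithTop ℕ∞) g
    (Metric.ball x δ)) (m : ℕ) {t : ℝ} (ht : x + t • z ∈ Metric.ball x δ) :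
    HasDerivAt (fun s : ℝ => iteratedFDeriv ℝ m g (x + s • z) fun _ => z)
      (iteratedFDeriv ℝ (m + 1) g (x + t • z) fun _ => z) t := by
  have hga : ContDiffAt ℝ ((⊤ : ℕ∞) : WithTop ℕ∞) g (x + t • z) :=
    hg.contDiffAt (Metric.isOpen_ball.mem_nhds ht)
  have hd : DifferentiableAt ℝ (iteratedFDeriv ℝ m g) (x + t • z) :=
    hga.differentiableAt_iteratedFDeriv (by exact_mod_cast ENat.natCast_lt_top m)
  have hline : HasDerivAt (fun s : ℝ => x + s • z) z t := by
    simpa using ((hasDerivAt_id t).smul_const z).const_add x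
  have h1 := hd.hasFDerivAt.comp_hasDerivAt t hline
  have h2 := (ContinuousMultilinearMap.apply ℝ (fun _ : Fin m => E) ℝ
    (fun _ => z)).hasFDerivAt.comp_hasDerivAt t h1
  rw [iteratedFDeriv_succ_apply_left]
  exact h2

theorem segment_mem_ball (hz : ‖z‖ < δ) {t : ℝ} (ht : t ∈ Set.Icc (0 : ℝ) 1) :
    x + t • z ∈ Metric.ball x δ := by
  rw [Metric.mem_ball, dist_eq_norm, add_sub_cancel_left, norm_smul, Real.norm_eq_abs,
    abs_of_nonneg ht.1]
  exact (mul_le_of_le_one_left (norm_nonneg z) ht.2).trans_lt hz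

theorem iteratedDerivWithin_segment (hg : ContDiffOn ℝ ((⊤ : ℕ∞) : WithTop ℕ∞) g
    (Metric.ball x δ)) (hz : ‖z‖ < δ) (m : ℕ) {t : ℝ} (ht : t ∈ Set.Icc (0 : ℝ) 1) :
    iteratedDerivWithin m (fun s : ℝ => g (x + s • z)) (Set.Icc 0 1) t =
      iteratedFDeriv ℝ m g (x + t • z) fun _ => z := by
  induction m generalizing t with
  | zero => simp
  | succ m ih =>
    have hu : UniqueDiffOn ℝ (Set.Icc (0 : ℝ) 1) := uniqueDiffOn_Icc zero_lt_one
    rw [iteratedDerivWithin_succ, derivWithin_congr (fun s hs => ih hs) (ih ht)]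
    exact (hasDerivAt_iteratedFDeriv_segment hg m
      (segment_mem_ball hz ht)).hasDerivWithinAt.derivWithin
      (hu t ht)

/-- Taylor's theorem with a bound on the remainder for a function with bounded derivatives. -/
theorem abs_sub_taylor_le (hg : ContDiffOn ℝ ((⊤ : ℕ∞) : WithTop ℕ∞) g (Metric.ball x δ)) {C : ℝ}
    (hgC : ∀ k : ℕ, ∀ y ∈ Metric.ball x δ, ‖iteratedFDeriv ℝ k g y‖ ≤ C) (hδ : δ ≤ 1)
    (hz : ‖z‖ < δ) {K : ℕ} (hK : 0 < K) :
    |g (x + z) - ∑ m ∈ Finset.range K, (m.factorial : ℝ)⁻¹ * iteratedFDeriv ℝ m g x fun _ => z| ≤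
      C / (K - 1).factorial := by
  obtain ⟨k, rfl⟩ := Nat.exists_eq_succ_of_ne_zero hK.ne'
  have hmaps : Set.MapsTo (fun s : ℝ => x + s • z) (Set.Icc 0 1) (Metric.ball x δ) :=
    fun t ht => segment_mem_ball hz ht
  have hline : ContDiffOn ℝ ((⊤ : ℕ∞) : WithTop ℕ∞) (fun s : ℝ => x + s • z) (Set.Icc 0 1) := by
    fun_prop
  have hcd : ContDiffOn ℝ ((k : ℕ∞) + 1 : WithTop ℕ∞) (fun s : ℝ => g (x + s • z))
      (Set.Icc 0 1) := (hg.comp hline hmaps).of_le (by exact_mod_cast le_top)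
  have h := taylor_mean_remainder_bound (C := C) (n := k) zero_le_one hcd
    (Set.right_mem_Icc.2 zero_le_one) fun y hy => by
      rw [iteratedDerivWithin_segment hg hz _ hy]
      refine (ContinuousMultilinearMap.le_opNorm _ _).trans ?_
      rw [Finset.prod_const]
      refine (mul_le_of_le_one_right (norm_nonneg _)
        (pow_le_one₀ (norm_nonneg z) (hz.le.trans hδ))).trans (hgC _ _ (segment_mem_ball hz hy))
  rw [taylor_within_apply] at h
  simp only [sub_zero, one_pow, mul_one, one_smul, Real.norm_eq_abs, smul_eq_mul] at h
  refine le_trans (le_of_eq ?_) h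
  congr 2
  refine Finset.sum_congr rfl fun m _ => ?_
  rw [iteratedDerivWithin_segment hg hz _ (Set.left_mem_Icc.2 zero_le_one)]
  simp

end Taylor

/-! ### The coefficients of the Taylor polynomial and the ridge penalty -/

section Coefficients

/-- The multi-index which counts how often each coordinate occurs in the tuple `l`. -/
def countIndex {J m : ℕ} (l : Fin m → Fin J) : Fin J → ℕ :=
  fun i => (Finset.univ.filter fun a => l a = i).card

theorem sum_countIndex {J m : ℕ} (l : Fin m → Fin J) : ∑ i, countIndex l i = m := by
  have h := Finset.card_eq_sum_card_fiberwise (f := l) (s := Finset.univ) (t := Finset.univ)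
    fun _ _ => Finset.mem_coe.2 (Finset.mem_univ _)
  rw [Finset.card_univ, Fintype.card_fin] at h
  exact h.symm

theorem prod_pow_countIndex {R : Type*} [CommMonoid R] {J m : ℕ} (l : Fin m → Fin J)
    (c : Fin J → R) : ∏ i, c i ^ countIndex l i = ∏ a, c (l a) := by
  rw [Finset.prod_comp c l]
  symm
  refine Finset.prod_subset (Finset.subset_univ _) fun i _ hi => ?_
  rw [Finset.card_eq_zero.2, pow_zero]
  refine Finset.filter_eq_empty_iff.2 fun a _ ha => hi ?_
  exact Finset.mem_image.2 ⟨a, Finset.mem_univ a, ha⟩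

/-- The number of tuples with given counts is the multinomial coefficient. -/
theorem card_filter_countIndex {J m : ℕ} (k : Fin J → ℕ) (hk : ∑ i, k i = m) :
    (Finset.univ.filter fun l : Fin m → Fin J => countIndex l = k).card =
      Nat.multinomial Finset.univ k := by
  classical
  set d : Fin J →₀ ℕ := Finsupp.equivFunOnFinite.symm k with hd
  have h := MvPolynomial.coeff_sum_X_pow_of_fintype (R := ℕ) d m
  have hsum : (d.sum fun _ m => m) = m := by
    rw [Finsupp.sum_fintype _ _ fun _ => rfl]
    exact hk
  rw [if_pos hsum] at h
  have hmult : (d.multinomial : ℕ) = Nat.multinomial Finset.univ k :=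
    Finsupp.multinomial_eq_of_support_subset (Finset.subset_univ _)
  have hexp : (∑ i, MvPolynomial.X i : MvPolynomial (Fin J) ℕ) ^ m =
      ∑ l : Fin m → Fin J,
        MvPolynomial.monomial (Finsupp.equivFunOnFinite.symm (countIndex l)) 1 := by
    rw [Fintype.sum_pow]
    refine Finset.sum_congr rfl fun l _ => ?_
    rw [← prod_pow_countIndex l fun i => (MvPolynomial.X i : MvPolynomial (Fin J) ℕ),
      MvPolynomial.monomial_eq, Finsupp.prod_fintype _ _ fun _ => pow_zero _]
    simp
  rw [hexp, MvPolynomial.coeff_sum] at h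
  simp only [MvPolynomial.coeff_monomial, hd, EmbeddingLike.apply_eq_iff_eq] at h
  rw [← hmult, ← Nat.cast_id (Finsupp.multinomial _), ← h, Finset.card_filter]

theorem sum_multiIndices {J K : ℕ} (F : (Fin J → ℕ) → ℝ) :
    ∑ k : multiIndices J K, F k.1 =
      ∑ m ∈ Finset.range K, ∑ k ∈ Finset.piAntidiag Finset.univ m, F k := by
  rw [Finset.sum_coe_sort (multiIndices J K) F,
    ← Finset.sum_fiberwise_of_maps_to (g := fun k : Fin J → ℕ => ∑ l, k l) (t := Finset.range K)
      fun k hk => Finset.mem_range.2 (mem_multiIndices.1 hk)]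
  refine Finset.sum_congr rfl fun m hm => Finset.sum_congr ?_ fun _ _ => rfl
  ext k
  simp only [Finset.mem_filter, mem_multiIndices, Finset.mem_piAntidiag, Finset.mem_univ,
    implies_true, and_true, and_iff_right_iff_imp]
  intro h
  rw [h]
  exact Finset.mem_range.1 hm

/-- The multinomial theorem, summed over all degrees less than `K`. -/
theorem sum_multinomial_mul_prod {J K : ℕ} (c : Fin J → ℝ) :
    ∑ k : multiIndices J K, (Nat.multinomial Finset.univ k.1 : ℝ) * ∏ l, c l ^ k.1 l =
      ∑ m ∈ Finset.range K, (∑ l, c l) ^ m := by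
  rw [sum_multiIndices fun k => (Nat.multinomial Finset.univ k : ℝ) * ∏ l, c l ^ k l]
  exact Finset.sum_congr rfl fun m _ => (Finset.sum_pow_eq_sum_piAntidiag _ _ _).symm

/-- The leverage of a design point in the neighbourhood with respect to the ridge matrix. -/
theorem sum_monomial_sq_mul_multinomial_le (φ : HilbertBasis ℕ ℝ L2) {x u : L2} {δ : ℝ}
    (hδ0 : 0 ≤ δ) (hδ : δ < 1) (hu : ‖u - x‖ < δ) (J K : ℕ) :
    ∑ k : multiIndices J K, monomial φ x k.1 u ^ 2 * (Nat.multinomial Finset.univ k.1 : ℝ) ≤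
      (1 - δ ^ 2)⁻¹ := by
  have e : ∀ k : multiIndices J K,
      monomial φ x k.1 u ^ 2 * (Nat.multinomial Finset.univ k.1 : ℝ) =
        (Nat.multinomial Finset.univ k.1 : ℝ) * ∏ l, (coords φ J (u - x) l ^ 2) ^ k.1 l :=
      fun k => by
    rw [mul_comm, monomial, ← Finset.prod_pow]
    congr 1
    exact Finset.prod_congr rfl fun l _ => by rw [← pow_mul, ← pow_mul, mul_comm]
  simp only [e]
  rw [sum_multinomial_mul_prod]
  have hs : ∑ l, coords φ J (u - x) l ^ 2 ≤ δ ^ 2 :=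
    (sum_coords_sq_le φ J _).trans (pow_le_pow_left₀ (norm_nonneg _) hu.le 2)
  have hs0 : 0 ≤ ∑ l, coords φ J (u - x) l ^ 2 := Finset.sum_nonneg fun l _ => sq_nonneg _
  have hδ2 : δ ^ 2 < 1 := pow_lt_one₀ hδ0 hδ two_ne_zero
  calc ∑ m ∈ Finset.range K, (∑ l, coords φ J (u - x) l ^ 2) ^ m
      ≤ ∑ m ∈ Finset.range K, (δ ^ 2) ^ m :=
        Finset.sum_le_sum fun m _ => pow_le_pow_left₀ hs0 hs m
    _ ≤ ∑' m : ℕ, (δ ^ 2) ^ m := (summable_geometric_of_lt_one (sq_nonneg δ) hδ2).sum_le_tsum _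
        fun m _ => pow_nonneg (sq_nonneg δ) m
    _ = (1 - δ ^ 2)⁻¹ := tsum_geometric_of_lt_one (sq_nonneg δ) hδ2

/-- The coefficients of the Taylor polynomial of `g` in the first `J` coordinates. The derivative of
order `m` is evaluated at all `m`-tuples of basis functions, and the tuples are grouped by the
multi-index which they represent. -/
noncomputable def taylorCoeff (g : L2 → ℝ) (x : L2) (φ : HilbertBasis ℕ ℝ L2) (J K : ℕ) :
    multiIndices J K → ℝ :=
  fun k => ∑ m ∈ Finset.range K, (m.factorial : ℝ)⁻¹ *
    ∑ l : Fin m → Fin J with countIndex l = k.1, iteratedFDeriv ℝ m g x fun a => φ (l a : ℕ)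

theorem monomials_dotProduct_taylorCoeff (g : L2 → ℝ) (x u : L2) (φ : HilbertBasis ℕ ℝ L2)
    (J K : ℕ) : monomials φ x J K u ⬝ᵥ taylorCoeff g x φ J K =
      ∑ m ∈ Finset.range K, (m.factorial : ℝ)⁻¹ *
        iteratedFDeriv ℝ m g x fun _ => truncate φ J (u - x) := by
  simp only [dotProduct, taylorCoeff, Finset.mul_sum]
  rw [Finset.sum_comm]
  refine Finset.sum_congr rfl fun m hm => ?_
  have hml : (iteratedFDeriv ℝ m g x fun _ => truncate φ J (u - x)) =
      ∑ l : Fin m → Fin J, (∏ a, coords φ J (u - x) (l a)) *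
        iteratedFDeriv ℝ m g x fun a => φ (l a : ℕ) := by
    unfold truncate
    rw [ContinuousMultilinearMap.map_sum]
    refine Finset.sum_congr rfl fun l _ => ?_
    rw [ContinuousMultilinearMap.map_smul_univ, smul_eq_mul]
  have hmem : ∀ l : Fin m → Fin J, countIndex l ∈ multiIndices J K := fun l =>
    mem_multiIndices.2 (by rw [sum_countIndex]; exact Finset.mem_range.1 hm)
  rw [hml, Finset.mul_sum, ← Finset.sum_fiberwise_of_maps_to
    (g := fun l : Fin m → Fin J => (⟨countIndex l, hmem l⟩ : multiIndices J K))
    (t := Finset.univ) fun _ _ => Finset.mem_univ _]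
  refine Finset.sum_congr rfl fun k _ => ?_
  have hfil : (Finset.univ.filter fun l : Fin m → Fin J =>
      (⟨countIndex l, hmem l⟩ : multiIndices J K) = k) =
      Finset.univ.filter fun l : Fin m → Fin J => countIndex l = k.1 := by
    ext l
    simp [Subtype.ext_iff]
  rw [hfil]
  refine Finset.sum_congr rfl fun l hl => ?_
  rw [← (Finset.mem_filter.1 hl).2 |> fun h => prod_pow_countIndex l (coords φ J (u - x)),
    (Finset.mem_filter.1 hl).2, monomials, monomial]
  ring

theorem monomials_self (x : L2) (φ : HilbertBasis ℕ ℝ L2) (J K : ℕ) :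
    monomials φ x J K x = unitZero J K := by
  ext k
  have h0 : coords φ J (x - x) = 0 := by
    ext l
    simp [coords]
  rw [monomials, monomial, h0, unitZero]
  split_ifs with h
  · simp [h]
  · obtain ⟨l, hl⟩ := Function.ne_iff.1 h
    exact Finset.prod_eq_zero (Finset.mem_univ l) (zero_pow hl)

theorem unitZero_dotProduct_taylorCoeff (g : L2 → ℝ) (x : L2) (φ : HilbertBasis ℕ ℝ L2)
    (J : ℕ) {K : ℕ} (hK : 0 < K) : unitZero J K ⬝ᵥ taylorCoeff g x φ J K = g x := by
  rw [← monomials_self x φ, monomials_dotProduct_taylorCoeff]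
  have h0 : truncate φ J (x - x) = 0 := by
    simp [truncate, coords]
  rw [h0, Finset.sum_eq_single 0]
  · simp
  · intro m _ hm
    have : Nonempty (Fin m) := Fin.pos_iff_nonempty.1 (Nat.pos_of_ne_zero hm)
    rw [(iteratedFDeriv ℝ m g x).map_coord_zero (Classical.arbitrary (Fin m)) rfl, mul_zero]
  · intro h
    exact absurd (Finset.mem_range.2 hK) h

/-- The residual of the Taylor polynomial in the first `J` coordinates. -/
theorem abs_sub_monomials_dotProduct_le {g : L2 → ℝ} {x : L2} {δ C : ℝ}
    (hg : HasBoundedDerivs g x δ C) (hδ : δ ≤ 1) (φ : HilbertBasis ℕ ℝ L2) (J : ℕ)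
    {K : ℕ} (hK : 0 < K) {u : L2} (hu : ‖u - x‖ < δ) :
    |g u - monomials φ x J K u ⬝ᵥ taylorCoeff g x φ J K| ≤
      C * (‖u - x - truncate φ J (u - x)‖ + ((K - 1).factorial : ℝ)⁻¹) := by
  set z := truncate φ J (u - x) with hz
  have hzn : ‖z‖ < δ := (norm_truncate_le φ J _).trans_lt hu
  have h1 := abs_sub_taylor_le hg.1 hg.2 hδ hzn hK
  have hum : u ∈ Metric.ball x δ := by simpa [dist_eq_norm] using hu
  have hzm : x + z ∈ Metric.ball x δ := by simpa [dist_eq_norm] using hzn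
  have h2 : |g u - g (x + z)| ≤ C * ‖u - x - z‖ := by
    have h := (convex_ball x δ).norm_image_sub_le_of_norm_fderiv_le (𝕜 := ℝ) (f := g) (C := C)
      (fun y hy => (hg.1.contDiffAt (Metric.isOpen_ball.mem_nhds hy)).differentiableAt
        (by simp)) (fun y hy => by
          rw [← norm_iteratedFDeriv_one]
          exact hg.2 1 y hy) hzm hum
    rwa [Real.norm_eq_abs, ← sub_sub] at h
  rw [monomials_dotProduct_taylorCoeff]
  have h3 := abs_sub_le (g u) (g (x + z)) (∑ m ∈ Finset.range K, (m.factorial : ℝ)⁻¹ *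
        iteratedFDeriv ℝ m g x fun _ => z)
  rw [mul_add, ← div_eq_mul_inv]
  linarith

/-- The ridge penalty of the Taylor coefficients. -/
theorem sum_taylorCoeff_sq_div_multinomial_le {g : L2 → ℝ} {x : L2} {δ C : ℝ}
    (hg : HasBoundedDerivs g x δ C) (hδ : 0 < δ) (φ : HilbertBasis ℕ ℝ L2) (J K : ℕ) :
    ∑ k : multiIndices J K, ((Nat.multinomial Finset.univ k.1 : ℕ) : ℝ)⁻¹ *
      taylorCoeff g x φ J K k ^ 2 ≤ C ^ 2 * Real.exp (2 * √J) := by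
  have hC : 0 ≤ C := (norm_nonneg _).trans (hg.2 0 x (Metric.mem_ball_self hδ))
  have hcoef : ∀ k : multiIndices J K, |taylorCoeff g x φ J K k| ≤
      C * (((∑ l, k.1 l).factorial : ℝ)⁻¹ * (Nat.multinomial Finset.univ k.1 : ℝ)) := by
    intro k
    have hk := mem_multiIndices.1 k.2
    have e : taylorCoeff g x φ J K k = ((∑ l, k.1 l).factorial : ℝ)⁻¹ *
        ∑ l : Fin (∑ l, k.1 l) → Fin J with countIndex l = k.1,
          iteratedFDeriv ℝ (∑ l, k.1 l) g x fun a => φ (l a : ℕ) := by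
      rw [taylorCoeff]
      refine Finset.sum_eq_single _ (fun m _ hm => ?_) fun h => absurd (Finset.mem_range.2 hk) h
      rw [Finset.sum_eq_zero, mul_zero]
      intro l hl
      exact absurd (show m = ∑ l, k.1 l by rw [← (Finset.mem_filter.1 hl).2, sum_countIndex]) hm
    rw [e, abs_mul, abs_of_nonneg (by positivity), mul_left_comm]
    refine mul_le_mul_of_nonneg_left ?_ (by positivity)
    rw [← card_filter_countIndex k.1 rfl, mul_comm, ← nsmul_eq_mul]
    refine (Finset.abs_sum_le_sum_abs _ _).trans (Finset.sum_le_card_nsmul _ _ _ fun l _ => ?_)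
    rw [← Real.norm_eq_abs]
    refine (ContinuousMultilinearMap.le_opNorm _ _).trans ?_
    simp only [φ.orthonormal.1, Finset.prod_const_one, mul_one]
    exact hg.2 _ x (Metric.mem_ball_self hδ)
  have hterm : ∀ k : multiIndices J K, ((Nat.multinomial Finset.univ k.1 : ℕ) : ℝ)⁻¹ *
      taylorCoeff g x φ J K k ^ 2 ≤
        C ^ 2 * (((∑ l, k.1 l).factorial : ℝ)⁻¹ ^ 2 * (Nat.multinomial Finset.univ k.1 : ℝ)) := by
    intro k
    have hM : (0 : ℝ) < (Nat.multinomial Finset.univ k.1 : ℝ) := by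
      exact_mod_cast Nat.multinomial_pos _ _
    have h := pow_le_pow_left₀ (abs_nonneg _) (hcoef k) 2
    rw [sq_abs] at h
    rw [inv_mul_le_iff₀ hM]
    refine h.trans (le_of_eq ?_)
    ring
  refine (Finset.sum_le_sum fun k _ => hterm k).trans ?_
  rw [← Finset.mul_sum]
  refine mul_le_mul_of_nonneg_left ?_ (sq_nonneg C)
  rw [sum_multiIndices fun k : Fin J → ℕ =>
    ((∑ l, k l).factorial : ℝ)⁻¹ ^ 2 * (Nat.multinomial Finset.univ k : ℝ)]
  have hdeg : ∀ m : ℕ, ∑ k ∈ Finset.piAntidiag (Finset.univ : Finset (Fin J)) m,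
      ((∑ l, k l).factorial : ℝ)⁻¹ ^ 2 * (Nat.multinomial Finset.univ k : ℝ) =
        ((√J) ^ m / m.factorial) ^ 2 := by
    intro m
    have h := Finset.sum_pow_eq_sum_piAntidiag (Finset.univ : Finset (Fin J)) (fun _ => (1 : ℝ)) m
    simp only [Finset.sum_const, Finset.card_univ, Fintype.card_fin, nsmul_eq_mul, mul_one, one_pow,
      Finset.prod_const_one] at h
    rw [div_pow, ← pow_mul, mul_comm m 2, pow_mul, Real.sq_sqrt (Nat.cast_nonneg J), h,
      div_eq_inv_mul, Finset.mul_sum]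
    refine Finset.sum_congr rfl fun k hk => ?_
    rw [(Finset.mem_piAntidiag.1 hk).1, inv_pow]
  simp only [hdeg]
  -- `∑ a_m² ≤ (∑ a_m)²` for nonnegative `a_m = √J ^ m / m!`
  calc ∑ m ∈ Finset.range K, ((√J) ^ m / m.factorial) ^ 2
      ≤ (∑ m ∈ Finset.range K, (√J) ^ m / m.factorial) ^ 2 :=
        Finset.sum_sq_le_sq_sum_of_nonneg fun m _ => by positivity
    _ ≤ (Real.exp √J) ^ 2 := by
        refine pow_le_pow_left₀ (Finset.sum_nonneg fun m _ => by positivity) ?_ 2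
        exact Real.sum_le_exp_of_nonneg (Real.sqrt_nonneg _) K
    _ = Real.exp (2 * √J) := by
        rw [← Real.exp_nat_mul]
        norm_num

end Coefficients

/-! ### The error of the estimator for a fixed sample size -/

section FiniteSample

/-- The squared error of ridge regression for responses which consist of a linear part, a residual
`r` and an error `ε`: the shrinkage and the residuals are bounded by the Cauchy–Schwarz inequality,
the errors are kept as a sum. -/
theorem ridge_error_sq_le {ι α : Type*} [DecidableEq ι] [Fintype ι] {s : Finset α} {w : α → ℝ}
    {ξ : α → ι → ℝ} {d : ι → ℝ} (hw : ∀ j, 0 ≤ w j) (hd : ∀ k, 0 < d k) (e θ : ι → ℝ)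
    {Y r ε : α → ℝ} (hY : ∀ j, Y j = ξ j ⬝ᵥ θ + r j + ε j) :
    (e ⬝ᵥ Matrix.mulVec (ridgeGram s w ξ d)⁻¹ (fun k => ∑ j ∈ s, w j * ξ j k * Y j) - e ⬝ᵥ θ) ^ 2 ≤
      3 * ((ridgeWeights s w ξ d e ⬝ᵥ e) * ∑ k, d k * θ k ^ 2 +
        (ridgeWeights s w ξ d e ⬝ᵥ e) * ∑ j ∈ s, w j * r j ^ 2 +
        (∑ j ∈ s, w j * (ξ j ⬝ᵥ ridgeWeights s w ξ d e) * ε j) ^ 2) := by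
  rw [ridge_error hw hd]
  have hen := ridgeWeights_energy (s := s) (ξ := ξ) hw hd e
  set v := ridgeWeights s w ξ d e
  set D := v ⬝ᵥ e
  have e1 : ∑ j ∈ s, w j * (ξ j ⬝ᵥ v) * (Y j - ξ j ⬝ᵥ θ) =
      ∑ j ∈ s, w j * (ξ j ⬝ᵥ v) * r j + ∑ j ∈ s, w j * (ξ j ⬝ᵥ v) * ε j := by
    rw [← Finset.sum_add_distrib]
    refine Finset.sum_congr rfl fun j _ => ?_
    rw [hY j]
    ring
  have n1 : 0 ≤ ∑ j ∈ s, w j * (ξ j ⬝ᵥ v) ^ 2 :=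
    Finset.sum_nonneg fun j _ => mul_nonneg (hw j) (sq_nonneg _)
  have n2 : 0 ≤ ∑ k, d k * v k ^ 2 :=
    Finset.sum_nonneg fun k _ => mul_nonneg (hd k).le (sq_nonneg _)
  have n3 : 0 ≤ ∑ j ∈ s, w j * r j ^ 2 :=
    Finset.sum_nonneg fun j _ => mul_nonneg (hw j) (sq_nonneg _)
  have n4 : 0 ≤ ∑ k, d k * θ k ^ 2 :=
    Finset.sum_nonneg fun k _ => mul_nonneg (hd k).le (sq_nonneg _)
  have c1 := (sq_sum_weight_mul_le s hw (fun j => ξ j ⬝ᵥ v) r).trans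
    (mul_le_mul_of_nonneg_right (show _ ≤ D by linarith) n3)
  have c2 := (sq_sum_weight_mul_le Finset.univ (fun k => (hd k).le) v θ).trans
    (mul_le_mul_of_nonneg_right (show _ ≤ D by linarith) n4)
  rw [e1]
  set a := ∑ j ∈ s, w j * (ξ j ⬝ᵥ v) * r j
  set b := ∑ j ∈ s, w j * (ξ j ⬝ᵥ v) * ε j
  set c := ∑ k, d k * v k * θ k
  nlinarith [sq_nonneg (a - b), sq_nonneg (a + c), sq_nonneg (b + c)]

theorem measurable_det {α ι : Type*} [MeasurableSpace α] [Fintype ι] [DecidableEq ι]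
    {M : α → Matrix ι ι ℝ} (hM : ∀ i j, Measurable fun a => M a i j) :
    Measurable fun a => (M a).det := by
  simp only [Matrix.det_apply]
  exact Finset.measurable_sum _ fun τ _ =>
    (Finset.measurable_prod _ fun i _ => hM _ _).const_smul _

theorem measurable_inv_mulVec {α ι : Type*} [MeasurableSpace α] [Fintype ι] [DecidableEq ι]
    {M : α → Matrix ι ι ℝ} (hM : ∀ i j, Measurable fun a => M a i j) (v : ι → ℝ) (i : ι) :
    Measurable fun a => Matrix.mulVec (M a)⁻¹ v i := by
  simp only [Matrix.mulVec, dotProduct]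
  refine Finset.measurable_sum _ fun j _ => Measurable.mul_const ?_ _
  simp only [Matrix.inv_def, Ring.inverse_eq_inv', Matrix.smul_apply, smul_eq_mul,
    Matrix.adjugate_apply]
  refine (measurable_det hM).inv.mul (measurable_det fun k l => ?_)
  simp only [Matrix.updateRow_apply]
  split_ifs
  · exact measurable_const
  · exact hM k l

/-- The penalty weights, the diagonal entries of the ridge matrix. -/
noncomputable def penalty (J K : ℕ) : multiIndices J K → ℝ :=
  fun k => ((Nat.multinomial Finset.univ k.1 : ℕ) : ℝ)⁻¹

theorem penalty_pos {J K : ℕ} (k : multiIndices J K) : 0 < penalty J K k := by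
  have : (0 : ℝ) < (Nat.multinomial Finset.univ k.1 : ℝ) := by
    exact_mod_cast Nat.multinomial_pos _ _
  exact inv_pos.2 this

/-- The vector `(M + S)⁻¹ e₀` as a function of the design. -/
noncomputable def designWeights (φ : HilbertBasis ℕ ℝ L2) (x : L2) (δ : ℝ) (J K n : ℕ)
    (u : ℕ → L2) : multiIndices J K → ℝ :=
  ridgeWeights (Finset.range n) (fun j => nbhdInd x δ (u j)) (fun j => monomials φ x J K (u j))
    (penalty J K) (unitZero J K)

theorem measurable_designWeights (φ : HilbertBasis ℕ ℝ L2) (x : L2) (δ : ℝ) (J K n : ℕ)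
    (k : multiIndices J K) : Measurable fun u => designWeights φ x δ J K n u k := by
  refine measurable_inv_mulVec (fun i j => ?_) _ k
  simp only [ridgeGram, weightedGram, Matrix.add_apply, Matrix.of_apply]
  refine Measurable.add_const (Finset.measurable_sum _ fun l _ => ?_) _
  exact (((measurable_nbhdInd x δ).comp (measurable_pi_apply l)).mul
    ((measurable_monomial φ x i.1).comp (measurable_pi_apply l))).mul
    ((measurable_monomial φ x j.1).comp (measurable_pi_apply l))

theorem designWeights_congr (φ : HilbertBasis ℕ ℝ L2) (x : L2) (δ : ℝ) (J K : ℕ) {n : ℕ}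
    {u u' : ℕ → L2} (h : ∀ k < n, u k = u' k) :
    designWeights φ x δ J K n u = designWeights φ x δ J K n u' := by
  have : weightedGram (Finset.range n) (fun j => nbhdInd x δ (u j))
      (fun j => monomials φ x J K (u j)) = weightedGram (Finset.range n)
        (fun j => nbhdInd x δ (u' j)) (fun j => monomials φ x J K (u' j)) := by
    ext i k
    simp only [weightedGram, Matrix.of_apply]
    exact Finset.sum_congr rfl fun j hj => by rw [h j (Finset.mem_range.1 hj)]
  simp only [designWeights, ridgeWeights, ridgeGram, this]

/-- The coefficients of the errors in the estimator, set to zero unless `e₀ᵀ (M + S)⁻¹ e₀`, which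
bounds the sum of their squares, is at most `ρ`. -/
noncomputable def noiseCoeff (φ : HilbertBasis ℕ ℝ L2) (x : L2) (δ : ℝ) (J K n : ℕ) (ρ : ℝ)
    (j : ℕ) (u : ℕ → L2) : ℝ :=
  if j < n ∧ designWeights φ x δ J K n u ⬝ᵥ unitZero J K ≤ ρ then
    nbhdInd x δ (u j) * (monomials φ x J K (u j) ⬝ᵥ designWeights φ x δ J K n u) else 0

theorem measurable_noiseCoeff (φ : HilbertBasis ℕ ℝ L2) (x : L2) (δ : ℝ) (J K n : ℕ) (ρ : ℝ)
    (j : ℕ) : Measurable (noiseCoeff φ x δ J K n ρ j) := by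
  have hm := measurable_designWeights φ x δ J K n
  by_cases hj : j < n
  · unfold noiseCoeff
    simp only [hj, true_and]
    refine Measurable.ite (measurableSet_le ?_ measurable_const) ?_ measurable_const
    · exact Finset.measurable_sum _ fun k _ => (hm k).mul_const _
    · refine ((measurable_nbhdInd x δ).comp (measurable_pi_apply j)).mul ?_
      exact Finset.measurable_sum _ fun k _ =>
        ((measurable_monomial φ x k.1).comp (measurable_pi_apply j)).mul (hm k)
  · unfold noiseCoeff
    simp only [hj, false_and, if_false]
    exact measurable_const

theorem nbhdInd_sq (x : L2) (δ : ℝ) (u : L2) : nbhdInd x δ u ^ 2 = nbhdInd x δ u := by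
  by_cases hu : u ∈ Metric.ball x δ <;> simp [nbhdInd, hu]

theorem sum_noiseCoeff_sq_le (φ : HilbertBasis ℕ ℝ L2) (x : L2) (δ : ℝ) (J K n : ℕ) {ρ : ℝ}
    (hρ : 0 ≤ ρ) (u : ℕ → L2) : ∑ j ∈ Finset.range n, noiseCoeff φ x δ J K n ρ j u ^ 2 ≤ ρ := by
  by_cases h : designWeights φ x δ J K n u ⬝ᵥ unitZero J K ≤ ρ
  · refine le_trans ?_ h
    have hen := ridgeWeights_energy (s := Finset.range n) (w := fun j => nbhdInd x δ (u j))
      (ξ := fun j => monomials φ x J K (u j)) (d := penalty J K)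
      (fun j => nbhdInd_nonneg x δ _) penalty_pos (unitZero J K)
    have h0 : 0 ≤ ∑ k, penalty J K k * designWeights φ x δ J K n u k ^ 2 :=
      Finset.sum_nonneg fun k _ => mul_nonneg (penalty_pos k).le (sq_nonneg _)
    refine le_trans (le_of_eq (Finset.sum_congr rfl fun j hj => ?_))
      ((le_add_of_nonneg_right h0).trans hen.le)
    rw [noiseCoeff, if_pos ⟨Finset.mem_range.1 hj, h⟩, mul_pow, nbhdInd_sq]
    rfl
  · simp only [noiseCoeff, h, and_false, if_false]
    simpa using hρ

theorem abs_noiseCoeff_le_one (φ : HilbertBasis ℕ ℝ L2) (x : L2) (δ : ℝ) (J K n : ℕ) {ρ : ℝ}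
    (hρ0 : 0 ≤ ρ) (hρ : ρ ≤ 1) (j : ℕ) (u : ℕ → L2) : |noiseCoeff φ x δ J K n ρ j u| ≤ 1 := by
  rw [← sq_le_one_iff_abs_le_one]
  by_cases hj : j < n
  · exact (Finset.single_le_sum (f := fun j => noiseCoeff φ x δ J K n ρ j u ^ 2)
      (fun j _ => sq_nonneg _) (Finset.mem_range.2 hj)).trans
      ((sum_noiseCoeff_sq_le φ x δ J K n hρ0 u).trans hρ)
  · simp [noiseCoeff, hj]

variable {Ω : Type*} [MeasurableSpace Ω] {P : Measure Ω} [IsProbabilityMeasure P]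
  {X : ℕ → Ω → L2} {Y : ℕ → Ω → ℝ} {g : L2 → ℝ} {σ : ℝ} {x : L2} {δ : ℝ}
  {φ : HilbertBasis ℕ ℝ L2}

/-- With high probability, `e₀ᵀ (M + S)⁻¹ e₀` is at most `ρ`. -/
theorem exists_event_designWeights_le (hmod : IsRegressionModel P X Y g σ) (hδ0 : 0 < δ)
    (hδ : δ < 1)
    {c₁ c₂ p₀ : ℝ} (hc₂ : 0 < c₂) (hp₀ : 0 < p₀) (hp : p₀ ≤ P.real {ω | X 0 ω ∈ Metric.ball x δ})
    {J K n : ℕ} (hrad : RadialDensityCondition P (X 0) x δ φ c₁ c₂ J) (hK : 0 < K) (hn : 0 < n)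
    {B : ℝ} (hB : 1 ≤ B) (hcB : c₁ * J ≤ B) {s ρ : ℝ} (hs : 2 ≤ s)
    (hρ : s ≤ ρ * (n * (p₀ / c₂ / 3 * smallValueLevel K B ^ 2))) :
    ∃ E : Set Ω, P.real Eᶜ ≤ 4 * (1 - δ ^ 2)⁻¹ * (multiIndices J K).card / s ∧
      ∀ ω ∈ E, designWeights φ x δ J K n (fun j => X j ω) ⬝ᵥ unitZero J K ≤ ρ := by
  have hs0 : 0 < s := by linarith
  have hXm := hmod.measurable_X
  set μ : ℝ := p₀ / c₂ / 3 * smallValueLevel K B ^ 2 with hμ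
  have hμ0 : 0 < μ := by
    have : 0 < smallValueLevel K B := Real.exp_pos _
    positivity
  set ζ : L2 → multiIndices J K → ℝ := fun u k => nbhdInd x δ u * monomial φ x k.1 u with hζ
  have hζm : ∀ k, Measurable fun u => ζ u k := fun k =>
    (measurable_nbhdInd x δ).mul (measurable_monomial φ x k.1)
  have hζ1 : ∀ u k, |ζ u k| ≤ 1 := fun u k =>
    abs_nbhdInd_mul_le zero_le_one fun h => abs_monomial_le_one φ k.1 (h.le.trans hδ.le)
  have hC0 : 0 ≤ (1 - δ ^ 2)⁻¹ :=
    inv_nonneg.2 (sub_nonneg.2 (pow_le_one₀ hδ0.le hδ.le))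
  have hζC : ∀ u, ∑ k, ζ u k ^ 2 / penalty J K k ≤ (1 - δ ^ 2)⁻¹ := by
    intro u
    have e : ∑ k, ζ u k ^ 2 / penalty J K k = nbhdInd x δ u *
        ∑ k : multiIndices J K, monomial φ x k.1 u ^ 2 * (Nat.multinomial Finset.univ k.1 : ℝ) := by
      rw [Finset.mul_sum]
      refine Finset.sum_congr rfl fun k _ => ?_
      rw [hζ, penalty, div_inv_eq_mul, mul_pow, nbhdInd_sq, mul_assoc]
    rw [e]
    exact nbhdInd_mul_le hC0 fun h => sum_monomial_sq_mul_multinomial_le φ hδ0.le hδ h J K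
  have hζv : ∀ u v, (ζ u ⬝ᵥ v) ^ 2 = nbhdInd x δ u * (monomials φ x J K u ⬝ᵥ v) ^ 2 := by
    intro u v
    have e : ζ u ⬝ᵥ v = nbhdInd x δ u * (monomials φ x J K u ⬝ᵥ v) := by
      simp only [dotProduct, hζ, Finset.mul_sum, monomials, mul_assoc]
    rw [e, mul_pow, nbhdInd_sq]
  obtain ⟨E, -, hE, hEv⟩ := gram_lower_bound (P := P) (X := X) hXm
    (fun i j hij => (hmod.indep.indepFun hij).comp measurable_fst measurable_fst)
    (fun j => (hmod.identDistrib j).comp measurable_fst) hζm hζ1 n hs0 penalty_pos hζC hC0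
  rw [Fintype.card_coe] at hE
  refine ⟨E, hE, fun ω hω => ?_⟩
  have hn' : (0 : ℝ) < n := by exact_mod_cast hn
  have hc : 0 < n * μ / s := by positivity
  refine (ridgeWeights_energy_le (fun j => nbhdInd_nonneg x δ _) penalty_pos (unitZero J K) hc
    fun v => ?_).trans ?_
  · have h1 := hEv ω hω v
    simp only [hζv] at h1
    have h2 := design_second_moment (hXm 0) hδ.le hrad hB hcB hK v
    have h3 : μ * (v ⬝ᵥ unitZero J K) ^ 2 ≤
        ∫ ω, nbhdInd x δ (X 0 ω) * (monomials φ x J K (X 0 ω) ⬝ᵥ v) ^ 2 ∂P := by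
      refine le_trans ?_ h2
      rw [hμ]
      gcongr
    set G := ∫ ω, nbhdInd x δ (X 0 ω) * (monomials φ x J K (X 0 ω) ⬝ᵥ v) ^ 2 ∂P
    set M := ∑ j ∈ Finset.range n, nbhdInd x δ (X j ω) * (monomials φ x J K (X j ω) ⬝ᵥ v) ^ 2
      with hM
    have hM0 : 0 ≤ M := Finset.sum_nonneg fun j _ => mul_nonneg (nbhdInd_nonneg x δ _) (sq_nonneg _)
    set T := ∑ k, penalty J K k * v k ^ 2
    set a := (v ⬝ᵥ unitZero J K) ^ 2
    rw [div_mul_eq_mul_div, div_le_iff₀ hs0]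
    have h4 : n * (μ * a) ≤ n * G := mul_le_mul_of_nonneg_left h3 hn'.le
    nlinarith
  · rw [inv_div, div_le_iff₀ (by positivity)]
    exact hρ

/-- The error probability of the estimator for a fixed sample size, in terms of a bound `ρ` for
`e₀ᵀ (M + S)⁻¹ e₀`. -/
theorem finite_sample_bound (hmod : IsRegressionModel P X Y g σ) (hδ0 : 0 < δ) (hδ : δ < 1)
    {C : ℝ} (hC : 0 < C) (hg : HasBoundedDerivs g x δ C) {C₁ C₂ γ : ℝ} (hC₁ : 0 < C₁) (hC₂ : 0 ≤ C₂)
    (hγ : 0 < γ) (hcov : CovDecay P (X 0) x δ φ C₁ C₂ γ)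
    {c₁ c₂ p₀ : ℝ} (hc₂ : 0 < c₂) (hp₀ : 0 < p₀) (hp : p₀ ≤ P.real {ω | X 0 ω ∈ Metric.ball x δ})
    {J K n : ℕ} (hrad : RadialDensityCondition P (X 0) x δ φ c₁ c₂ J) (hK : 0 < K) (hn : 0 < n)
    {B : ℝ} (hB : 1 ≤ B) (hcB : c₁ * J ≤ B) {s ρ lam : ℝ} (hs : 2 ≤ s) (hρ0 : 0 < ρ) (hρ1 : ρ ≤ 1)
    (hρ : s ≤ ρ * (n * (p₀ / c₂ / 3 * smallValueLevel K B ^ 2))) (hlam : 0 < lam)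
    (hshrink : 9 * (ρ * (C ^ 2 * Real.exp (2 * √J))) ≤ lam) :
    P.real {ω | lam < |estimator φ x δ J K n (fun j => X j ω) (fun j => Y j ω) - g x| ^ 2} ≤
      4 * (1 - δ ^ 2)⁻¹ * (multiIndices J K).card / s +
        ρ * (18 * C ^ 2 * (n * (C₂ * Real.exp (-(C₁ * (J : ℝ) ^ γ)) +
          ((K - 1).factorial : ℝ)⁻¹ ^ 2)) + 9 * σ ^ 2) / lam := by
  obtain ⟨E, hE, hEρ⟩ :=
    exists_event_designWeights_le hmod hδ0 hδ hc₂ hp₀ hp hrad hK hn hB hcB hs hρ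
  have hXm := hmod.measurable_X
  set θ := taylorCoeff g x φ J K with hθ
  set fac : ℝ := ((K - 1).factorial : ℝ)⁻¹ with hfac
  have hfac0 : 0 ≤ fac := by positivity
  -- the truncation error of a design point
  set t : L2 → ℝ := fun u => nbhdInd x δ u * ‖u - x - truncate φ J (u - x)‖ ^ 2 with ht
  have htm : Measurable t := by
    have : Continuous fun u : L2 => ‖u - x - truncate φ J (u - x)‖ ^ 2 := by
      unfold truncate
      simp only [coords]
      fun_prop
    exact (measurable_nbhdInd x δ).mul this.measurable
  have ht0 : ∀ u, 0 ≤ t u := fun u => mul_nonneg (nbhdInd_nonneg x δ u) (sq_nonneg _)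
  have ht4 : ∀ u, |t u| ≤ 4 := fun u => abs_nbhdInd_mul_le (by norm_num) fun h => by
    have h1 : ‖u - x - truncate φ J (u - x)‖ ≤ 2 :=
      (norm_sub_le _ _).trans (by linarith [norm_truncate_le φ J (u - x)])
    rw [abs_of_nonneg (sq_nonneg _)]
    nlinarith [norm_nonneg (u - x - truncate φ J (u - x))]
  have hti : ∀ j, Integrable (fun ω => t (X j ω)) P := fun j =>
    integrable_comp_of_bounded (hXm j) htm ht4
  set F : Ω → ℝ := fun ω => ∑ j ∈ Finset.range n, t (X j ω) + n * fac ^ 2 with hF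
  have hF0 : ∀ ω, 0 ≤ F ω :=
    fun ω => add_nonneg (Finset.sum_nonneg fun j _ => ht0 _) (by positivity)
  have hFi : Integrable F P :=
    (integrable_finsetSum _ fun j _ => hti j).add (integrable_const _)
  have hFmean : ∫ ω, F ω ∂P ≤ n * (C₂ * Real.exp (-(C₁ * (J : ℝ) ^ γ)) + fac ^ 2) := by
    have h1 := integral_truncation_error_le (P := P) (hXm 0) hC₁ hC₂ hγ hcov J
    have h2 : ∀ j, ∫ ω, t (X j ω) ∂P = ∫ ω, t (X 0 ω) ∂P := fun j =>
      (((hmod.identDistrib j).comp measurable_fst).comp htm).integral_eq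
    rw [hF, integral_add (integrable_finsetSum _ fun j _ => hti j) (integrable_const _),
      integral_finsetSum _ fun j _ => hti j, integral_const]
    simp only [h2, Finset.sum_const, Finset.card_range, nsmul_eq_mul, probReal_univ, one_smul]
    rw [mul_add]
    gcongr
  set N : Ω → ℝ := fun ω => (∑ j ∈ Finset.range n,
    noiseCoeff φ x δ J K n ρ j (fun k => X k ω) * (Y j ω - g (X j ω))) ^ 2 with hN
  have : Inhabited L2 := ⟨0⟩
  obtain ⟨hNi, hNmean⟩ := noise_second_moment (P := P) hXm hmod.measurable_Y hmod.measurable_g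
    hmod.indep hmod.memLp_error hmod.centered hmod.variance_le
    (measurable_noiseCoeff φ x δ J K n ρ) (abs_noiseCoeff_le_one φ x δ J K n hρ0.le hρ1)
    (n := n) fun j u u' h => by
      by_cases hj : j < n
      · simp only [noiseCoeff, designWeights_congr φ x δ J K h, h j hj]
      · simp only [noiseCoeff, hj, false_and, if_false]
  have hNmean' : ∫ ω, N ω ∂P ≤ σ ^ 2 * ρ := by
    refine hNmean.trans (mul_le_mul_of_nonneg_left ?_ (sq_nonneg σ))
    calc ∫ ω, ∑ j ∈ Finset.range n, noiseCoeff φ x δ J K n ρ j (fun k => X k ω) ^ 2 ∂P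
        ≤ ∫ _, ρ ∂P := integral_mono_of_nonneg
          (ae_of_all _ fun ω => Finset.sum_nonneg fun j _ => sq_nonneg _) (integrable_const _)
          (ae_of_all _ fun ω => sum_noiseCoeff_sq_le φ x δ J K n hρ0.le _)
      _ = ρ := by simp
  have hsub : {ω | lam < |estimator φ x δ J K n (fun j => X j ω) (fun j => Y j ω) - g x| ^ 2} ⊆
      Eᶜ ∪ ({ω | lam / (18 * C ^ 2 * ρ) ≤ F ω} ∪ {ω | lam / 9 ≤ N ω}) := by
    intro ω hω
    by_contra hcon
    simp only [Set.mem_union, Set.mem_compl_iff, Set.mem_ofPred_eq, not_or, not_not, not_le] at hcon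
    obtain ⟨hωE, hωF, hωN⟩ := hcon
    have hD := hEρ ω hωE
    set r : ℕ → ℝ := fun j => g (X j ω) - monomials φ x J K (X j ω) ⬝ᵥ θ with hr
    have herr := ridge_error_sq_le (s := Finset.range n) (w := fun j => nbhdInd x δ (X j ω))
      (ξ := fun j => monomials φ x J K (X j ω)) (d := penalty J K)
      (fun j => nbhdInd_nonneg x δ _) penalty_pos (unitZero J K) θ
      (Y := fun j => Y j ω) (r := r) (ε := fun j => Y j ω - g (X j ω))
      fun j => by rw [hr]; ring
    rw [unitZero_dotProduct_taylorCoeff g x φ J hK] at herr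
    have hv : ridgeWeights (Finset.range n) (fun j => nbhdInd x δ (X j ω))
      (fun j => monomials φ x J K (X j ω)) (penalty J K) (unitZero J K) =
        designWeights φ x δ J K n fun j => X j ω := rfl
    rw [hv] at herr
    set D := designWeights φ x δ J K n (fun j => X j ω) ⬝ᵥ unitZero J K with hDdef
    have hnoise : (∑ j ∈ Finset.range n, nbhdInd x δ (X j ω) *
        (monomials φ x J K (X j ω) ⬝ᵥ designWeights φ x δ J K n fun j => X j ω) *
          (Y j ω - g (X j ω))) ^ 2 = N ω := by
      rw [hN]
      congr 1
      refine Finset.sum_congr rfl fun j hj => ?_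
      rw [noiseCoeff, if_pos ⟨Finset.mem_range.1 hj, hD⟩]
    rw [hnoise] at herr
    have hpen : ∑ k, penalty J K k * θ k ^ 2 ≤ C ^ 2 * Real.exp (2 * √J) :=
      sum_taylorCoeff_sq_div_multinomial_le hg hδ0 φ J K
    have hres : ∑ j ∈ Finset.range n, nbhdInd x δ (X j ω) * r j ^ 2 ≤ 2 * C ^ 2 * F ω := by
      have hj : ∀ j ∈ Finset.range n, nbhdInd x δ (X j ω) * r j ^ 2 ≤
          2 * C ^ 2 * (t (X j ω) + fac ^ 2) := by
        intro j _
        by_cases hu : X j ω ∈ Metric.ball x δ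
        · have h1 := abs_sub_monomials_dotProduct_le hg hδ.le φ J hK
            (u := X j ω) (by simpa [dist_eq_norm] using hu)
          simp only [ht, nbhdInd, Set.indicator_of_mem hu, one_mul]
          have h2 := pow_le_pow_left₀ (abs_nonneg _) h1 2
          rw [sq_abs] at h2
          refine h2.trans ?_
          rw [← hfac]
          nlinarith [sq_nonneg (‖X j ω - x - truncate φ J (X j ω - x)‖ - fac), sq_nonneg C,
            mul_nonneg (sq_nonneg C)
              (sq_nonneg (‖X j ω - x - truncate φ J (X j ω - x)‖ - fac))]
        · rw [nbhdInd, Set.indicator_of_notMem hu, zero_mul]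
          have := ht0 (X j ω)
          positivity
      refine (Finset.sum_le_sum hj).trans (le_of_eq ?_)
      rw [← Finset.mul_sum, Finset.sum_add_distrib, Finset.sum_const, Finset.card_range,
        nsmul_eq_mul]
    have hpen0 : 0 ≤ ∑ k, penalty J K k * θ k ^ 2 :=
      Finset.sum_nonneg fun k _ => mul_nonneg (penalty_pos k).le (sq_nonneg _)
    have hres0 : 0 ≤ ∑ j ∈ Finset.range n, nbhdInd x δ (X j ω) * r j ^ 2 :=
      Finset.sum_nonneg fun j _ => mul_nonneg (nbhdInd_nonneg x δ _) (sq_nonneg _)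
    have b1 : D * ∑ k, penalty J K k * θ k ^ 2 ≤ ρ * (C ^ 2 * Real.exp (2 * √J)) :=
      mul_le_mul hD hpen hpen0 hρ0.le
    have b2 : D * ∑ j ∈ Finset.range n, nbhdInd x δ (X j ω) * r j ^ 2 ≤ ρ * (2 * C ^ 2 * F ω) :=
      mul_le_mul hD hres hres0 hρ0.le
    rw [lt_div_iff₀ (by positivity)] at hωF
    have hω' : lam < (estimator φ x δ J K n (fun j => X j ω) (fun j => Y j ω) - g x) ^ 2 := by
      rw [← sq_abs]
      exact hω
    have hest : (estimator φ x δ J K n (fun j => X j ω) (fun j => Y j ω) - g x) ^ 2 ≤ _ := herr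
    have b3 : ρ * (2 * C ^ 2 * F ω) < lam / 9 := by
      rw [lt_div_iff₀ (by norm_num)]
      linarith
    linarith
  have hPF : P.real {ω | lam / (18 * C ^ 2 * ρ) ≤ F ω} ≤ 18 * C ^ 2 * ρ / lam *
      (n * (C₂ * Real.exp (-(C₁ * (J : ℝ) ^ γ)) + fac ^ 2)) := by
    have h := (mul_meas_ge_le_integral_of_nonneg (μ := P) (ae_of_all _ hF0) hFi
      (lam / (18 * C ^ 2 * ρ))).trans hFmean
    rw [mul_comm, ← le_div_iff₀ (by positivity)] at h
    refine h.trans (le_of_eq ?_)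
    rw [div_div_eq_mul_div]
    ring
  have hPN : P.real {ω | lam / 9 ≤ N ω} ≤ 9 / lam * (σ ^ 2 * ρ) := by
    have h := (mul_meas_ge_le_integral_of_nonneg (μ := P) (ae_of_all _ fun ω => sq_nonneg _) hNi
      (lam / 9)).trans hNmean'
    rw [mul_comm, ← le_div_iff₀ (by positivity)] at h
    refine h.trans (le_of_eq ?_)
    rw [div_div_eq_mul_div]
    ring
  calc P.real {ω | lam < |estimator φ x δ J K n (fun j => X j ω) (fun j => Y j ω) - g x| ^ 2}
      ≤ P.real (Eᶜ ∪ ({ω | lam / (18 * C ^ 2 * ρ) ≤ F ω} ∪ {ω | lam / 9 ≤ N ω})) :=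
        measureReal_mono hsub
    _ ≤ P.real Eᶜ + (P.real {ω | lam / (18 * C ^ 2 * ρ) ≤ F ω} + P.real {ω | lam / 9 ≤ N ω}) :=
        (measureReal_union_le _ _).trans (add_le_add le_rfl (measureReal_union_le _ _))
    _ ≤ 4 * (1 - δ ^ 2)⁻¹ * (multiIndices J K).card / s +
        (18 * C ^ 2 * ρ / lam * (n * (C₂ * Real.exp (-(C₁ * (J : ℝ) ^ γ)) + fac ^ 2)) +
          9 / lam * (σ ^ 2 * ρ)) := add_le_add hE (add_le_add hPF hPN)
    _ = _ := by ring

end FiniteSample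

/-! ### Growth of the tuning parameters -/

section Asymptotics

theorem card_multiIndices_le (J K : ℕ) : (multiIndices J K).card ≤ K ^ J := by
  refine (Finset.card_filter_le _ _).trans ?_
  simp [Fintype.card_piFinset]

theorem tendsto_log_natCast : Tendsto (fun n : ℕ => Real.log n) atTop atTop :=
  Real.tendsto_log_atTop.comp tendsto_natCast_atTop_atTop

theorem tendsto_div_log_atTop : Tendsto (fun t : ℝ => t / Real.log t) atTop atTop := by
  have h := (Real.isLittleO_log_id_atTop.tendsto_div_nhds_zero)
  have h2 : Tendsto (fun t : ℝ => Real.log t / t) atTop (𝓝[>] 0) := by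
    refine tendsto_nhdsWithin_iff.2 ⟨h, ?_⟩
    filter_upwards [eventually_gt_atTop (1 : ℝ)] with t ht
    exact div_pos (Real.log_pos ht) (by linarith)
  refine h2.inv_tendsto_nhdsGT_zero.congr fun t => ?_
  simp

/-- Terms which are of smaller order than `t`. -/
theorem eventually_lower_order_le {D₀ : ℝ} (hD₀ : D₀ < 1) (A c : ℝ) {η : ℝ} (hη : 0 < η) :
    ∀ᶠ t : ℝ in atTop, A * t ^ D₀ * Real.log t + 2 * (A * t ^ D₀) + c * (t / Real.log t) ≤
      η * t := by
  have h1 : (fun t : ℝ => t ^ D₀ * Real.log t) =o[atTop] fun t : ℝ => t := by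
    have := (Asymptotics.isBigO_refl (fun t : ℝ => t ^ D₀) atTop).mul_isLittleO
      (isLittleO_log_rpow_atTop (sub_pos.2 hD₀))
    refine this.congr' EventuallyEq.rfl ?_
    filter_upwards [eventually_gt_atTop (0 : ℝ)] with t ht
    rw [← Real.rpow_add ht]
    simp
  have h2 : (fun t : ℝ => t ^ D₀) =o[atTop] fun t : ℝ => t := by
    have hl := (Asymptotics.isLittleO_one_iff ℝ).2 (tendsto_rpow_neg_atTop (sub_pos.2 hD₀))
    have := (Asymptotics.isBigO_refl (fun t : ℝ => t) atTop).mul_isLittleO hl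
    simp only [mul_one] at this
    refine this.congr' ?_ EventuallyEq.rfl
    filter_upwards [eventually_gt_atTop (0 : ℝ)] with t ht
    nth_rewrite 1 [← Real.rpow_one t]
    rw [← Real.rpow_add ht]
    ring_nf
  have h3 : (fun t : ℝ => t / Real.log t) =o[atTop] fun t : ℝ => t := by
    have hl : Tendsto (fun t : ℝ => (Real.log t)⁻¹) atTop (𝓝 0) :=
      Real.tendsto_log_atTop.inv_tendsto_atTop
    have := (Asymptotics.isBigO_refl (fun t : ℝ => t) atTop).mul_isLittleO
      ((Asymptotics.isLittleO_one_iff ℝ).2 hl)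
    simpa [div_eq_mul_inv] using this
  have h := ((h1.const_mul_left A).add (h2.const_mul_left (2 * A))).add (h3.const_mul_left c)
  filter_upwards [h.bound hη, eventually_gt_atTop (0 : ℝ)] with t ht h0
  rw [Real.norm_of_nonneg h0.le] at ht
  refine le_trans (le_of_eq ?_) ((le_abs_self _).trans ht)
  ring

/-- The cost of the estimator: the number of monomials and the reciprocal of the smallest value of
the normalized design matrix grow more slowly than the power `n ^ (1 - κ)`. -/
theorem eventually_cost_le {c₁ D₀ D₁ κ : ℝ} (hc₁ : 0 < c₁) (hD₀ : D₀ < 1) (hD₁ : 0 < D₁)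
    (hκ : κ < 1 - 3 * D₀ * D₁) {J : ℕ → ℕ}
    (hJ : (fun n : ℕ => (J n : ℝ)) =O[atTop] fun n : ℕ => Real.log n ^ D₀) (hD₀' : 0 < D₀)
    {η : ℝ} (hη : 0 < η) :
    ∀ᶠ n : ℕ in atTop, (n : ℝ) ^ κ * ((n : ℝ)⁻¹ * ((degreeParam D₁ n : ℝ) ^ J n *
      Real.exp (2 * √(J n : ℝ)) *
        Real.exp (3 * degreeParam D₁ n * (Real.log (2 * max 1 (c₁ * J n)) + 2)))) ≤ η := by
  obtain ⟨A, hA, hJA⟩ := hJ.exists_pos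
  have hτ : 0 < (1 - κ - 3 * D₀ * D₁) / 2 := by linarith
  set τ := (1 - κ - 3 * D₀ * D₁) / 2 with hτdef
  set c := Real.log (2 * (1 + c₁ * A)) + 2 with hc
  have hsmall : Tendsto (fun n : ℕ => Real.exp (-(τ * Real.log n))) atTop (𝓝 0) :=
    Real.tendsto_exp_neg_atTop_nhds_zero.comp (tendsto_log_natCast.const_mul_atTop hτ)
  have hlog := Real.tendsto_log_atTop.comp tendsto_log_natCast
  filter_upwards [hJA.bound, tendsto_log_natCast.eventually
    (eventually_lower_order_le hD₀ A (3 * D₁ * c) hτ), hlog.eventually_ge_atTop D₁,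
    tendsto_log_natCast.eventually_ge_atTop 1, hlog.eventually_gt_atTop 0,
    hsmall.eventually_le_const hη, eventually_gt_atTop 0] with n hJn hlow hlD hL1 hl0 hη' hn
  have hn0 : (0 : ℝ) < n := by exact_mod_cast hn
  simp only [Function.comp_apply] at hlD hl0
  refine le_trans ?_ hη'
  set L := Real.log n with hL
  set l := Real.log L with hl
  set K := degreeParam D₁ n with hK
  have hLp : 1 ≤ L ^ D₀ := Real.one_le_rpow hL1 hD₀'.le
  rw [Real.norm_of_nonneg (Nat.cast_nonneg _), Real.norm_of_nonneg (by linarith)] at hJn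
  have hKle : (K : ℝ) ≤ D₁ * L / l := Nat.floor_le (by positivity)
  have hKL : (K : ℝ) ≤ L := by
    refine hKle.trans ?_
    rw [div_le_iff₀ hl0]
    nlinarith
  have hpow : (K : ℝ) ^ J n ≤ Real.exp (A * L ^ D₀ * l) := by
    calc (K : ℝ) ^ J n ≤ L ^ J n := pow_le_pow_left₀ (Nat.cast_nonneg _) hKL _
      _ = Real.exp (J n * l) := by
        rw [mul_comm, Real.exp_mul, Real.exp_log (by linarith), Real.rpow_natCast]
      _ ≤ _ := Real.exp_le_exp.2 (mul_le_mul_of_nonneg_right hJn hl0.le)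
  have hsqrt : √(J n : ℝ) ≤ A * L ^ D₀ := by
    refine le_trans ?_ hJn
    rcases Nat.eq_zero_or_pos (J n) with h | h
    · simp [h]
    · exact Real.sqrt_le_left (by positivity) |>.2 (by
        have : (1 : ℝ) ≤ J n := by exact_mod_cast h
        nlinarith)
  have hB : max 1 (c₁ * J n) ≤ (1 + c₁ * A) * L ^ D₀ := by
    have h0 : 0 < c₁ * A := mul_pos hc₁ hA
    refine max_le (by nlinarith) ?_
    have := mul_le_mul_of_nonneg_left hJn hc₁.le
    nlinarith
  have hlogB : Real.log (2 * max 1 (c₁ * J n)) + 2 ≤ D₀ * l + c := by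
    have h1 : 0 < 2 * max 1 (c₁ * J n) := by
      have := le_max_left 1 (c₁ * J n)
      linarith
    have h2 := Real.log_le_log h1 (mul_le_mul_of_nonneg_left hB zero_le_two)
    rw [← mul_assoc, Real.log_mul (x := 2 * (1 + c₁ * A)) (by positivity) (by positivity),
      Real.log_rpow (by linarith)] at h2
    rw [hc]
    linarith
  have hlogB0 : 0 ≤ Real.log (2 * max 1 (c₁ * J n)) + 2 := by
    have : 0 ≤ Real.log (2 * max 1 (c₁ * J n)) := Real.log_nonneg (by
      have := le_max_left 1 (c₁ * J n)
      linarith)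
    linarith
  have hmain : 3 * K * (Real.log (2 * max 1 (c₁ * J n)) + 2) ≤
      3 * D₀ * D₁ * L + 3 * D₁ * c * (L / l) := by
    calc 3 * K * (Real.log (2 * max 1 (c₁ * J n)) + 2)
        ≤ 3 * (D₁ * L / l) * (D₀ * l + c) := by gcongr
      _ = 3 * D₀ * D₁ * L + 3 * D₁ * c * (L / l) := by
        field_simp
  have hn1 : (n : ℝ) ^ κ * (n : ℝ)⁻¹ = Real.exp (L * (κ - 1)) := by
    rw [Real.exp_mul, hL, Real.exp_log hn0, Real.rpow_sub hn0, Real.rpow_one, div_eq_mul_inv]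
  rw [← mul_assoc, hn1]
  calc Real.exp (L * (κ - 1)) * ((K : ℝ) ^ J n * Real.exp (2 * √(J n : ℝ)) *
        Real.exp (3 * K * (Real.log (2 * max 1 (c₁ * J n)) + 2)))
      ≤ Real.exp (L * (κ - 1)) * (Real.exp (A * L ^ D₀ * l) * Real.exp (2 * (A * L ^ D₀)) *
        Real.exp (3 * D₀ * D₁ * L + 3 * D₁ * c * (L / l))) := by gcongr
    _ = Real.exp (L * (κ - 1) + (A * L ^ D₀ * l + 2 * (A * L ^ D₀) +
        (3 * D₀ * D₁ * L + 3 * D₁ * c * (L / l)))) := by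
      simp only [Real.exp_add]
    _ ≤ Real.exp (-(τ * L)) := by
      refine Real.exp_le_exp.2 ?_
      have : τ * L = (1 - κ - 3 * D₀ * D₁) / 2 * L := rfl
      linarith

/-- The truncation of the covariates to `J` coordinates is negligible. -/
theorem eventually_mul_exp_neg_le_one {C γ D₀ : ℝ} (hC : 0 < C) (hγ : 0 < γ) (hγD : 1 < γ * D₀)
    {J : ℕ → ℕ} (hJ : (fun n : ℕ => Real.log n ^ D₀) =O[atTop] fun n : ℕ => (J n : ℝ)) :
    ∀ᶠ n : ℕ in atTop, (n : ℝ) * Real.exp (-(C * (J n : ℝ) ^ γ)) ≤ 1 := by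
  obtain ⟨A, hA, hJA⟩ := hJ.exists_pos
  have hpow := (tendsto_rpow_atTop (sub_pos.2 hγD)).comp tendsto_log_natCast
  filter_upwards [hJA.bound, hpow.eventually_ge_atTop (A ^ γ / C),
    tendsto_log_natCast.eventually_gt_atTop 0, eventually_gt_atTop 0] with n hJn hp hL hn
  have hn0 : (0 : ℝ) < n := by exact_mod_cast hn
  simp only [Function.comp_apply] at hp
  set L := Real.log n with hLdef
  rw [Real.norm_of_nonneg (by positivity), Real.norm_of_nonneg (Nat.cast_nonneg _)] at hJn
  have h1 : L ^ (γ * D₀) ≤ A ^ γ * (J n : ℝ) ^ γ := by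
    have := Real.rpow_le_rpow (by positivity) hJn hγ.le
    rwa [← Real.rpow_mul hL.le, Real.mul_rpow hA.le (Nat.cast_nonneg _), mul_comm D₀] at this
  rw [Real.rpow_sub hL, Real.rpow_one, div_le_div_iff₀ hC hL] at hp
  have h2 : L ≤ C * (J n : ℝ) ^ γ := by
    have hAγ : 0 < A ^ γ := by positivity
    have : A ^ γ * L ≤ A ^ γ * (C * (J n : ℝ) ^ γ) := by nlinarith
    exact le_of_mul_le_mul_left this hAγ
  calc (n : ℝ) * Real.exp (-(C * (J n : ℝ) ^ γ)) = Real.exp (L - C * (J n : ℝ) ^ γ) := by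
        rw [sub_eq_add_neg, Real.exp_add, hLdef, Real.exp_log hn0]
    _ ≤ 1 := Real.exp_le_one_iff.2 (by linarith)

theorem eventually_degreeParam_pred_ge {D D₁ : ℝ} (hD0 : 0 ≤ D) (hD : D < D₁) :
    ∀ᶠ n : ℕ in atTop, 0 < degreeParam D₁ n ∧
      D * (Real.log n / Real.log (Real.log n)) ≤ ((degreeParam D₁ n - 1 : ℕ) : ℝ) := by
  have h := ((tendsto_div_log_atTop.comp tendsto_log_natCast).const_mul_atTop
    (sub_pos.2 hD)).eventually_ge_atTop 2
  filter_upwards [h, (tendsto_div_log_atTop.comp tendsto_log_natCast).eventually_ge_atTop 0] with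
    n hn hn0
  simp only [Function.comp_apply] at hn hn0
  have hDn := mul_nonneg hD0 hn0
  have h0 : 0 < degreeParam D₁ n := Nat.floor_pos.2 (by rw [mul_div_assoc]; linarith)
  have h1 : D₁ * Real.log n / Real.log (Real.log n) < degreeParam D₁ n + 1 :=
    Nat.lt_floor_add_one _
  rw [mul_div_assoc] at h1
  refine ⟨h0, ?_⟩
  rw [Nat.cast_sub h0]
  push_cast
  linarith

/-- The remainder of the Taylor polynomial of degree `K - 1` is negligible. -/
theorem eventually_mul_factorial_inv_le_one {D₁ : ℝ} (hD₁ : 1 < 2 * D₁) :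
    ∀ᶠ n : ℕ in atTop, (n : ℝ) * (((degreeParam D₁ n - 1).factorial : ℝ)⁻¹) ^ 2 ≤ 1 := by
  obtain ⟨D, hD, hDD⟩ := exists_between (show 1 / 2 < D₁ by linarith)
  have hD0 : 0 < D := by linarith
  have hlog := Real.tendsto_log_atTop.comp tendsto_log_natCast
  have hlow : ∀ᶠ l : ℝ in atTop, Real.log l + (1 - Real.log D) ≤ (1 - 1 / (2 * D)) * l := by
    have hη : 0 < 1 - 1 / (2 * D) := by
      rw [sub_pos, div_lt_one (by positivity)]
      linarith
    have h := (Real.isLittleO_log_id_atTop.add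
      (Asymptotics.isLittleO_const_id_atTop (1 - Real.log D))).bound hη
    filter_upwards [h, eventually_ge_atTop 0] with l hl hl0
    rw [id, Real.norm_of_nonneg hl0] at hl
    exact (le_abs_self _).trans hl
  filter_upwards [eventually_degreeParam_pred_ge hD0.le hDD, hlog.eventually hlow,
    hlog.eventually_gt_atTop 0, tendsto_log_natCast.eventually_gt_atTop 0,
    eventually_gt_atTop 0] with n hk hl hl0 hL hn
  have hn0 : (0 : ℝ) < n := by exact_mod_cast hn
  simp only [Function.comp_apply] at hl hl0
  obtain ⟨-, hk⟩ := hk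
  set k := degreeParam D₁ n - 1
  set L := Real.log n with hLdef
  set l := Real.log L with hldef
  have hy : 0 < D * (L / l) := by positivity
  have hk0 : (0 : ℝ) < k := hy.trans_le hk
  have hlogk : l - Real.log l + Real.log D ≤ Real.log k := by
    have := Real.log_le_log hy hk
    rw [Real.log_mul hD0.ne' (by positivity), Real.log_div hL.ne' hl0.ne'] at this
    linarith
  have h1 : L / 2 ≤ k * (Real.log k - 1) := by
    have h2 : 1 / (2 * D) * l ≤ Real.log k - 1 := by linarith
    calc L / 2 = D * (L / l) * (1 / (2 * D) * l) := by field_simp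
      _ ≤ k * (Real.log k - 1) := mul_le_mul hk h2 (by positivity) hk0.le
  have h2 := Real.pow_div_factorial_le_exp (k : ℝ) hk0.le k
  have hf : (0 : ℝ) < (k.factorial : ℝ) := by exact_mod_cast k.factorial_pos
  rw [div_le_iff₀ hf] at h2
  have h3 : Real.exp (L / 2) ≤ (k.factorial : ℝ) := by
    refine (Real.exp_le_exp.2 h1).trans ?_
    have e : Real.exp (k * (Real.log k - 1)) * Real.exp k = (k : ℝ) ^ k := by
      rw [← Real.exp_add, mul_sub, mul_one, sub_add_cancel, mul_comm, Real.exp_mul,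
        Real.exp_log hk0, Real.rpow_natCast]
    have := Real.exp_pos (k : ℝ)
    rw [← e, mul_comm] at h2
    exact le_of_mul_le_mul_left h2 this
  have h4 : (n : ℝ) ≤ (k.factorial : ℝ) ^ 2 := by
    calc (n : ℝ) = Real.exp (L / 2) ^ 2 := by
          rw [← Real.exp_nat_mul]
          push_cast
          rw [mul_div_cancel₀ _ two_ne_zero, hLdef, Real.exp_log hn0]
      _ ≤ _ := pow_le_pow_left₀ (Real.exp_pos _).le h3 2
  rw [inv_pow, ← div_eq_mul_inv]
  exact (div_le_one (by positivity)).2 h4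

end Asymptotics

/-! ### The rate of convergence -/

theorem exists_tuningConditions {c₁ : ℝ} (hc₁ : 0 < c₁) : ∃ γ₀ : ℝ, 0 < γ₀ ∧ ∀ γ : ℝ, γ₀ < γ →
    ∃ D₀ D₁ : ℝ, 0 < D₀ ∧ 0 < D₁ ∧ TuningConditions c₁ γ D₀ D₁ := by
  -- `(4 c₁ + 1) D₀` is just below `1 / 4`, and `D₁` is the reciprocal of `(8 c₁ + 4) D₀`
  refine ⟨16 * c₁ + 5, by positivity, fun γ hγ =>
    ⟨1 / (16 * c₁ + 5), (16 * c₁ + 5) / (8 * c₁ + 4), by positivity, by positivity, ?_⟩⟩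
  have h1 : 0 < 16 * c₁ + 5 := by positivity
  have h2 : 0 < 8 * c₁ + 4 := by positivity
  refine ⟨?_, ?_, ?_, ?_⟩
  · rw [mul_one_div, one_lt_div h1]
    exact hγ
  · rw [mul_one_div, div_lt_one h1]
    linarith
  · have e : 2 * ((16 * c₁ + 5) / (8 * c₁ + 4)) * (1 - (4 * c₁ + 1) * (1 / (16 * c₁ + 5))) =
        (24 * c₁ + 8) / (8 * c₁ + 4) := by
      field_simp
      ring
    rw [e, one_lt_div h2]
    linarith
  · have e : (8 * c₁ + 3) * (1 / (16 * c₁ + 5)) * ((16 * c₁ + 5) / (8 * c₁ + 4)) =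
        (8 * c₁ + 3) / (8 * c₁ + 4) := by
      field_simp
    rw [e, div_lt_one h2]
    linarith

/-- The bound of `finite_sample_bound`, with `ρ` chosen in terms of the cost `Q` of the
estimator. -/
theorem error_probability_le {Ω : Type*} [MeasurableSpace Ω] {P : Measure Ω}
    [IsProbabilityMeasure P] {X : ℕ → Ω → L2} {Y : ℕ → Ω → ℝ} {g : L2 → ℝ} {σ : ℝ} {x : L2} {δ : ℝ}
    {φ : HilbertBasis ℕ ℝ L2} (hmod : IsRegressionModel P X Y g σ) (hδ0 : 0 < δ) (hδ : δ < 1)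
    {C : ℝ} (hC : 0 < C) (hg : HasBoundedDerivs g x δ C) {C₁ C₂ γ : ℝ} (hC₁ : 0 < C₁) (hC₂ : 0 < C₂)
    (hγ : 0 < γ) (hcov : CovDecay P (X 0) x δ φ C₁ C₂ γ)
    {c₁ c₂ p₀ : ℝ} (hc₂ : 0 < c₂) (hp₀ : 0 < p₀) (hp : p₀ ≤ P.real {ω | X 0 ω ∈ Metric.ball x δ})
    {J K n : ℕ} (hrad : RadialDensityCondition P (X 0) x δ φ c₁ c₂ J) (hK : 0 < K) (hn : 0 < n)
    {κ ε : ℝ} (hκ : 0 ≤ κ) (hε : 0 < ε)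
    (htrunc : (n : ℝ) * Real.exp (-(C₁ * (J : ℝ) ^ γ)) ≤ 1)
    (htaylor : (n : ℝ) * (((K - 1).factorial : ℝ)⁻¹) ^ 2 ≤ 1) {Q : ℝ}
    (hQ : (n : ℝ) ^ κ * ((n : ℝ)⁻¹ * ((K : ℝ) ^ J * Real.exp (2 * √(J : ℝ)) *
      Real.exp (3 * K * (Real.log (2 * max 1 (c₁ * J)) + 2)))) ≤ Q) {q : ℝ}
    (hq : (12 * (1 - δ ^ 2)⁻¹ / ε + 2) / (p₀ / c₂ / 3) * Q ≤ q) (hq1 : q ≤ 1)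
    (hqC : 9 * C ^ 2 * q ≤ 1) (hqε : q * (18 * C ^ 2 * (C₂ + 1) + 9 * σ ^ 2) ≤ ε / 2) :
    P.real {ω | (n : ℝ) ^ (-κ) <
      |estimator φ x δ J K n (fun j => X j ω) (fun j => Y j ω) - g x| ^ 2} ≤ ε := by
  have hn0 : (0 : ℝ) < n := by exact_mod_cast hn
  have hn1 : (1 : ℝ) ≤ n := by exact_mod_cast hn
  set B := max 1 (c₁ * J) with hB
  set m := p₀ / c₂ / 3 with hm
  have hm0 : 0 < m := by positivity
  set A := (1 - δ ^ 2)⁻¹ with hA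
  have hA0 : 0 ≤ A := inv_nonneg.2 (sub_nonneg.2 (pow_le_one₀ hδ0.le hδ.le))
  set N : ℝ := ((multiIndices J K).card : ℝ) with hN
  have hN0 : 0 ≤ N := Nat.cast_nonneg _
  have hNK : N ≤ (K : ℝ) ^ J := by 
    rw [hN]
    exact_mod_cast card_multiIndices_le J K
  have hKJ : (1 : ℝ) ≤ (K : ℝ) ^ J := one_le_pow₀ (by exact_mod_cast hK)
  set V := Real.exp (3 * K * (Real.log (2 * B) + 2)) with hV
  have hV0 : 0 < V := Real.exp_pos _
  have hVv : smallValueLevel K B ^ 2 = V⁻¹ := by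
    rw [smallValueLevel, hV, ← Real.exp_neg, ← Real.exp_nat_mul]
    congr 1
    push_cast
    ring
  -- the exceptional event of `finite_sample_bound` then has probability at most `ε / 3`
  set s := 12 * A / ε * N + 2 with hs
  have hs2 : 2 ≤ s := le_add_of_nonneg_left (by positivity)
  have hs0 : 0 < s := by linarith
  have hsK : s ≤ (12 * A / ε + 2) * (K : ℝ) ^ J := by
    have : 12 * A / ε * N ≤ 12 * A / ε * (K : ℝ) ^ J := by gcongr
    rw [hs]
    linarith
  set T := Real.exp (2 * √(J : ℝ)) with hT
  have hT1 : 1 ≤ T := Real.one_le_exp (by positivity)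
  have hnκ : 1 ≤ (n : ℝ) ^ κ := Real.one_le_rpow hn1 hκ
  set ρ := s / m * (n : ℝ)⁻¹ * V with hρ
  have hρ0 : 0 < ρ := by positivity
  -- the three requirements on `ρ` follow from this one
  have hkey : (n : ℝ) ^ κ * (ρ * T) ≤ q := by
    refine le_trans ?_ hq
    calc (n : ℝ) ^ κ * (ρ * T) = s * ((n : ℝ) ^ κ * ((n : ℝ)⁻¹ * (T * V)) / m) := by
          rw [hρ]
          ring
      _ ≤ (12 * A / ε + 2) * (K : ℝ) ^ J * ((n : ℝ) ^ κ * ((n : ℝ)⁻¹ * (T * V)) / m) := by gcongr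
      _ = (12 * A / ε + 2) / m * ((n : ℝ) ^ κ * ((n : ℝ)⁻¹ * ((K : ℝ) ^ J * T * V))) := by ring
      _ ≤ _ := by gcongr
  have hρT : ρ * T ≤ q :=
    (le_mul_of_one_le_left (by positivity) hnκ).trans hkey
  have hρq : ρ ≤ q := (le_mul_of_one_le_right hρ0.le hT1).trans hρT
  have hnρ : (n : ℝ) ^ κ * ρ ≤ q :=
    (mul_le_mul_of_nonneg_left (le_mul_of_one_le_right hρ0.le hT1) (by positivity)).trans hkey
  have h := finite_sample_bound hmod hδ0 hδ hC hg hC₁ hC₂.le hγ hcov hc₂ hp₀ hp hrad hK hn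
    (B := B) (le_max_left _ _) (le_max_right _ _) hs2 hρ0 (hρq.trans hq1)
    (by
      rw [hVv, hρ, ← hm]
      refine le_of_eq ?_
      field_simp)
    (lam := (n : ℝ) ^ (-κ)) (by positivity) (by
      rw [Real.rpow_neg hn0.le, ← one_div, le_div_iff₀ (by positivity)]
      calc 9 * (ρ * (C ^ 2 * T)) * (n : ℝ) ^ κ = 9 * C ^ 2 * ((n : ℝ) ^ κ * (ρ * T)) := by ring
        _ ≤ 9 * C ^ 2 * q := by gcongr
        _ ≤ 1 := hqC)
  refine h.trans ?_
  have h1 : 4 * A * N / s ≤ ε / 2 := by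
    rw [div_le_iff₀ hs0, hs]
    have : ε / 2 * (12 * A / ε * N + 2) = 6 * A * N + ε := by
      field_simp
      ring
    rw [this]
    nlinarith [mul_nonneg hA0 hN0]
  have h2 : ρ * (18 * C ^ 2 * (n * (C₂ * Real.exp (-(C₁ * (J : ℝ) ^ γ)) +
      ((K - 1).factorial : ℝ)⁻¹ ^ 2)) + 9 * σ ^ 2) / (n : ℝ) ^ (-κ) ≤ ε / 2 := by
    refine le_trans ?_ hqε
    have h3 : n * (C₂ * Real.exp (-(C₁ * (J : ℝ) ^ γ)) + ((K - 1).factorial : ℝ)⁻¹ ^ 2) ≤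
        C₂ + 1 := by
      have := mul_le_mul_of_nonneg_left htrunc hC₂.le
      rw [mul_add]
      linarith
    have h4 := mul_le_mul_of_nonneg_left h3 (show 0 ≤ 18 * C ^ 2 by positivity)
    rw [Real.rpow_neg hn0.le, div_inv_eq_mul, mul_right_comm, mul_comm ρ]
    exact mul_le_mul hnρ (by linarith) (by positivity) (hρ0.le.trans hρq)
  linarith

end FunctionalLocPoly

theorem mainTheorem2 :
    (∀ c₁ : ℝ, 0 < c₁ → ∃ γ₀ : ℝ, 0 < γ₀ ∧ ∀ γ : ℝ, γ₀ < γ →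
      ∃ D₀ D₁ : ℝ, 0 < D₀ ∧ 0 < D₁ ∧ FunctionalLocPoly.TuningConditions c₁ γ D₀ D₁) ∧
    (∀ δ σ CFre CΓ₁ CΓ₂ γ p₀ c₁ c₂ D₀ D₁ κ : ℝ,
      0 < δ → δ < 1 → 0 < σ → 0 < CFre → 0 < CΓ₁ → 0 < CΓ₂ → 0 < γ → 0 < p₀ →
      0 < c₁ → 0 < c₂ → 0 < D₀ → 0 < D₁ →
      FunctionalLocPoly.TuningConditions c₁ γ D₀ D₁ →
      κ < 1 - (8 * c₁ + 3) * D₀ * D₁ →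
      ∀ J : ℕ → ℕ,
      Asymptotics.IsTheta atTop (fun n : ℕ => (J n : ℝ)) (fun n : ℕ => Real.log n ^ D₀) →
      ∀ ε : ℝ, 0 < ε → ∃ M : ℝ, 0 < M ∧ ∀ᶠ n : ℕ in atTop,
        ∀ (Ω : Type*) [MeasurableSpace Ω] (P : Measure Ω) [IsProbabilityMeasure P]
          (X : ℕ → Ω → FunctionalLocPoly.L2) (Y : ℕ → Ω → ℝ) (g : FunctionalLocPoly.L2 → ℝ)
          (x : FunctionalLocPoly.L2) (φ : HilbertBasis ℕ ℝ FunctionalLocPoly.L2),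
          FunctionalLocPoly.IsRegressionModel P X Y g σ →
          FunctionalLocPoly.HasBoundedDerivs g x δ CFre →
          FunctionalLocPoly.CovDecay P (X 0) x δ φ CΓ₁ CΓ₂ γ →
          p₀ ≤ P.real {ω | X 0 ω ∈ Metric.ball x δ} →
          FunctionalLocPoly.RadialDensityCondition P (X 0) x δ φ c₁ c₂ (J n) →
          P.real {ω | M * (n : ℝ) ^ (-κ) <
              |FunctionalLocPoly.estimator φ x δ (J n) (FunctionalLocPoly.degreeParam D₁ n) n
                (fun j => X j ω) (fun j => Y j ω) - g x| ^ 2} ≤ ε) := by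
  refine ⟨fun c₁ hc₁ => FunctionalLocPoly.exists_tuningConditions hc₁, ?_⟩
  intro δ σ C C₁ C₂ γ p₀ c₁ c₂ D₀ D₁ κ hδ0 hδ hσ hC hC₁ hC₂ hγ hp₀ hc₁ hc₂ hD₀ hD₁ htun hκ J hJ ε hε
  refine ⟨1, one_pos, ?_⟩
  have hDD : 0 < D₀ * D₁ := mul_pos hD₀ hD₁
  have hD₀1 : D₀ < 1 := by
    have := htun.lt_one
    nlinarith [mul_pos hc₁ hD₀]
  have hD₁2 : 1 < 2 * D₁ := by
    have := htun.one_lt'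
    have h : 0 < (4 * c₁ + 1) * D₀ := by positivity
    nlinarith [mul_pos hD₁ h]
  -- it suffices to treat nonnegative exponents
  have hκ0 : 0 ≤ max κ 0 := le_max_right _ _
  have hκ' : max κ 0 < 1 - 3 * D₀ * D₁ := by
    have h1 := htun.lt_one'
    have h2 := mul_pos hc₁ hDD
    exact max_lt (by linarith) (by linarith)
  set κ' := max κ 0 with hκdef
  have ha : 0 < (12 * (1 - δ ^ 2)⁻¹ / ε + 2) / (p₀ / c₂ / 3) := by
    have : 0 ≤ (1 - δ ^ 2)⁻¹ := inv_nonneg.2 (sub_nonneg.2 (pow_le_one₀ hδ0.le hδ.le))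
    positivity
  set a := (12 * (1 - δ ^ 2)⁻¹ / ε + 2) / (p₀ / c₂ / 3)
  have hb : 0 < 18 * C ^ 2 * (C₂ + 1) + 9 * σ ^ 2 := by positivity
  set b := 18 * C ^ 2 * (C₂ + 1) + 9 * σ ^ 2
  obtain ⟨q, hq0, hq⟩ := exists_between
    (show 0 < min 1 (min (1 / (9 * C ^ 2)) (ε / 2 / b)) by positivity)
  rw [lt_min_iff, lt_min_iff, lt_div_iff₀ (by positivity), lt_div_iff₀ hb] at hq
  filter_upwards [FunctionalLocPoly.eventually_cost_le hc₁ hD₀1 hD₁ hκ' hJ.isBigO hD₀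
      (div_pos hq0 ha),
    FunctionalLocPoly.eventually_mul_exp_neg_le_one hC₁ hγ htun.one_lt hJ.isBigO_symm,
    FunctionalLocPoly.eventually_mul_factorial_inv_le_one hD₁2,
    FunctionalLocPoly.eventually_degreeParam_pred_ge le_rfl hD₁, eventually_gt_atTop 0] with
    n hcost htrunc htaylor hK hn
  intro Ω _ P _ X Y g x φ hmod hg hcov hp hrad
  have h := FunctionalLocPoly.error_probability_le hmod hδ0 hδ hC hg hC₁ hC₂ hγ hcov hc₂ hp₀ hp hrad
    hK.1 hn hκ0 hε htrunc htaylor hcost (q := q) (le_of_eq (mul_div_cancel₀ _ ha.ne')) hq.1.le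
    (by linarith [hq.2.1]) hq.2.2.le
  refine le_trans (measureReal_mono fun ω hω => ?_) h
  have hn1 : (1 : ℝ) ≤ n := by exact_mod_cast hn
  have hmono : (n : ℝ) ^ (-κ') ≤ (n : ℝ) ^ (-κ) :=
    Real.rpow_le_rpow_of_exponent_le hn1 (neg_le_neg (le_max_left _ _))
  rw [Set.mem_ofPred_eq, one_mul] at hω
  exact hmono.trans_lt hω
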